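/- **Setting.** Let $\mathfrak g$ be a finite-dimensional complex semisimple Lie algebra with adjoint group $G$, and let $\ll\,,\gg$ be a fixed symmetric, non-degenerate, ad-invariant bilinear form on $\mathfrak g$. Fix a Cartan subalgebra $\mathfrak h$, with root system $\Sigma$ and root spaces $\mathfrak g_\alpha$, a set $\Sigma^+$ of positive roots, and the corresponding set $\Gamma$ of simple roots. Put $\mathfrak n=\sum_{\alpha\in\Sigma^+}\mathfrak g_\alpha$ and $\mathfrak n^-=\sum_{\alpha\in\Sigma^+}\mathfrak g_{-\alpha}$. For $\alpha\in\Sigma$ let $H_\alpha\in\mathfrak h$ be the element with $\ll H_\alpha,x\gg=\alpha(x)$ for all $x\in\mathfrak h$, and fix root vectors $E_\alpha\in\mathfrak g_\alpha$ with $\ll E_\alpha,E_{-\alpha}\gg=1$ for $\alpha\in\Sigma^+$. For $S\subset\Gamma$ let $[S]$ be the set of roots in the linear span of $S$, and let $$\mathfrak z_S=\{x\in\mathfrak h:\alpha(x)=0\ \ \forall\alpha\in S\},\qquad \mathfrak g_S=\operatorname{span}\{H_\alpha:\alpha\in S\}+\sum_{\alpha\in[S]}\mathfrak g_\alpha,\qquad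 \mathfrak m_S=\mathfrak h+\sum_{\alpha\in[S]}\mathfrak g_\alpha=\mathfrak z_S+\mathfrak g_S,$$ $$\mathfrak n_S=\sum_{\alpha\in\Sigma^+\setminus[S]}\mathfrak g_\alpha,\qquad \mathfrak n_S^-=\sum_{\alpha\in\Sigma^+\setminus[S]}\mathfrak g_{-\alpha}.$$ Let $M_S\subset G$ be the connected subgroup with Lie algebra $\mathfrak m_S$, and let $\chi_S:\mathfrak g\to\mathfrak g_S$ be the projection with respect to $\mathfrak g=\mathfrak n_S^-+\mathfrak z_S+\mathfrak g_S+\mathfrak n_S$. Let $(S,T,d)$ be a generalized Belavin–Drinfeld triple: $S,T\subset\Gamma$, and $d:S\to T$ is a bijection with $\ll H_{d\alpha},H_{d\beta}\gg=\ll H_\alpha,H_\beta\gg$ for all $\alpha,\beta\in S$. Let $\gamma_d:\mathfrak g_S\to\mathfrak g_T$ be the unique Lie algebra isomorphism with $\gamma_d(E_\alpha)=E_{d\alpha}$ and $\gamma_d(H_\alpha)=H_{d\alpha}$ for all $\alpha\in S$. Let $V$ be a Lagrangian (maximal isotropic) subspace of $\mathfrak z_S\oplus\mathfrak z_T$ for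 the form $\langle(x_1,x_2),(y_1,y_2)\rangle=\ll x_1,y_1\gg-\ll x_2,y_2\gg$, and put $$\mathfrak l_{S,T,d,V}=V+(\mathfrak n_S\oplus\mathfrak n_T^-)+\{(x,\gamma_d(x)):x\in\mathfrak g_S\}\subset\mathfrak g\oplus\mathfrak g .$$ Let $v$ be an element of the Weyl group $W$ which has minimal length in its coset $vW_T$, where $W_T$ is generated by the reflections in the elements of $T$, and let $\dot v\in G$ be a representative of $v$ in the normalizer of $\mathfrak h$. Let $S(v,d)$ be the largest subset of $S$ that is invariant under $vd$, let $m\in M_{S(v,d)}$, and put $$\mathfrak l=\mathfrak l_{S,T,d,V,\dot v,m}=\operatorname{Ad}_{(m,\dot v)}\mathfrak l_{S,T,d,V}.$$ Finally let $\phi=\operatorname{Ad}_{\dot v}\,\gamma_d\,\chi_S\,\operatorname{Ad}_m^{-1}:\mathfrak g\to\mathfrak g$ and $\mathfrak n_v=\mathfrak n\cap\operatorname{Ad}_{\dot v}(\mathfrak n^-)$. **Theorem.** (a) $\phi$ maps $\mathfrak g_{S(v,d)}$ into itself and equals $\operatorname{Ad}_{\dot v}\gamma_d\operatorname{Ad}_m^{-1}$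 there. Moreover $$\mathfrak z'_{S(v,d)}:=\{z\in\mathfrak z_{S(v,d)}: z-\phi(z)\in\operatorname{Ad}_{\dot v}\mathfrak z_T\}=\{z\in\mathfrak z_{S(v,d)}:\gamma_d\chi_S(z)=\chi_T(\operatorname{Ad}_{\dot v}^{-1}z)\}.$$ (b) $\mathfrak n_v\subset\mathfrak n_{S(v,d)}$, and $\phi$ maps $\mathfrak n_{S(v,d)}$ into itself and is nilpotent there; let $\psi=(1-\phi)^{-1}:\mathfrak n_{S(v,d)}\to\mathfrak n_{S(v,d)}$. (c) The normalizer $\mathfrak n(\mathfrak l)=\{x\in\mathfrak g:[(x,x),\mathfrak l]\subset\mathfrak l\}$ of $\mathfrak l$ in $\mathfrak g_\Delta\cong\mathfrak g$ is $$\mathfrak n(\mathfrak l)=\mathfrak z'_{S(v,d)}+\mathfrak g_{S(v,d)}^{\phi}+\psi(\mathfrak n_v),$$ where $\mathfrak g_{S(v,d)}^{\phi}=\{x\in\mathfrak g_{S(v,d)}:\phi(x)=x\}$. -/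

import Mathlib

noncomputable section

set_option linter.unusedSectionVars false

namespace LagrangianNormalizer

open Module LieAlgebra LieAlgebra.IsKilling LieModule
open scoped Nat

/-- A fixed symmetric non-degenerate ad-invariant bilinear form `≪ , ≫` on a complex Lie algebra.
Invariance is `≪[x, y], z≫ = -≪y, [x, z]≫`. -/
structure AdInvariantForm (g : Type*) [LieRing g] [LieAlgebra ℂ g] where
  form : LinearMap.BilinForm ℂ g
  symm : form.IsSymm
  nondegenerate : form.Nondegenerate
  invariant : form.lieInvariant g

/-! ### Lie algebras generated by elements satisfying the Chevalley relations -/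

section Generators

variable {L : Type*} [LieRing L] [LieAlgebra ℂ L] {ι : Type*}

/-- Iterated brackets of a family of elements. -/
inductive IterBracket (e : ι → L) : L → Prop
  | base (i : ι) : IterBracket e (e i)
  | step (i : ι) {x : L} (hx : IterBracket e x) : IterBracket e ⁅e i, x⁆

/-- The linear span of the iterated brackets of a family of elements. -/
def iterSpan (e : ι → L) : Submodule ℂ L := Submodule.span ℂ {x | IterBracket e x}

lemma lie_mem_of_span {s : Set L} {U : Submodule ℂ L} {x y : L}
    (h : ∀ z ∈ s, ⁅x, z⁆ ∈ U) (hy : y ∈ Submodule.span ℂ s) : ⁅x, y⁆ ∈ U := by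
  induction hy using Submodule.span_induction with
  | mem z hz => exact h z hz
  | zero => simp
  | add u w _ _ h1 h2 => simpa using U.add_mem h1 h2
  | smul a u _ h => simpa using U.smul_mem a h

lemma lie_iterSpan (e : ι → L) (i : ι) {x : L} (hx : x ∈ iterSpan e) : ⁅e i, x⁆ ∈ iterSpan e :=
  lie_mem_of_span (fun _ hz ↦ Submodule.subset_span (IterBracket.step i hz)) hx

lemma mem_iterSpan (e : ι → L) (i : ι) : e i ∈ iterSpan e := Submodule.subset_span (IterBracket.base i)

lemma lie_cartan_iterSpan {e h : ι → L} {c : ι → ι → ℂ} (hhe : ∀ i j, ⁅h i, e j⁆ = c i j • e j)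
    (i : ι) {x : L} (hx : x ∈ iterSpan e) : ⁅h i, x⁆ ∈ iterSpan e := by
  refine lie_mem_of_span (fun z hz ↦ ?_) hx
  induction hz with
  | base j => rw [hhe]; exact Submodule.smul_mem _ _ (mem_iterSpan e j)
  | step j hz ih =>
    rw [leibniz_lie, hhe, smul_lie]
    exact add_mem (Submodule.smul_mem _ _ (lie_iterSpan e j (Submodule.subset_span hz)))
      (lie_iterSpan e j ih)

lemma lie_cross_iterSpan {e f h : ι → L} {c : ι → ι → ℂ}
    (hef : ∀ i j, ⁅e i, f j⁆ ∈ Submodule.span ℂ (Set.range h))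
    (hhf : ∀ i j, ⁅h i, f j⁆ = c i j • f j)
    (i : ι) {x : L} (hx : x ∈ iterSpan f) :
    ⁅e i, x⁆ ∈ iterSpan f ⊔ Submodule.span ℂ (Set.range h) := by
  have hH : ∀ t ∈ Submodule.span ℂ (Set.range h), ∀ x ∈ iterSpan f, ⁅t, x⁆ ∈ iterSpan f := by
    intro t ht x hx
    rw [← lie_skew]
    refine neg_mem (lie_mem_of_span ?_ ht)
    rintro - ⟨j, rfl⟩
    rw [← lie_skew]
    exact neg_mem (lie_cartan_iterSpan hhf j hx)
  refine lie_mem_of_span (fun z hz ↦ ?_) hx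
  induction hz with
  | base j => exact Submodule.mem_sup_right (hef i j)
  | step j hz ih =>
    rename_i z
    rw [leibniz_lie]
    refine add_mem (Submodule.mem_sup_left (hH _ (hef i j) _ (Submodule.subset_span hz))) ?_
    obtain ⟨u, hu, t, ht, hut⟩ := Submodule.mem_sup.mp ih
    rw [← hut, lie_add]
    refine Submodule.mem_sup_left (add_mem (lie_iterSpan f j hu) ?_)
    rw [← lie_skew]
    exact neg_mem (hH t ht _ (mem_iterSpan f j))

/-- The triangular decomposition of a Lie algebra generated by elements satisfying the
Chevalley relations. -/
lemma lieSpan_le_triangular {e f h : ι → L} {c : ι → ι → ℂ}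
    (hef : ∀ i j, ⁅e i, f j⁆ ∈ Submodule.span ℂ (Set.range h))
    (hhe : ∀ i j, ⁅h i, e j⁆ = c i j • e j) (hhf : ∀ i j, ⁅h i, f j⁆ = -c i j • f j) {x : L}
    (hx : x ∈ LieSubalgebra.lieSpan ℂ L (Set.range e ∪ Set.range f)) :
    x ∈ iterSpan f ⊔ Submodule.span ℂ (Set.range h) ⊔ iterSpan e := by
  set W := iterSpan f ⊔ Submodule.span ℂ (Set.range h) ⊔ iterSpan e with hW
  have hf1 : iterSpan f ≤ W := le_sup_left.trans le_sup_left
  have hh1 : Submodule.span ℂ (Set.range h) ≤ W := le_sup_right.trans le_sup_left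
  have he1 : iterSpan e ≤ W := le_sup_right
  have hE : ∀ i, ∀ y ∈ W, ⁅e i, y⁆ ∈ W := by
    intro i y hy
    obtain ⟨q, hq, w, hw, rfl⟩ := Submodule.mem_sup.mp hy
    obtain ⟨u, hu, t, ht, rfl⟩ := Submodule.mem_sup.mp hq
    rw [lie_add, lie_add]
    refine add_mem (add_mem ?_ ?_) (he1 (lie_iterSpan e i hw))
    · exact le_sup_left (α := Submodule ℂ L) (lie_cross_iterSpan hef hhf i hu)
    · refine he1 (lie_mem_of_span ?_ ht)
      rintro - ⟨j, rfl⟩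
      rw [← lie_skew, hhe]
      exact neg_mem (Submodule.smul_mem _ _ (mem_iterSpan e i))
  have hF : ∀ i, ∀ y ∈ W, ⁅f i, y⁆ ∈ W := by
    intro i y hy
    have hfe : ∀ i j, ⁅f i, e j⁆ ∈ Submodule.span ℂ (Set.range h) := by
      intro i j
      rw [← lie_skew]
      exact neg_mem (hef j i)
    obtain ⟨q, hq, w, hw, rfl⟩ := Submodule.mem_sup.mp hy
    obtain ⟨u, hu, t, ht, rfl⟩ := Submodule.mem_sup.mp hq
    rw [lie_add, lie_add]
    refine add_mem (add_mem (hf1 (lie_iterSpan f i hu)) ?_) ?_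
    · refine hf1 (lie_mem_of_span ?_ ht)
      rintro - ⟨j, rfl⟩
      rw [← lie_skew, hhf]
      exact neg_mem (Submodule.smul_mem _ _ (mem_iterSpan f i))
    · exact sup_le he1 hh1 (lie_cross_iterSpan hfe hhe i hw)
  have key : ∀ y ∈ W, ⁅x, y⁆ ∈ W := by
    induction hx using LieSubalgebra.lieSpan_induction with
    | mem x hx =>
      obtain ⟨i, rfl⟩ | ⟨i, rfl⟩ := hx
      exacts [hE i, hF i]
    | zero => simp
    | add x y _ _ h1 h2 => intro z hz; rw [add_lie]; exact add_mem (h1 z hz) (h2 z hz)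
    | smul a x _ h => intro z hz; rw [smul_lie]; exact W.smul_mem a (h z hz)
    | lie x y _ _ h1 h2 =>
      intro z hz
      rw [lie_lie]
      exact sub_mem (h1 _ (h2 z hz)) (h2 _ (h1 z hz))
  clear key
  suffices x ∈ W ∧ ∀ y ∈ W, ⁅x, y⁆ ∈ W from this.1
  induction hx using LieSubalgebra.lieSpan_induction with
  | mem x hx =>
    obtain ⟨i, rfl⟩ | ⟨i, rfl⟩ := hx
    exacts [⟨he1 (mem_iterSpan e i), hE i⟩, ⟨hf1 (mem_iterSpan f i), hF i⟩]
  | zero => simp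
  | add x y _ _ h1 h2 =>
    refine ⟨add_mem h1.1 h2.1, fun z hz ↦ ?_⟩
    rw [add_lie]
    exact add_mem (h1.2 z hz) (h2.2 z hz)
  | smul a x _ h =>
    refine ⟨W.smul_mem a h.1, fun z hz ↦ ?_⟩
    rw [smul_lie]
    exact W.smul_mem a (h.2 z hz)
  | lie x y _ _ h1 h2 =>
    refine ⟨h1.2 y h2.1, fun z hz ↦ ?_⟩
    rw [lie_lie]
    exact sub_mem (h1.2 _ (h2.2 z hz)) (h2.2 _ (h1.2 z hz))

lemma iterSpan_le {e : ι → L} {U : Submodule ℂ L} (h1 : ∀ i, e i ∈ U)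
    (h2 : ∀ i, ∀ x ∈ U, ⁅e i, x⁆ ∈ U) : iterSpan e ≤ U := by
  refine Submodule.span_le.mpr fun x hx ↦ ?_
  induction hx with
  | base i => exact h1 i
  | step i _ ih => exact h2 i _ ih

/-- An invariant form which vanishes on the generators vanishes on the Lie algebra they generate. -/
lemma form_eq_zero_of_generators {β : LinearMap.BilinForm ℂ L} (hβ : β.lieInvariant L)
    (hs : ∀ x y, β x y = β y x) {e f h : ι → L} {c : ι → ι → ℂ}
    (hef : ∀ i j, ⁅e i, f j⁆ ∈ Submodule.span ℂ (Set.range h))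
    (hhe : ∀ i j, ⁅h i, e j⁆ = c i j • e j) (hhf : ∀ i j, ⁅h i, f j⁆ = -c i j • f j)
    {P M : Submodule ℂ L} (hP : iterSpan e ≤ P) (hM : iterSpan f ≤ M)
    (hPP : ∀ x ∈ P, ∀ y ∈ P, β x y = 0) (hMM : ∀ x ∈ M, ∀ y ∈ M, β x y = 0)
    (hhP : ∀ i, ∀ y ∈ P, β (h i) y = 0) (hhM : ∀ i, ∀ y ∈ M, β (h i) y = 0)
    (hhh : ∀ i j, β (h i) (h j) = 0) (hefz : ∀ i j, β (e i) (f j) = 0) {x y : L}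
    (hx : x ∈ LieSubalgebra.lieSpan ℂ L (Set.range e ∪ Set.range f))
    (hy : y ∈ LieSubalgebra.lieSpan ℂ L (Set.range e ∪ Set.range f)) : β x y = 0 := by
  have hspan : ∀ {U : Submodule ℂ L}, (∀ i, ∀ y ∈ U, β (h i) y = 0) →
      ∀ t ∈ Submodule.span ℂ (Set.range h), ∀ y ∈ U, β t y = 0 := by
    intro U hU t ht y hy
    induction ht using Submodule.span_induction with
    | mem t ht => obtain ⟨i, rfl⟩ := ht; exact hU i y hy
    | zero => simp
    | add u w _ _ h1 h2 => simp [h1, h2]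
    | smul a u _ h => simp [h]
  have hhh' : ∀ t ∈ Submodule.span ℂ (Set.range h), ∀ y ∈ Submodule.span ℂ (Set.range h),
      β t y = 0 := by
    refine hspan fun i y hy ↦ ?_
    induction hy using Submodule.span_induction with
    | mem t ht => obtain ⟨j, rfl⟩ := ht; exact hhh i j
    | zero => simp
    | add u w _ _ h1 h2 => simp [h1, h2]
    | smul a u _ h => simp [h]
  have hhP' := hspan hhP
  have hhM' := hspan hhM
  have hPM : ∀ x ∈ iterSpan e, ∀ y ∈ iterSpan f, β x y = 0 := by
    intro x hx
    induction hx using Submodule.span_induction with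
    | mem x hx =>
      induction hx with
      | base i =>
        intro y hy
        induction hy using Submodule.span_induction with
        | mem y hy =>
          cases hy with
          | base j => exact hefz i j
          | step j hy =>
            rename_i z
            have h1 : ⁅f j, e i⁆ ∈ Submodule.span ℂ (Set.range h) := by
              rw [← lie_skew]
              exact neg_mem (hef i j)
            rw [hs, hβ, hs z, hhM' _ h1 z (hM (Submodule.subset_span hy)), neg_zero]
        | zero => simp
        | add u w _ _ h1 h2 => simp [h1, h2]
        | smul a u _ h => simp [h]
      | step i hx ih =>
        intro y hy
        rename_i z
        rw [hβ, neg_eq_zero]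
        obtain ⟨u, hu, t, ht, hut⟩ := Submodule.mem_sup.mp (lie_cross_iterSpan hef hhf i hy)
        rw [← hut, map_add, ih u hu, hs z t, hhP' t ht z (hP (Submodule.subset_span hx)), add_zero]
    | zero => simp
    | add u w _ _ h1 h2 => intro y hy; simp [h1 y hy, h2 y hy]
    | smul a u _ h => intro y hy; simp [h y hy]
  obtain ⟨xq, hxq, x3, hx3, rfl⟩ := Submodule.mem_sup.mp (lieSpan_le_triangular hef hhe hhf hx)
  obtain ⟨x1, hx1, x2, hx2, rfl⟩ := Submodule.mem_sup.mp hxq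
  obtain ⟨yq, hyq, y3, hy3, rfl⟩ := Submodule.mem_sup.mp (lieSpan_le_triangular hef hhe hhf hy)
  obtain ⟨y1, hy1, y2, hy2, rfl⟩ := Submodule.mem_sup.mp hyq
  simp only [map_add, LinearMap.add_apply]
  rw [hMM _ (hM hx1) _ (hM hy1), hs x1 y2, hhM' _ hy2 _ (hM hx1), hs x1 y3, hPM _ hy3 _ hx1,
    hhM' _ hx2 _ (hM hy1), hhh' _ hx2 _ hy2, hhP' _ hx2 _ (hP hy3), hPM _ hx3 _ hy1,
    hs x3 y2, hhP' _ hy2 _ (hP hx3), hPP _ (hP hx3) _ (hP hy3)]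
  simp
end Generators

section RootData

variable {g : Type*} [LieRing g] [LieAlgebra ℂ g] [FiniteDimensional ℂ g]
  [LieAlgebra.IsSemisimple ℂ g] {H : LieSubalgebra ℂ g} [H.IsCartanSubalgebra]

/-! ### Root vectors and root subspaces -/

/-- The restriction of the invariant form to the Cartan subalgebra. -/
def AdInvariantForm.restrictCartan (κ : AdInvariantForm g) (H : LieSubalgebra ℂ g) :
    LinearMap.BilinForm ℂ H :=
  κ.form.restrict H.toSubmodule

lemma AdInvariantForm.restrictCartan_apply (κ : AdInvariantForm g) (x y : H) :
    κ.restrictCartan H x y = κ.form x y := rfl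

lemma AdInvariantForm.comm (κ : AdInvariantForm g) (x y : g) :
    κ.form x y = κ.form y x := by simpa using κ.symm.eq x y

lemma isNonZero_of_root (α : H.root) : (α : Weight ℂ H g).IsNonZero := by
  simpa [LieSubalgebra.root] using Finset.mem_filter.mp α.2

lemma AdInvariantForm.cartan_rootSpace (κ : AdInvariantForm g) (t : H) (α : H.root) (y : g)
    (hy : y ∈ rootSpace H (α : Weight ℂ H g)) : κ.form t y = 0 := by
  have hα : (α : Weight ℂ H g).IsNonZero := isNonZero_of_root α
  obtain ⟨h, hh⟩ : ∃ h : H, (α : Weight ℂ H g) h ≠ 0 := by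
    by_contra! hc
    exact hα (funext hc)
  have h1 : ⁅(h : g), y⁆ = (α : Weight ℂ H g) h • y := IsKilling.lie_eq_smul_of_mem_rootSpace hy h
  have h2 := κ.invariant (h : g) (t : g) y
  have h3 : ⁅(h : g), (t : g)⁆ = 0 := by
    have := LieModule.IsTrivial.trivial h t
    simpa using congrArg (Subtype.val) this
  rw [h3, h1] at h2
  simpa [hh] using h2

lemma AdInvariantForm.rootSpace_rootSpace (κ : AdInvariantForm g) {α β : H.root} {x y : g}
    (h0 : ((α : Weight ℂ H g) + (β : Weight ℂ H g) : H → ℂ) ≠ 0)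
    (hx : x ∈ rootSpace H (α : Weight ℂ H g)) (hy : y ∈ rootSpace H (β : Weight ℂ H g)) :
    κ.form x y = 0 := by
  obtain ⟨h, hh⟩ : ∃ h : H, (α : Weight ℂ H g) h + (β : Weight ℂ H g) h ≠ 0 := by
    by_contra! hc
    exact h0 (funext hc)
  have h1 : ⁅(h : g), x⁆ = (α : Weight ℂ H g) h • x := lie_eq_smul_of_mem_rootSpace hx h
  have h2 : ⁅(h : g), y⁆ = (β : Weight ℂ H g) h • y := lie_eq_smul_of_mem_rootSpace hy h
  have h3 := κ.invariant (h : g) x y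
  rw [h1, h2, map_smul, map_smul, LinearMap.smul_apply, smul_eq_mul, smul_eq_mul,
    eq_neg_iff_add_eq_zero, ← add_mul] at h3
  exact (mul_eq_zero.mp h3).resolve_left hh

lemma iSup_rootSpace_eq_top :
    H.toSubmodule ⊔ ⨆ α : H.root, (rootSpace H (α : Weight ℂ H g)).toSubmodule = ⊤ := by
  rw [eq_top_iff, ← LieSubmodule.top_toSubmodule (R := ℂ) (L := H) (M := g),
    ← LieModule.iSup_genWeightSpace_eq_top' ℂ H g, LieSubmodule.iSup_toSubmodule]
  refine iSup_le fun χ ↦ ?_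
  by_cases hχ : χ.IsZero
  · refine le_trans ?_ le_sup_left
    have : (χ : H → ℂ) = 0 := hχ
    rw [this]
    intro x hx
    have hx' : x ∈ rootSpace H (0 : H → ℂ) := hx
    rw [LieAlgebra.rootSpace_zero_eq] at hx'
    exact hx'
  · refine le_trans ?_ le_sup_right
    exact le_iSup (fun α : H.root ↦ (rootSpace H (α : Weight ℂ H g)).toSubmodule)
      ⟨χ, by simpa using hχ⟩

lemma AdInvariantForm.restrictCartan_nondegenerate (κ : AdInvariantForm g) :
    (κ.restrictCartan H).Nondegenerate := by
  have key : ∀ t : H, (∀ x : H, κ.form t x = 0) → t = 0 := by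
    intro t ht
    have h1 : LinearMap.ker (κ.form t) = ⊤ := by
      rw [eq_top_iff, ← iSup_rootSpace_eq_top (H := H)]
      refine sup_le (fun x hx ↦ ht ⟨x, hx⟩) (iSup_le fun α y hy ↦ ?_)
      exact κ.cartan_rootSpace t α y hy
    have h2 : (t : g) = 0 := κ.nondegenerate.1 t fun y ↦ by
      have : y ∈ LinearMap.ker (κ.form t) := h1 ▸ Submodule.mem_top
      exact this
    exact Subtype.ext h2
  refine ⟨fun t ht ↦ key t ht, fun t ht ↦ key t fun x ↦ ?_⟩
  rw [κ.comm]
  exact ht x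

/-- For `α ∈ 𝔥*`, the element `H_α ∈ 𝔥` with `≪H_α, x≫ = α x` for all `x ∈ 𝔥`. -/
def AdInvariantForm.hVec (κ : AdInvariantForm g) : Dual ℂ H ≃ₗ[ℂ] H :=
  ((κ.restrictCartan H).toDual κ.restrictCartan_nondegenerate).symm

lemma AdInvariantForm.form_hVec (κ : AdInvariantForm g) (α : Dual ℂ H) (x : H) :
    κ.form (κ.hVec α : H) x = α x := by
  rw [← κ.restrictCartan_apply, hVec,
    ← LinearMap.BilinForm.toDual_def κ.restrictCartan_nondegenerate, LinearEquiv.apply_symm_apply]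

/-- The sum `∑_{α ∈ A} 𝔤_α` of the root spaces of a set `A` of roots. -/
def rootSum (A : Set H.root) : Submodule ℂ g :=
  ⨆ α ∈ A, (rootSpace H (α : Weight ℂ H g)).toSubmodule

/-- `[S]`: the set of roots in the linear span of `S`. -/
def closureRoots (S : Set H.root) : Set H.root :=
  {α | (rootSystem H).root α ∈ Submodule.span ℂ ((rootSystem H).root '' S)}

/-- `𝔪_S = 𝔥 + ∑_{α ∈ [S]} 𝔤_α`. -/
def levi (S : Set H.root) : Submodule ℂ g :=
  H.toSubmodule ⊔ rootSum (closureRoots S)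

/-- `𝔷_S = {x ∈ 𝔥 : α x = 0 for all α ∈ S}`. -/
def center (S : Set H.root) : Submodule ℂ g :=
  (⨅ α ∈ S, LinearMap.ker ((rootSystem H).root α)).map H.toSubmodule.subtype

/-- The subspace `span {H_α : α ∈ S} + ∑_{α ∈ [S]} 𝔤_α` underlying `𝔤_S`. -/
def semisimplePart (κ : AdInvariantForm g) (S : Set H.root) : Submodule ℂ g :=
  Submodule.span ℂ ((fun α ↦ ((κ.hVec ((rootSystem H).root α) : H) : g)) '' S) ⊔
    rootSum (closureRoots S)

lemma hVec_mem_semisimplePart (κ : AdInvariantForm g) (S : Set H.root) (f : Dual ℂ H)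
    (hf : f ∈ Submodule.span ℂ ((rootSystem H).root '' S)) :
    ((κ.hVec f : H) : g) ∈ semisimplePart κ S := by
  refine Submodule.mem_sup_left ?_
  induction hf using Submodule.span_induction with
  | mem x hx =>
    obtain ⟨α, hα, rfl⟩ := hx
    exact Submodule.subset_span ⟨α, hα, rfl⟩
  | zero => simp
  | add x y _ _ hx hy => simpa using add_mem hx hy
  | smul a x _ hx => simpa using Submodule.smul_mem _ a hx

lemma mem_rootSum {A : Set H.root} {α : H.root} (hα : α ∈ A) {x : g}
    (hx : x ∈ rootSpace H (α : Weight ℂ H g)) : x ∈ rootSum A :=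
  Submodule.mem_iSup_of_mem α (Submodule.mem_iSup_of_mem hα hx)

lemma lie_eq_hVec (κ : AdInvariantForm g) {α β : H.root} {x y : g}
    (h0 : ((α : Weight ℂ H g) + (β : Weight ℂ H g) : H → ℂ) = 0)
    (hx : x ∈ rootSpace H (α : Weight ℂ H g)) (hy : y ∈ rootSpace H (β : Weight ℂ H g)) :
    ⁅x, y⁆ = ((κ.form x y • κ.hVec ((rootSystem H).root α) : H) : g) := by
  have hxy : ⁅x, y⁆ ∈ rootSpace H ((α : Weight ℂ H g) + (β : Weight ℂ H g) : H → ℂ) :=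
    lie_mem_genWeightSpace_of_mem_genWeightSpace hx hy
  rw [h0, LieAlgebra.rootSpace_zero_eq] at hxy
  have hxy' : ⁅x, y⁆ ∈ H := hxy
  have h1 : (⟨⁅x, y⁆, hxy'⟩ : H) = κ.form x y • κ.hVec ((rootSystem H).root α) := by
    rw [← map_smul, ← sub_eq_zero]
    refine κ.restrictCartan_nondegenerate.1 _ fun h ↦ ?_
    rw [map_sub, LinearMap.sub_apply, κ.restrictCartan_apply, κ.restrictCartan_apply,
      κ.form_hVec]
    have h2 : ⁅(h : g), y⁆ = (β : Weight ℂ H g) h • y := lie_eq_smul_of_mem_rootSpace hy h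
    have h3 : (β : Weight ℂ H g) h = -(α : Weight ℂ H g) h :=
      eq_neg_of_add_eq_zero_right (congrFun h0 h)
    have h4 := κ.invariant y x (h : g)
    have h5 : ⁅y, (h : g)⁆ = (α : Weight ℂ H g) h • y := by
      rw [← lie_skew, h2, h3, neg_smul, neg_neg]
    have h6 : ⁅x, y⁆ = -⁅y, x⁆ := (lie_skew x y).symm
    simp only [h6, map_neg, LinearMap.neg_apply, h4, h5, map_smul, LinearMap.smul_apply,
      smul_eq_mul, neg_neg, rootSystem_root_apply, Weight.toLinear_apply]
    ring
  exact congrArg Subtype.val h1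

lemma lie_rootSpace_mem_semisimplePart (κ : AdInvariantForm g) (S : Set H.root) {α β : H.root}
    (hα : α ∈ closureRoots S) (hβ : β ∈ closureRoots S) {x y : g}
    (hx : x ∈ rootSpace H (α : Weight ℂ H g)) (hy : y ∈ rootSpace H (β : Weight ℂ H g)) :
    ⁅x, y⁆ ∈ semisimplePart κ S := by
  have hxy : ⁅x, y⁆ ∈ rootSpace H ((α : Weight ℂ H g) + (β : Weight ℂ H g) : H → ℂ) :=
    lie_mem_genWeightSpace_of_mem_genWeightSpace hx hy
  by_cases h0 : ((α : Weight ℂ H g) + (β : Weight ℂ H g) : H → ℂ) = 0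
  · rw [lie_eq_hVec κ h0 hx hy]
    exact Submodule.smul_mem _ _ (hVec_mem_semisimplePart κ S _ hα)
  · by_cases hb : rootSpace H ((α : Weight ℂ H g) + (β : Weight ℂ H g) : H → ℂ) = ⊥
    · rw [hb, LieSubmodule.mem_bot] at hxy
      rw [hxy]
      exact zero_mem _
    · let χ : Weight ℂ H g := ⟨_, hb⟩
      have hχ : χ.IsNonZero := h0
      let γ : H.root := ⟨χ, by simpa using hχ⟩
      have hγ : γ ∈ closureRoots S := by
        have : (rootSystem H).root γ = (rootSystem H).root α + (rootSystem H).root β := by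
          ext h
          rfl
        change (rootSystem H).root γ ∈ Submodule.span ℂ ((rootSystem H).root '' S)
        rw [this]
        exact Submodule.add_mem (Submodule.span ℂ ((rootSystem H).root '' S)) hα hβ
      exact Submodule.mem_sup_right (mem_rootSum hγ hxy)

lemma semisimplePart_eq_span (κ : AdInvariantForm g) (S : Set H.root) :
    semisimplePart κ S = Submodule.span ℂ
      (((fun α ↦ ((κ.hVec ((rootSystem H).root α) : H) : g)) '' S) ∪
        {x | ∃ α ∈ closureRoots S, x ∈ rootSpace H (α : Weight ℂ H g)}) := by
  rw [Submodule.span_union, semisimplePart]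
  congr 1
  refine le_antisymm (iSup₂_le fun α hα x hx ↦ Submodule.subset_span ⟨α, hα, hx⟩) ?_
  rw [Submodule.span_le]
  rintro x ⟨α, hα, hx⟩
  exact mem_rootSum hα hx

lemma lie_mem_semisimplePart (κ : AdInvariantForm g) (S : Set H.root) {x y : g}
    (hx : x ∈ semisimplePart κ S) (hy : y ∈ semisimplePart κ S) :
    ⁅x, y⁆ ∈ semisimplePart κ S := by
  rw [semisimplePart_eq_span] at hx hy
  induction hx, hy using Submodule.span_induction₂ with
  | mem_mem x y hx hy =>
    have hcartan : ∀ (t : H), ∀ α ∈ closureRoots S, ∀ z ∈ rootSpace H (α : Weight ℂ H g),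
        ⁅(t : g), z⁆ ∈ semisimplePart κ S := by
      intro t α hα z hz
      have : ⁅(t : g), z⁆ = (α : Weight ℂ H g) t • z := lie_eq_smul_of_mem_rootSpace hz t
      rw [this]
      exact Submodule.smul_mem _ _ (Submodule.mem_sup_right (mem_rootSum hα hz))
    rcases hx with ⟨α, -, rfl⟩ | ⟨α, hα, hx⟩ <;> rcases hy with ⟨β, -, rfl⟩ | ⟨β, hβ, hy⟩
    · have := LieModule.IsTrivial.trivial (κ.hVec ((rootSystem H).root α))
        (κ.hVec ((rootSystem H).root β))
      have h2 := congrArg Subtype.val this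
      simp only [LieSubalgebra.coe_bracket, ZeroMemClass.coe_zero] at h2
      simp only [h2, zero_mem]
    · exact hcartan _ β hβ y hy
    · rw [← lie_skew]
      exact neg_mem (hcartan _ α hα x hx)
    · exact lie_rootSpace_mem_semisimplePart κ S hα hβ hx hy
  | zero_left y _ => simp
  | zero_right x _ => simp
  | add_left x y z _ _ _ h1 h2 => simpa using add_mem h1 h2
  | add_right x y z _ _ _ h1 h2 => simpa using add_mem h1 h2
  | smul_left r x y _ _ h => simpa using Submodule.smul_mem _ r h
  | smul_right r x y _ _ h => simpa using Submodule.smul_mem _ r h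

lemma isCompl_span_coroot (S : Set H.root) :
    IsCompl (Submodule.span ℂ ((rootSystem H).coroot '' closureRoots S))
      (⨅ α ∈ S, LinearMap.ker ((rootSystem H).root α)) := by
  let P := rootSystem H
  have hclos : ∀ i ∈ closureRoots S, ∀ j ∈ closureRoots S,
      P.reflectionPerm i j ∈ closureRoots S := by
    intro i hi j hj
    change P.root (P.reflectionPerm i j) ∈ Submodule.span ℂ (P.root '' S)
    rw [P.root_reflectionPerm, P.reflection_apply]
    exact Submodule.sub_mem (Submodule.span ℂ (P.root '' S)) hj (Submodule.smul_mem _ _ hi)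
  let Q : RootPairing (closureRoots S) ℂ (Dual ℂ H) H :=
    RootPairing.mk' P.toLinearMap
      ⟨fun i ↦ P.root i, fun i j h ↦ Subtype.ext (P.root.injective h)⟩
      ⟨fun i ↦ P.coroot i, fun i j h ↦ Subtype.ext (P.coroot.injective h)⟩
      (fun i ↦ P.root_coroot_two i)
      (by
        rintro i - ⟨j, rfl⟩
        exact ⟨⟨_, hclos i i.2 j j.2⟩, P.root_reflectionPerm i j⟩)
      (by
        rintro i - ⟨j, rfl⟩
        exact ⟨⟨_, hclos i i.2 j j.2⟩, P.coroot_reflectionPerm i j⟩)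
  have : Q.IsCrystallographic := ⟨fun i j ↦ P.exists_value i j⟩
  let _ : Fintype (closureRoots S) := Fintype.ofFinite _
  have h := Q.isCompl_corootSpan_ker_corootForm
  have h1 : Q.corootSpan ℂ = Submodule.span ℂ (P.coroot '' closureRoots S) := by
    rw [RootPairing.corootSpan, Set.image_eq_range]
    rfl
  have h2 : LinearMap.ker Q.CorootForm = ⨅ α ∈ S, LinearMap.ker (P.root α) := by
    ext x
    simp only [Submodule.mem_iInf, LinearMap.mem_ker]
    constructor
    · intro hx α hα
      have hx' : x ∈ LinearMap.ker Q.CorootForm := hx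
      rw [Q.ker_corootForm_eq_dualAnnihilator] at hx'
      obtain ⟨f, hf, rfl⟩ := hx'
      rw [SetLike.mem_coe, Submodule.mem_dualAnnihilator] at hf
      have hα' : α ∈ closureRoots S := Submodule.subset_span ⟨α, hα, rfl⟩
      have h3 := hf (Q.root ⟨α, hα'⟩) (Submodule.subset_span ⟨_, rfl⟩)
      have h4 : Q.flip.toPerfPair (Q.flip.toPerfPair.symm f) (Q.root ⟨α, hα'⟩) = 0 := by
        rw [LinearEquiv.apply_symm_apply]
        exact h3
      exact h4
    · intro hx
      have hx' : ∀ f ∈ Submodule.span ℂ (P.root '' S), f x = 0 := by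
        intro f hf
        induction hf using Submodule.span_induction with
        | mem f hf =>
          obtain ⟨α, hα, rfl⟩ := hf
          exact hx α hα
        | zero => simp
        | add f g _ _ h1 h2 => simp [h1, h2]
        | smul a f _ h => simp [h]
      ext y
      rw [RootPairing.corootForm_apply_apply]
      refine Finset.sum_eq_zero fun i _ ↦ ?_
      have : Q.root' i x = 0 := hx' _ i.2
      rw [this, zero_mul]
  rw [← h1, ← h2]
  exact h

lemma coroot_mem_semisimplePart (κ : AdInvariantForm g) (S : Set H.root) {α : H.root}
    (hα : α ∈ closureRoots S) : (((rootSystem H).coroot α : H) : g) ∈ semisimplePart κ S := by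
  have h := coroot_mem_corootSpace (α : Weight ℂ H g)
  rw [LieAlgebra.mem_corootSpace] at h
  change ((coroot (α : Weight ℂ H g) : H) : g) ∈ _
  refine Submodule.span_le.mpr ?_ h
  rintro x ⟨y, hy, z, hz, rfl⟩
  let β : H.root := ⟨-(α : Weight ℂ H g), by
    simpa [LieSubalgebra.root] using isNonZero_of_root α⟩
  have hβ : β ∈ closureRoots S := by
    have : (rootSystem H).root β = -(rootSystem H).root α := by
      ext h
      rfl
    change (rootSystem H).root β ∈ Submodule.span ℂ ((rootSystem H).root '' S)
    rw [this]
    exact Submodule.neg_mem _ hα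
  exact lie_rootSpace_mem_semisimplePart κ S hα hβ hy hz

/-- `𝔷_S + 𝔫_S + 𝔫_S⁻`, where `𝔫_S + 𝔫_S⁻` is the sum of the root spaces of all roots outside
`[S]`. -/
def semisimpleCompl (S : Set H.root) : Submodule ℂ g :=
  center S ⊔ rootSum (closureRoots S)ᶜ

lemma form_semisimplePart_compl (κ : AdInvariantForm g) (S : Set H.root) (x : g)
    (hx : x ∈ semisimplePart κ S) (y : g) (hy : y ∈ semisimpleCompl S) : κ.form x y = 0 := by
  have hout : ∀ x ∈ semisimplePart κ S, ∀ β ∉ closureRoots S,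
      ∀ y ∈ rootSpace H (β : Weight ℂ H g), κ.form x y = 0 := by
    intro x hx β hβ y hy
    rw [semisimplePart_eq_span] at hx
    induction hx using Submodule.span_induction with
    | mem x hx =>
      obtain ⟨α, -, rfl⟩ | ⟨α, hα, hx⟩ := hx
      · exact κ.cartan_rootSpace _ β y hy
      · refine κ.rootSpace_rootSpace (fun h0 ↦ hβ ?_) hx hy
        have : (rootSystem H).root β = -(rootSystem H).root α := by
          ext h
          exact eq_neg_of_add_eq_zero_right (congrFun h0 h)
        change (rootSystem H).root β ∈ Submodule.span ℂ ((rootSystem H).root '' S)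
        rw [this]
        exact Submodule.neg_mem _ hα
    | zero => simp
    | add u w _ _ h1 h2 => simp [h1, h2]
    | smul a u _ h => simp [h]
  have hcenter : ∀ x ∈ semisimplePart κ S, ∀ y ∈ center S, κ.form x y = 0 := by
    rintro x hx - ⟨z, hz, rfl⟩
    rw [semisimplePart_eq_span] at hx
    induction hx using Submodule.span_induction with
    | mem x hx =>
      obtain ⟨α, hα, rfl⟩ | ⟨α, -, hx⟩ := hx
      · have hz' : z ∈ ⨅ α ∈ S, LinearMap.ker ((rootSystem H).root α) := hz
        simp only [Submodule.mem_iInf, LinearMap.mem_ker] at hz'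
        exact (κ.form_hVec _ z).trans (hz' α hα)
      · rw [κ.comm]
        exact κ.cartan_rootSpace z α x hx
    | zero => simp
    | add u w _ _ h1 h2 => simp only [map_add, LinearMap.add_apply, h1, h2, add_zero]
    | smul a u _ h => simp only [map_smul, LinearMap.smul_apply, h, smul_zero]
  have hle : semisimpleCompl S ≤ LinearMap.ker (κ.form x) :=
    sup_le (fun z hz ↦ hcenter x hx z hz) (iSup₂_le fun β hβ z hz ↦ hout x hx β hβ z hz)
  exact hle hy

lemma isCompl_semisimplePart (κ : AdInvariantForm g) (S : Set H.root) :
    IsCompl (semisimplePart κ S) (semisimpleCompl S) := by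
  have hsup : semisimplePart κ S ⊔ semisimpleCompl S = ⊤ := by
    rw [eq_top_iff, ← iSup_rootSpace_eq_top (H := H)]
    refine sup_le ?_ (iSup_le fun α ↦ ?_)
    · intro x hx
      have h : (⟨x, hx⟩ : H) ∈ Submodule.span ℂ ((rootSystem H).coroot '' closureRoots S) ⊔
          ⨅ α ∈ S, LinearMap.ker ((rootSystem H).root α) := by
        rw [(isCompl_span_coroot S).sup_eq_top]
        exact Submodule.mem_top
      obtain ⟨y, hy, z, hz, hyz⟩ := Submodule.mem_sup.mp h
      have h2 : x = y + z := (congrArg Subtype.val hyz).symm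
      rw [h2]
      refine Submodule.add_mem_sup ?_ (Submodule.mem_sup_left ⟨z, hz, rfl⟩)
      have h3 : Submodule.span ℂ ((rootSystem H).coroot '' closureRoots S) ≤
          (semisimplePart κ S).comap H.toSubmodule.subtype := by
        rw [Submodule.span_le]
        rintro - ⟨α, hα, rfl⟩
        exact coroot_mem_semisimplePart κ S hα
      exact h3 hy
    · by_cases hα : α ∈ closureRoots S
      · exact fun x hx ↦ Submodule.mem_sup_left (Submodule.mem_sup_right (mem_rootSum hα hx))
      · exact fun x hx ↦ Submodule.mem_sup_right (Submodule.mem_sup_right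
          (mem_rootSum (A := (closureRoots S)ᶜ) hα hx))
  refine IsCompl.of_eq ?_ hsup
  rw [eq_bot_iff]
  rintro x ⟨hx1, hx2⟩
  refine κ.nondegenerate.1 x fun y ↦ ?_
  have hy : y ∈ semisimplePart κ S ⊔ semisimpleCompl S := hsup ▸ Submodule.mem_top
  obtain ⟨u, hu, w, hw, rfl⟩ := Submodule.mem_sup.mp hy
  rw [map_add, form_semisimplePart_compl κ S x hx1 w hw, κ.comm x u, form_semisimplePart_compl κ S u hu x hx2, add_zero]

/-- The semisimple Lie subalgebra `𝔤_S = span {H_α : α ∈ S} + ∑_{α ∈ [S]} 𝔤_α`. -/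
def gS (κ : AdInvariantForm g) (S : Set H.root) : LieSubalgebra ℂ g where
  __ := semisimplePart κ S
  lie_mem' := lie_mem_semisimplePart κ S

/-- The projection `χ_S` to `𝔤_S` along `𝔷_S + 𝔫_S + 𝔫_S⁻`. On `𝔭_S = 𝔷_S + 𝔤_S + 𝔫_S` it is the
projection along `𝔷_S + 𝔫_S`, and on `𝔭_S⁻ = 𝔷_S + 𝔤_S + 𝔫_S⁻` the projection along
`𝔷_S + 𝔫_S⁻`. -/
def chi (κ : AdInvariantForm g) (S : Set H.root) : g →ₗ[ℂ] gS κ S :=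
  Submodule.projectionOnto (semisimplePart κ S) (semisimpleCompl S) (isCompl_semisimplePart κ S)


lemma exists_negRoot (α : H.root) : ∃ β : H.root,
    (β : Weight ℂ H g) = -(α : Weight ℂ H g) :=
  ⟨⟨-(α : Weight ℂ H g), by simpa [LieSubalgebra.root] using isNonZero_of_root α⟩, rfl⟩

lemma AdInvariantForm.eq_zero_of_rootSpace (κ : AdInvariantForm g) {α β : H.root} {u : g}
    (h0 : ((α : Weight ℂ H g) + (β : Weight ℂ H g) : H → ℂ) = 0)
    (hu : u ∈ rootSpace H (α : Weight ℂ H g))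
    (h : ∀ y ∈ rootSpace H (β : Weight ℂ H g), κ.form u y = 0) : u = 0 := by
  have h1 : LinearMap.ker (κ.form u) = ⊤ := by
    rw [eq_top_iff, ← iSup_rootSpace_eq_top (H := H)]
    refine sup_le (fun x hx ↦ ?_) (iSup_le fun γ y hy ↦ ?_)
    · rw [LinearMap.mem_ker, κ.comm]
      exact κ.cartan_rootSpace ⟨x, hx⟩ α u hu
    · by_cases hγ : γ = β
      · subst hγ
        exact h y hy
      · refine κ.rootSpace_rootSpace (fun h2 ↦ hγ ?_) hu hy
        apply Subtype.ext
        apply DFunLike.coe_injective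
        exact add_left_cancel (h2.trans h0.symm)
  exact κ.nondegenerate.1 u fun y ↦ by
    have : y ∈ LinearMap.ker (κ.form u) := h1 ▸ Submodule.mem_top
    exact this

lemma rootSpace_le_of_add (κ : AdInvariantForm g) {i j k : H.root}
    (hk : (rootSystem H).root k = (rootSystem H).root i + (rootSystem H).root j)
    {U : LieSubalgebra ℂ g} (hi : ∀ x ∈ rootSpace H (i : Weight ℂ H g), x ∈ U)
    (hj : ∀ x ∈ rootSpace H (j : Weight ℂ H g), x ∈ U) :
    ∀ x ∈ rootSpace H (k : Weight ℂ H g), x ∈ U := by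
  have hkf : ∀ t : H, (k : Weight ℂ H g) t = (i : Weight ℂ H g) t + (j : Weight ℂ H g) t :=
    fun t ↦ LinearMap.congr_fun hk t
  obtain ⟨h, e, f, t, he, hf⟩ := exists_isSl2Triple_of_weight_isNonZero (isNonZero_of_root j)
  have hh : h = coroot (j : Weight ℂ H g) := t.h_eq_coroot (isNonZero_of_root j) he hf
  have hj2 : (j : Weight ℂ H g) (coroot (j : Weight ℂ H g)) = 2 :=
    root_apply_coroot (isNonZero_of_root j)
  have hmem : ∀ y ∈ rootSpace H (i : Weight ℂ H g), ⁅e, y⁆ ∈ rootSpace H (k : Weight ℂ H g) := by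
    intro y hy
    have : ((k : Weight ℂ H g) : H → ℂ) = (j : Weight ℂ H g) + (i : Weight ℂ H g) := by
      funext s
      rw [hkf, Pi.add_apply, add_comm]
    rw [this]
    exact lie_mem_genWeightSpace_of_mem_genWeightSpace he hy
  by_cases hne : ∃ y ∈ rootSpace H (i : Weight ℂ H g), ⁅e, y⁆ ≠ 0
  · obtain ⟨y, hy, hey⟩ := hne
    intro x hx
    obtain ⟨c, hc⟩ := (finrank_eq_one_iff_of_nonzero'
      (⟨⁅e, y⁆, hmem y hy⟩ : rootSpace H (k : Weight ℂ H g))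
      (by simpa [Subtype.ext_iff] using hey)).mp
      (finrank_rootSpace_eq_one _ (isNonZero_of_root k)) ⟨x, hx⟩
    have hc' : c • ⁅e, y⁆ = x := congrArg Subtype.val hc
    rw [← hc']
    exact U.smul_mem c (U.lie_mem (hj e he) (hi y hy))
  · exfalso
    push Not at hne
    obtain ⟨i', hi'⟩ := exists_negRoot i
    obtain ⟨k', hk'⟩ := exists_negRoot k
    obtain ⟨y, hy, hy0⟩ := (i : Weight ℂ H g).exists_ne_zero
    obtain ⟨w, hw, hw0⟩ := (k' : Weight ℂ H g).exists_ne_zero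
    have hi'f : ∀ s : H, (i' : Weight ℂ H g) s = -(i : Weight ℂ H g) s := by
      intro s; rw [hi']; rfl
    have hk'f : ∀ s : H, (k' : Weight ℂ H g) s = -(k : Weight ℂ H g) s := by
      intro s; rw [hk']; rfl
    have hew : ⁅e, w⁆ = 0 := by
      have hmem' : ⁅e, w⁆ ∈ rootSpace H (i' : Weight ℂ H g) := by
        have : ((i' : Weight ℂ H g) : H → ℂ) = (j : Weight ℂ H g) + (k' : Weight ℂ H g) := by
          funext s
          rw [Pi.add_apply, hi'f, hk'f, hkf]
          ring
        rw [this]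
        exact lie_mem_genWeightSpace_of_mem_genWeightSpace he hw
      refine κ.eq_zero_of_rootSpace (α := i') (β := i) ?_ hmem' fun z hz ↦ ?_
      · funext s
        simp [hi'f]
      · rw [κ.invariant, hne z hz, map_zero, neg_zero]
    have p1 : t.HasPrimitiveVectorWith y ((i : Weight ℂ H g) (coroot (j : Weight ℂ H g))) :=
      ⟨hy0, by rw [hh]; exact lie_eq_smul_of_mem_rootSpace hy _, hne y hy⟩
    have p2 : t.HasPrimitiveVectorWith w ((k' : Weight ℂ H g) (coroot (j : Weight ℂ H g))) :=
      ⟨hw0, by rw [hh]; exact lie_eq_smul_of_mem_rootSpace hw _, hew⟩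
    obtain ⟨n1, hn1⟩ := p1.exists_nat
    obtain ⟨n2, hn2⟩ := p2.exists_nat
    rw [hk'f, hkf, hn1, hj2] at hn2
    have : ((n1 + 2 + n2 : ℕ) : ℂ) = 0 := by
      push_cast
      rw [← hn2]
      ring
    exact absurd (Nat.cast_eq_zero.mp this) (by omega)

lemma semisimplePart_le_of_simple (b : (rootSystem H).Base) (κ : AdInvariantForm g)
    {S : Set H.root} (hS : S ⊆ b.support) {U : LieSubalgebra ℂ g}
    (hU : ∀ α ∈ S, (∀ x ∈ rootSpace H (α : Weight ℂ H g), x ∈ U) ∧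
      ∀ x ∈ rootSpace H (-(α : Weight ℂ H g) : Weight ℂ H g), x ∈ U) :
    ∀ x ∈ semisimplePart κ S, x ∈ U := by
  classical
  let c : b.support → Dual ℂ H → ℂ := fun j f ↦ b.toWeightBasis.repr f j
  have hc : ∀ i j : b.support, c j ((rootSystem H).root i) = if i = j then 1 else 0 := by
    intro i j
    simp only [c]
    rw [← b.toWeightBasis_apply i, Basis.repr_self, Finsupp.single_apply]
  have hadd : ∀ j f f', c j (f + f') = c j f + c j f' := by
    intro j f f'
    simp [c]
  have hspan : ∀ j : b.support, (j : H.root) ∉ S → ∀ α ∈ closureRoots S,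
      c j ((rootSystem H).root α) = 0 := by
    intro j hj α hα
    have : Submodule.span ℂ ((rootSystem H).root '' S) ≤
        LinearMap.ker (b.toWeightBasis.coord j) := by
      rw [Submodule.span_le]
      rintro - ⟨i, hi, rfl⟩
      have h1 := hc ⟨i, hS hi⟩ j
      rw [if_neg (by rintro rfl; exact hj hi)] at h1
      exact h1
    exact this hα
  have hpos : ∀ i : H.root, b.IsPos i → (b.IsPos i ∧
      (∀ j, ∃ n : ℕ, c j ((rootSystem H).root i) = n) ∧
      (i ∈ closureRoots S → (∀ x ∈ rootSpace H (i : Weight ℂ H g), x ∈ U) ∧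
        ∀ x ∈ rootSpace H (-(i : Weight ℂ H g) : Weight ℂ H g), x ∈ U)) := by
    intro i hi
    refine hi.induction_on_add (p := fun i ↦ b.IsPos i ∧
      (∀ j, ∃ n : ℕ, c j ((rootSystem H).root i) = n) ∧
      (i ∈ closureRoots S → (∀ x ∈ rootSpace H (i : Weight ℂ H g), x ∈ U) ∧
        ∀ x ∈ rootSpace H (-(i : Weight ℂ H g) : Weight ℂ H g), x ∈ U)) ?_ ?_
    · intro i hi
      refine ⟨b.isPos_of_mem_support hi, fun j ↦ ?_, fun hiS ↦ ?_⟩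
      · rw [hc ⟨i, hi⟩ j]
        split_ifs
        exacts [⟨1, by simp⟩, ⟨0, by simp⟩]
      · by_contra hcon
        have hiS' : i ∉ S := fun h ↦ hcon (hU i h)
        have h1 := hspan ⟨i, hi⟩ hiS' i hiS
        rw [hc ⟨i, hi⟩ ⟨i, hi⟩, if_pos rfl] at h1
        exact one_ne_zero h1
    · rintro i j k hk ⟨hi, hin, hiU⟩ hj
      refine ⟨hi.add (b.isPos_of_mem_support hj) hk, fun l ↦ ?_, fun hkS ↦ ?_⟩
      · obtain ⟨n, hn⟩ := hin l
        rw [hk, hadd, hn, hc ⟨j, hj⟩ l]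
        split_ifs
        exacts [⟨n + 1, by simp⟩, ⟨n, by simp⟩]
      · have hjS : j ∈ S := by
          by_contra hjS
          have h1 := hspan ⟨j, hj⟩ hjS k hkS
          obtain ⟨n, hn⟩ := hin ⟨j, hj⟩
          rw [hk, hadd, hn, hc ⟨j, hj⟩ ⟨j, hj⟩, if_pos rfl] at h1
          exact Nat.cast_add_one_ne_zero n h1
        have hiS : i ∈ closureRoots S := by
          have h1 : (rootSystem H).root i = (rootSystem H).root k - (rootSystem H).root j := by
            rw [hk, add_sub_cancel_right]
          change (rootSystem H).root i ∈ Submodule.span ℂ ((rootSystem H).root '' S)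
          rw [h1]
          exact Submodule.sub_mem _ hkS (Submodule.subset_span ⟨j, hjS, rfl⟩)
        refine ⟨rootSpace_le_of_add κ hk (hiU hiS).1 (hU j hjS).1, ?_⟩
        obtain ⟨i', hi'⟩ := exists_negRoot i
        obtain ⟨j', hj'⟩ := exists_negRoot j
        obtain ⟨k', hk'⟩ := exists_negRoot k
        rw [← hk']
        refine rootSpace_le_of_add κ (i := i') (j := j') ?_ ?_ ?_
        · ext s
          have := LinearMap.congr_fun hk s
          simp only [LinearMap.add_apply, rootSystem_root_apply, Weight.toLinear_apply] at this ⊢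
          rw [hi', hj', hk']
          simp only [Weight.coe_neg, Pi.neg_apply]
          rw [this]
          ring
        · rw [hi']
          exact (hiU hiS).2
        · rw [hj']
          exact (hU j hjS).2
  have hroot : ∀ α ∈ closureRoots S, ∀ x ∈ rootSpace H (α : Weight ℂ H g), x ∈ U := by
    intro α hα x hx
    have hneg : (rootSystem H).root ((rootSystem H).reflectionPerm α α) =
        -(rootSystem H).root α := by
      rw [RootPairing.root_reflectionPerm, RootPairing.reflection_apply_self]
    rcases RootPairing.Base.IsPos.or_neg (b := b) α with h | h
    · exact ((hpos α h).2.2 hα).1 x hx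
    · have hneg' : (((rootSystem H).reflectionPerm α α : H.root) : Weight ℂ H g) =
          -(α : Weight ℂ H g) := by
        apply DFunLike.coe_injective
        funext s
        exact LinearMap.congr_fun hneg s
      have h1 : (rootSystem H).reflectionPerm α α ∈ closureRoots S := by
        change (rootSystem H).root ((rootSystem H).reflectionPerm α α) ∈
          Submodule.span ℂ ((rootSystem H).root '' S)
        rw [hneg]
        exact Submodule.neg_mem _ hα
      have h' : b.IsPos ((rootSystem H).reflectionPerm α α) := h
      have h2 := ((hpos _ h').2.2 h1).2
      rw [hneg', neg_neg] at h2
      exact h2 x hx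
  intro x hx
  rw [semisimplePart_eq_span] at hx
  have hle : Submodule.span ℂ
      (((fun α ↦ ((κ.hVec ((rootSystem H).root α) : H) : g)) '' S) ∪
        {x | ∃ α ∈ closureRoots S, x ∈ rootSpace H (α : Weight ℂ H g)}) ≤ U.toSubmodule := by
    rw [Submodule.span_le]
    rintro x (⟨α, hα, rfl⟩ | ⟨α, hα, hx⟩)
    · obtain ⟨y, hy, hy0⟩ := (α : Weight ℂ H g).exists_ne_zero
      obtain ⟨α', hα'⟩ := exists_negRoot α
      have h0 : ((α : Weight ℂ H g) + (α' : Weight ℂ H g) : H → ℂ) = 0 := by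
        funext s
        rw [hα']
        simp
      obtain ⟨z, hz, hyz⟩ : ∃ z ∈ rootSpace H (α' : Weight ℂ H g), κ.form y z ≠ 0 := by
        by_contra! hcon
        exact hy0 (κ.eq_zero_of_rootSpace h0 hy hcon)
      have h1 := lie_eq_hVec κ h0 hy hz
      have h2 : ((κ.hVec ((rootSystem H).root α) : H) : g) = (κ.form y z)⁻¹ • ⁅y, z⁆ := by
        rw [h1]
        change _ = (κ.form y z)⁻¹ • (κ.form y z • ((κ.hVec ((rootSystem H).root α) : H) : g))
        rw [smul_smul, inv_mul_cancel₀ hyz, one_smul]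
      change ((κ.hVec ((rootSystem H).root α) : H) : g) ∈ U
      rw [h2]
      rw [hα'] at hz
      exact U.smul_mem _ (U.lie_mem ((hU α hα).1 y hy) ((hU α hα).2 z hz))
    · exact hroot α hα x hx
  exact hle hx

variable (b : (rootSystem H).Base)

/-- `𝔫 = ∑_{α > 0} 𝔤_α`. -/
def nPos : Submodule ℂ g := rootSum {α | b.IsPos α}

/-- `𝔫⁻ = ∑_{α > 0} 𝔤_{-α}`. -/
def nNeg : Submodule ℂ g := rootSum {α | ¬ b.IsPos α}

/-- `𝔫_S = ∑_{α > 0, α ∉ [S]} 𝔤_α`. -/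
def nS (S : Set H.root) : Submodule ℂ g := rootSum ({α | b.IsPos α} \ closureRoots S)

/-- `𝔫_S⁻ = ∑_{α > 0, α ∉ [S]} 𝔤_{-α}`. -/
def nSNeg (S : Set H.root) : Submodule ℂ g := rootSum ({α | ¬ b.IsPos α} \ closureRoots S)

/-! ### The Weyl group -/

/-- The action of the Weyl group on the set of roots. -/
def weylAct (w : (rootSystem H).weylGroup) (α : H.root) : H.root :=
  (rootSystem H).weylGroupToPerm w α

/-- The length of `w` with respect to the simple reflections. -/
def weylLength (w : (rootSystem H).weylGroup) : ℕ :=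
  sInf {k | ∃ l : List b.support, l.length = k ∧
    w = (l.map fun α ↦ RootPairing.weylGroup.ofIdx (rootSystem H) α).prod}

/-- The subgroup `W_T` generated by the reflections in the elements of `T`. -/
def weylParabolic (T : Set H.root) : Subgroup (rootSystem H).weylGroup :=
  Subgroup.closure (RootPairing.weylGroup.ofIdx (rootSystem H) '' T)

/-- `v ∈ W^T`: `v` has minimal length in its coset `v W_T`. -/
def IsMinRep (T : Set H.root) (v : (rootSystem H).weylGroup) : Prop :=
  ∀ u ∈ weylParabolic T, weylLength b v ≤ weylLength b (v * u)

/-! ### Root vectors, generalized Belavin-Drinfeld triples, and `γ_d` -/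

/-- A choice of root vectors `E_α ∈ 𝔤_α` with `≪E_α, E_{-α}≫ = 1` for positive roots `α`. -/
structure RootVectors (κ : AdInvariantForm g) where
  E : H.root → g
  mem : ∀ α : H.root, E α ∈ rootSpace H (α : Weight ℂ H g)
  form_eq_one : ∀ α β : H.root, b.IsPos α → (rootSystem H).root β = -(rootSystem H).root α →
    κ.form (E α) (E β) = 1

/-- A generalized Belavin-Drinfeld triple: sets `S, T` of simple roots and a bijection `d : S → T`
with `≪dα, dβ≫ = ≪α, β≫` for all `α, β ∈ S`, where `≪α, β≫ = ≪H_α, H_β≫`. -/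
structure BDTriple (κ : AdInvariantForm g) where
  S : Set H.root
  T : Set H.root
  S_subset : S ⊆ b.support
  T_subset : T ⊆ b.support
  d : S ≃ T
  isometry : ∀ α β : S,
    κ.form (κ.hVec ((rootSystem H).root (d α)) : H) (κ.hVec ((rootSystem H).root (d β)) : H) =
      κ.form (κ.hVec ((rootSystem H).root α) : H) (κ.hVec ((rootSystem H).root β) : H)

variable {b} {κ : AdInvariantForm g} (E : RootVectors b κ) (D : BDTriple b κ)

/-- `γ : 𝔤_S → 𝔤_T` satisfies `γ(E_α) = E_{dα}` and `γ(H_α) = H_{dα}` for all `α ∈ S`. -/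
def IsGamma (γ : gS κ D.S ≃ₗ⁅ℂ⁆ gS κ D.T) : Prop :=
  ∀ α : D.S,
    (∀ x : gS κ D.S, (x : g) = E.E α → (γ x : g) = E.E (D.d α)) ∧
    (∀ x : gS κ D.S, (x : g) = (κ.hVec ((rootSystem H).root α) : H) →
      (γ x : g) = (κ.hVec ((rootSystem H).root (D.d α)) : H))

/-- The root `-α`. -/
def negRoot (α : H.root) : H.root := (rootSystem H).reflectionPerm α α

lemma root_negRoot (α : H.root) : (rootSystem H).root (negRoot α) = -(rootSystem H).root α := by
  rw [negRoot, RootPairing.root_reflectionPerm, RootPairing.reflection_apply_self]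

lemma coe_negRoot (α : H.root) : ((negRoot α : H.root) : Weight ℂ H g) = -(α : Weight ℂ H g) := by
  apply DFunLike.coe_injective
  funext s
  exact LinearMap.congr_fun (root_negRoot α) s

lemma isPos_negRoot (α : H.root) : b.IsPos (negRoot α) ↔ ¬ b.IsPos α :=
  RootPairing.Base.IsPos.neg_iff_not (b := b) α

lemma add_eq_zero_iff_negRoot (α β : H.root) :
    ((α : Weight ℂ H g) + (β : Weight ℂ H g) : H → ℂ) = 0 ↔ β = negRoot α := by
  constructor
  · intro h
    apply Subtype.ext
    rw [coe_negRoot]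
    apply DFunLike.coe_injective
    funext s
    exact eq_neg_of_add_eq_zero_right (congrFun h s)
  · rintro rfl
    funext s
    simp [coe_negRoot]

lemma lie_mem_rootSum {A : Set H.root} {α : H.root} {x y : g}
    (h1 : ∀ β ∈ A, β ≠ negRoot α)
    (h2 : ∀ β ∈ A, ∀ γ : H.root,
      (rootSystem H).root γ = (rootSystem H).root α + (rootSystem H).root β → γ ∈ A)
    (hx : x ∈ rootSpace H (α : Weight ℂ H g)) (hy : y ∈ rootSum A) : ⁅x, y⁆ ∈ rootSum A := by
  have hle : rootSum A ≤ (rootSum A).comap (LieAlgebra.ad ℂ g x : g →ₗ[ℂ] g) := by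
    refine iSup₂_le fun β hβ z hz ↦ ?_
    change ⁅x, z⁆ ∈ rootSum A
    have hxz : ⁅x, z⁆ ∈ rootSpace H ((α : Weight ℂ H g) + (β : Weight ℂ H g) : H → ℂ) :=
      lie_mem_genWeightSpace_of_mem_genWeightSpace hx hz
    by_cases hb : rootSpace H ((α : Weight ℂ H g) + (β : Weight ℂ H g) : H → ℂ) = ⊥
    · rw [hb, LieSubmodule.mem_bot] at hxz
      rw [hxz]
      exact zero_mem _
    · let χ : Weight ℂ H g := ⟨_, hb⟩
      have hχ : χ.IsNonZero := fun h ↦ h1 β hβ ((add_eq_zero_iff_negRoot α β).mp h)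
      let γ : H.root := ⟨χ, by simpa using hχ⟩
      refine mem_rootSum (h2 β hβ γ ?_) hxz
      ext s
      rfl
  exact hle hy

lemma form_rootSum (κ : AdInvariantForm g) {A B : Set H.root}
    (h : ∀ α ∈ A, ∀ β ∈ B, β ≠ negRoot α) {x y : g} (hx : x ∈ rootSum A) (hy : y ∈ rootSum B) :
    κ.form x y = 0 := by
  have h1 : ∀ α ∈ A, ∀ x ∈ rootSpace H (α : Weight ℂ H g), rootSum B ≤ LinearMap.ker (κ.form x) :=
    fun α hα x hx ↦ iSup₂_le fun β hβ z hz ↦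
      κ.rootSpace_rootSpace (fun h0 ↦ h α hα β hβ ((add_eq_zero_iff_negRoot α β).mp h0)) hx hz
  have h2 : rootSum A ≤ LinearMap.ker (κ.form.flip y) :=
    iSup₂_le fun α hα z hz ↦ h1 α hα z hz hy
  exact h2 hx

lemma form_cartan_rootSum (κ : AdInvariantForm g) {A : Set H.root} (t : H) {y : g}
    (hy : y ∈ rootSum A) : κ.form t y = 0 := by
  have h : rootSum A ≤ LinearMap.ker (κ.form t) :=
    iSup₂_le fun α _ z hz ↦ κ.cartan_rootSpace t α z hz
  exact h hy

lemma lie_eq_zero_of_simple {i j : H.root} (hi : i ∈ b.support) (hj : j ∈ b.support)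
    (hij : i ≠ j) {x y : g} (hx : x ∈ rootSpace H (i : Weight ℂ H g))
    (hy : y ∈ rootSpace H (negRoot j : Weight ℂ H g)) : ⁅x, y⁆ = 0 := by
  have hxy : ⁅x, y⁆ ∈ rootSpace H ((i : Weight ℂ H g) + (negRoot j : Weight ℂ H g) : H → ℂ) :=
    lie_mem_genWeightSpace_of_mem_genWeightSpace hx hy
  by_cases hb : rootSpace H ((i : Weight ℂ H g) + (negRoot j : Weight ℂ H g) : H → ℂ) = ⊥
  · rwa [hb, LieSubmodule.mem_bot] at hxy
  · exfalso
    let χ : Weight ℂ H g := ⟨_, hb⟩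
    have hχ : χ.IsNonZero := by
      intro h
      have h1 := (add_eq_zero_iff_negRoot i (negRoot j)).mp h
      refine hij ((rootSystem H).root.injective ?_)
      have h2 := congrArg (rootSystem H).root h1
      rw [root_negRoot, root_negRoot, neg_inj] at h2
      exact h2.symm
    refine b.sub_notMem_range_root hi hj ⟨⟨χ, by simpa using hχ⟩, ?_⟩
    rw [sub_eq_add_neg, ← root_negRoot]
    ext s
    rfl

lemma RootVectors.form_negRoot {α : H.root} (hα : b.IsPos α) :
    κ.form (E.E α) (E.E (negRoot α)) = 1 :=
  E.form_eq_one α _ hα (root_negRoot α)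

lemma RootVectors.lie_negRoot {α : H.root} (hα : b.IsPos α) :
    ⁅E.E α, E.E (negRoot α)⁆ = ((κ.hVec ((rootSystem H).root α) : H) : g) := by
  rw [lie_eq_hVec κ ((add_eq_zero_iff_negRoot α _).mpr rfl) (E.mem α) (E.mem _),
    E.form_negRoot hα, one_smul]

lemma RootVectors.mem_of_mem {α : H.root} (hα : E.E α ≠ 0) {U : LieSubalgebra ℂ g}
    (hU : E.E α ∈ U) : ∀ x ∈ rootSpace H (α : Weight ℂ H g), x ∈ U := by
  intro x hx
  obtain ⟨c, hc⟩ := (finrank_eq_one_iff_of_nonzero'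
    (⟨E.E α, E.mem α⟩ : rootSpace H (α : Weight ℂ H g)) (by simpa [Subtype.ext_iff] using hα)).mp
    (finrank_rootSpace_eq_one _ (isNonZero_of_root α)) ⟨x, hx⟩
  have hc' : c • E.E α = x := congrArg Subtype.val hc
  rw [← hc']
  exact U.smul_mem c hU

/-- `(E_α, E_{dα})` -/
def pairE (α : D.S) : g × g := (E.E α, E.E (D.d α))

/-- `(E_{-α}, E_{-dα})` -/
def pairF (α : D.S) : g × g := (E.E (negRoot (α : H.root)), E.E (negRoot (D.d α : H.root)))

/-- `(H_α, H_{dα})` -/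
def pairH (α : D.S) : g × g :=
  (((κ.hVec ((rootSystem H).root α) : H) : g), ((κ.hVec ((rootSystem H).root (D.d α)) : H) : g))

lemma D_isPos (α : D.S) : b.IsPos (α : H.root) := b.isPos_of_mem_support (D.S_subset α.2)

lemma D_isPos' (α : D.S) : b.IsPos (D.d α : H.root) :=
  b.isPos_of_mem_support (D.T_subset (D.d α).2)

lemma pair_lie_EF (α β : D.S) :
    ⁅pairE E D α, pairF E D β⁆ ∈ Submodule.span ℂ (Set.range (pairH D)) := by
  by_cases h : α = β
  · subst h
    have : ⁅pairE E D α, pairF E D α⁆ = pairH D α := by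
      rw [LieAlgebra.Prod.bracket_apply]
      exact Prod.ext (E.lie_negRoot (D_isPos D α)) (E.lie_negRoot (D_isPos' D α))
    rw [this]
    exact Submodule.subset_span ⟨α, rfl⟩
  · have : ⁅pairE E D α, pairF E D β⁆ = 0 := by
      rw [LieAlgebra.Prod.bracket_apply]
      refine Prod.ext ?_ ?_
      · exact lie_eq_zero_of_simple (D.S_subset α.2) (D.S_subset β.2)
          (fun h' ↦ h (Subtype.ext h')) (E.mem _) (E.mem _)
      · exact lie_eq_zero_of_simple (D.T_subset (D.d α).2) (D.T_subset (D.d β).2)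
          (fun h' ↦ h (D.d.injective (Subtype.ext h'))) (E.mem _) (E.mem _)
    rw [this]
    exact zero_mem _

lemma D_root_hVec (α β : D.S) :
    (rootSystem H).root (D.d β) (κ.hVec ((rootSystem H).root (D.d α))) =
      (rootSystem H).root β (κ.hVec ((rootSystem H).root α)) := by
  rw [← κ.form_hVec, ← κ.form_hVec]
  exact D.isometry β α

lemma pair_lie_HE (α β : D.S) : ⁅pairH D α, pairE E D β⁆ =
    (rootSystem H).root β (κ.hVec ((rootSystem H).root α)) • pairE E D β := by
  rw [LieAlgebra.Prod.bracket_apply]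
  refine Prod.ext ?_ ?_
  · exact lie_eq_smul_of_mem_rootSpace (E.mem β) _
  · refine (lie_eq_smul_of_mem_rootSpace (E.mem (D.d β)) _).trans ?_
    rw [← D_root_hVec]
    rfl

lemma pair_lie_HF (α β : D.S) : ⁅pairH D α, pairF E D β⁆ =
    -(rootSystem H).root β (κ.hVec ((rootSystem H).root α)) • pairF E D β := by
  have key : ∀ (t : H) (γ : H.root), ⁅(t : g), E.E (negRoot γ)⁆ =
      -((rootSystem H).root γ t) • E.E (negRoot γ) := by
    intro t γ
    refine (lie_eq_smul_of_mem_rootSpace (E.mem (negRoot γ)) t).trans ?_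
    rw [coe_negRoot]
    rfl
  rw [LieAlgebra.Prod.bracket_apply]
  refine Prod.ext (key _ _) ((key _ _).trans ?_)
  rw [D_root_hVec]
  rfl

/-- The form `≪x₁, y₁≫ - ≪x₂, y₂≫` on `g ⊕ g`. -/
def AdInvariantForm.prodForm (κ : AdInvariantForm g) : LinearMap.BilinForm ℂ (g × g) :=
  κ.form.compl₁₂ (LinearMap.fst ℂ g g) (LinearMap.fst ℂ g g) -
    κ.form.compl₁₂ (LinearMap.snd ℂ g g) (LinearMap.snd ℂ g g)

lemma AdInvariantForm.prodForm_apply (κ : AdInvariantForm g) (p q : g × g) :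
    κ.prodForm p q = κ.form p.1 q.1 - κ.form p.2 q.2 := rfl

/-- The Lie subalgebra of `g ⊕ g` generated by all `(E_α, E_{dα})` and `(E_{-α}, E_{-dα})`,
`α ∈ S`; it is the graph of `γ_d`. -/
def gammaAlg : LieSubalgebra ℂ (g × g) :=
  LieSubalgebra.lieSpan ℂ (g × g) (Set.range (pairE E D) ∪ Set.range (pairF E D))

lemma gammaAlg_isotropic {p q : g × g} (hp : p ∈ gammaAlg E D) (hq : q ∈ gammaAlg E D) :
    κ.form p.1 q.1 = κ.form p.2 q.2 := by
  have hposadd : ∀ α : H.root, b.IsPos α → ∀ β ∈ {α | b.IsPos α}, β ≠ negRoot α := by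
    rintro α hα β hβ rfl
    exact (isPos_negRoot α).mp hβ hα
  have hnegadd : ∀ α : H.root, ¬ b.IsPos α → ∀ β ∈ {α | ¬ b.IsPos α}, β ≠ negRoot α := by
    rintro α hα β hβ rfl
    exact hβ ((isPos_negRoot α).mpr hα)
  have hposlie : ∀ α : H.root, b.IsPos α → ∀ y ∈ nPos b, ⁅E.E α, y⁆ ∈ nPos b :=
    fun α hα y hy ↦ lie_mem_rootSum (hposadd α hα) (fun β hβ γ hγ ↦ hα.add hβ hγ) (E.mem α) hy
  have hneglie : ∀ α : H.root, ¬ b.IsPos α → ∀ y ∈ nNeg b, ⁅E.E α, y⁆ ∈ nNeg b := by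
    refine fun α hα y hy ↦ lie_mem_rootSum (hnegadd α hα) (fun β hβ γ hγ ↦ ?_) (E.mem α) hy
    refine (isPos_negRoot γ).mp (RootPairing.Base.IsPos.add ((isPos_negRoot α).mpr hα)
      ((isPos_negRoot β).mpr hβ) ?_)
    rw [root_negRoot, root_negRoot, root_negRoot, hγ, neg_add]
  have hz : κ.prodForm p q = 0 := by
    refine form_eq_zero_of_generators (P := (nPos b).prod (nPos b)) (M := (nNeg b).prod (nNeg b))
      ?_ ?_ (pair_lie_EF E D) (pair_lie_HE E D) (pair_lie_HF E D) ?_ ?_ ?_ ?_ ?_ ?_ ?_ ?_ hp hq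
    · intro x y z
      simp only [κ.prodForm_apply, LieAlgebra.Prod.bracket_apply, κ.invariant x.1,
        κ.invariant x.2]
      ring
    · intro x y
      rw [κ.prodForm_apply, κ.prodForm_apply, κ.comm x.1, κ.comm x.2]
    · refine iterSpan_le (fun α ↦ ⟨mem_rootSum (D_isPos D α) (E.mem _),
        mem_rootSum (D_isPos' D α) (E.mem _)⟩) fun α x hx ↦ ⟨?_, ?_⟩
      · exact hposlie _ (D_isPos D α) _ hx.1
      · exact hposlie _ (D_isPos' D α) _ hx.2
    · have h1 : ∀ α : D.S, ¬ b.IsPos (negRoot (α : H.root)) :=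
        fun α h ↦ (isPos_negRoot _).mp h (D_isPos D α)
      have h2 : ∀ α : D.S, ¬ b.IsPos (negRoot (D.d α : H.root)) :=
        fun α h ↦ (isPos_negRoot _).mp h (D_isPos' D α)
      refine iterSpan_le (fun α ↦ ⟨mem_rootSum (h1 α) (E.mem _), mem_rootSum (h2 α) (E.mem _)⟩)
        fun α x hx ↦ ⟨?_, ?_⟩
      · exact hneglie _ (h1 α) _ hx.1
      · exact hneglie _ (h2 α) _ hx.2
    · intro x hx y hy
      rw [κ.prodForm_apply, form_rootSum κ hposadd hx.1 hy.1, form_rootSum κ hposadd hx.2 hy.2,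
        sub_zero]
    · intro x hx y hy
      rw [κ.prodForm_apply, form_rootSum κ hnegadd hx.1 hy.1, form_rootSum κ hnegadd hx.2 hy.2,
        sub_zero]
    · intro α y hy
      rw [κ.prodForm_apply]
      exact (congrArg₂ (· - ·) (form_cartan_rootSum κ _ hy.1)
        (form_cartan_rootSum κ _ hy.2)).trans (sub_zero 0)
    · intro α y hy
      rw [κ.prodForm_apply]
      exact (congrArg₂ (· - ·) (form_cartan_rootSum κ _ hy.1)
        (form_cartan_rootSum κ _ hy.2)).trans (sub_zero 0)
    · intro α β
      exact sub_eq_zero.mpr (D.isometry α β).symm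
    · intro α β
      rw [κ.prodForm_apply]
      by_cases h : α = β
      · subst h
        refine (congrArg₂ (· - ·) (E.form_negRoot (D_isPos D α))
          (E.form_negRoot (D_isPos' D α))).trans (sub_self 1)
      · have hneg : ∀ i j : H.root, i ≠ j →
            ((i : Weight ℂ H g) + (negRoot j : Weight ℂ H g) : H → ℂ) ≠ 0 := by
          intro i j hij h0
          have h1 := congrArg (rootSystem H).root ((add_eq_zero_iff_negRoot _ _).mp h0)
          rw [root_negRoot, root_negRoot, neg_inj] at h1
          exact hij ((rootSystem H).root.injective h1.symm)
        refine (congrArg₂ (· - ·)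
          (κ.rootSpace_rootSpace (hneg _ _ fun h' ↦ h (Subtype.ext h')) (E.mem _) (E.mem _))
          (κ.rootSpace_rootSpace (hneg _ _ fun h' ↦ h (D.d.injective (Subtype.ext h')))
            (E.mem _) (E.mem _))).trans (sub_zero 0)
  exact sub_eq_zero.mp hz

lemma root_mem_gS {S : Set H.root} {α : H.root} (hα : α ∈ S) :
    E.E α ∈ gS κ S ∧ E.E (negRoot α) ∈ gS κ S := by
  have h1 : α ∈ closureRoots S := Submodule.subset_span ⟨α, hα, rfl⟩
  have h2 : negRoot α ∈ closureRoots S := by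
    change (rootSystem H).root (negRoot α) ∈ Submodule.span ℂ ((rootSystem H).root '' S)
    rw [root_negRoot]
    exact Submodule.neg_mem _ h1
  exact ⟨Submodule.mem_sup_right (mem_rootSum h1 (E.mem _)),
    Submodule.mem_sup_right (mem_rootSum h2 (E.mem _))⟩

lemma gammaAlg_mem {p : g × g} (hp : p ∈ gammaAlg E D) : p.1 ∈ gS κ D.S ∧ p.2 ∈ gS κ D.T := by
  induction hp using LieSubalgebra.lieSpan_induction with
  | mem x hx =>
    obtain ⟨α, rfl⟩ | ⟨α, rfl⟩ := hx
    · exact ⟨(root_mem_gS E α.2).1, (root_mem_gS E (D.d α).2).1⟩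
    · exact ⟨(root_mem_gS E α.2).2, (root_mem_gS E (D.d α).2).2⟩
  | zero => exact ⟨zero_mem _, zero_mem _⟩
  | add x y _ _ h1 h2 => exact ⟨add_mem h1.1 h2.1, add_mem h1.2 h2.2⟩
  | smul a x _ h => exact ⟨(gS κ D.S).smul_mem a h.1, (gS κ D.T).smul_mem a h.2⟩
  | lie x y _ _ h1 h2 =>
    exact ⟨(gS κ D.S).lie_mem h1.1 h2.1, (gS κ D.T).lie_mem h1.2 h2.2⟩

lemma gammaAlg_fst (x : gS κ D.S) : ∃ p ∈ gammaAlg E D, p.1 = x := by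
  have h := semisimplePart_le_of_simple b κ D.S_subset
    (U := (gammaAlg E D).map (LieHom.fst ℂ g g)) (fun α hα ↦ ?_) x x.2
  · exact h
  · have hp := D_isPos D ⟨α, hα⟩
    have hne := E.form_negRoot hp
    have h1 : E.E α ∈ (gammaAlg E D).map (LieHom.fst ℂ g g) :=
      ⟨pairE E D ⟨α, hα⟩, LieSubalgebra.subset_lieSpan (Or.inl ⟨_, rfl⟩), rfl⟩
    have h2 : E.E (negRoot α) ∈ (gammaAlg E D).map (LieHom.fst ℂ g g) :=
      ⟨pairF E D ⟨α, hα⟩, LieSubalgebra.subset_lieSpan (Or.inr ⟨_, rfl⟩), rfl⟩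
    refine ⟨E.mem_of_mem (fun h0 ↦ by simp [h0] at hne) h1, ?_⟩
    rw [← coe_negRoot]
    exact E.mem_of_mem (fun h0 ↦ by simp [h0] at hne) h2

lemma gammaAlg_snd (x : gS κ D.T) : ∃ p ∈ gammaAlg E D, p.2 = x := by
  have h := semisimplePart_le_of_simple b κ D.T_subset
    (U := (gammaAlg E D).map (LieHom.snd ℂ g g)) (fun α hα ↦ ?_) x x.2
  · exact h
  · have hd : (D.d (D.d.symm ⟨α, hα⟩) : H.root) = α := by simp
    have hp := D_isPos' D (D.d.symm ⟨α, hα⟩)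
    rw [hd] at hp
    have hne := E.form_negRoot hp
    have h1 : E.E α ∈ (gammaAlg E D).map (LieHom.snd ℂ g g) :=
      ⟨pairE E D (D.d.symm ⟨α, hα⟩), LieSubalgebra.subset_lieSpan (Or.inl ⟨_, rfl⟩),
        congrArg E.E hd⟩
    have h2 : E.E (negRoot α) ∈ (gammaAlg E D).map (LieHom.snd ℂ g g) :=
      ⟨pairF E D (D.d.symm ⟨α, hα⟩), LieSubalgebra.subset_lieSpan (Or.inr ⟨_, rfl⟩),
        congrArg (fun β ↦ E.E (negRoot β)) hd⟩
    refine ⟨E.mem_of_mem (fun h0 ↦ by simp [h0] at hne) h1, ?_⟩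
    rw [← coe_negRoot]
    exact E.mem_of_mem (fun h0 ↦ by simp [h0] at hne) h2

lemma gS_nondegenerate {S : Set H.root} {x : g} (hx : x ∈ gS κ S)
    (h : ∀ y ∈ gS κ S, κ.form x y = 0) : x = 0 := by
  refine κ.nondegenerate.1 x fun y ↦ ?_
  have hy : y ∈ semisimplePart κ S ⊔ semisimpleCompl S :=
    (isCompl_semisimplePart κ S).sup_eq_top ▸ Submodule.mem_top
  obtain ⟨u, hu, w, hw, rfl⟩ := Submodule.mem_sup.mp hy
  rw [map_add, h u hu, form_semisimplePart_compl κ S x hx w hw, add_zero]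

/-- The projection of the graph of `γ_d` to `𝔤_S`. -/
def gammaFst : gammaAlg E D →ₗ⁅ℂ⁆ gS κ D.S where
  toFun p := ⟨p.1.1, (gammaAlg_mem E D p.2).1⟩
  map_add' _ _ := rfl
  map_smul' _ _ := rfl
  map_lie' := rfl

/-- The projection of the graph of `γ_d` to `𝔤_T`. -/
def gammaSnd : gammaAlg E D →ₗ⁅ℂ⁆ gS κ D.T where
  toFun p := ⟨p.1.2, (gammaAlg_mem E D p.2).2⟩
  map_add' _ _ := rfl
  map_smul' _ _ := rfl
  map_lie' := rfl

lemma gammaFst_bijective : Function.Bijective (gammaFst E D) := by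
  constructor
  · rw [injective_iff_map_eq_zero]
    rintro ⟨⟨x, y⟩, hp⟩ h0
    have hx : x = 0 := congrArg Subtype.val h0
    subst hx
    have hy : y = 0 := gS_nondegenerate (gammaAlg_mem E D hp).2 fun z hz ↦ by
      obtain ⟨q, hq, hqz⟩ := gammaAlg_snd E D ⟨z, hz⟩
      have := gammaAlg_isotropic E D hp hq
      simpa [hqz] using this.symm
    subst hy
    rfl
  · intro x
    obtain ⟨p, hp, hpx⟩ := gammaAlg_fst E D x
    exact ⟨⟨p, hp⟩, Subtype.ext hpx⟩

lemma gammaSnd_bijective : Function.Bijective (gammaSnd E D) := by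
  constructor
  · rw [injective_iff_map_eq_zero]
    rintro ⟨⟨x, y⟩, hp⟩ h0
    have hy : y = 0 := congrArg Subtype.val h0
    subst hy
    have hx : x = 0 := gS_nondegenerate (gammaAlg_mem E D hp).1 fun z hz ↦ by
      obtain ⟨q, hq, hqz⟩ := gammaAlg_fst E D ⟨z, hz⟩
      have := gammaAlg_isotropic E D hp hq
      simpa [hqz] using this
    subst hx
    rfl
  · intro x
    obtain ⟨p, hp, hpx⟩ := gammaAlg_snd E D x
    exact ⟨⟨p, hp⟩, Subtype.ext hpx⟩

/-- The isomorphism `γ_d : 𝔤_S → 𝔤_T`, constructed through its graph. It is the unique Lie algebra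
isomorphism with `γ_d(E_α) = E_{dα}` and `γ_d(H_α) = H_{dα}` for all `α ∈ S`. -/
def gammaD : gS κ D.S ≃ₗ⁅ℂ⁆ gS κ D.T :=
  (LieEquiv.ofBijective (gammaFst E D) (gammaFst_bijective E D)).symm.trans
    (LieEquiv.ofBijective (gammaSnd E D) (gammaSnd_bijective E D))

lemma gammaD_apply {p : g × g} (hp : p ∈ gammaAlg E D) {x : gS κ D.S} (hx : (x : g) = p.1) :
    (gammaD E D x : g) = p.2 := by
  have h1 : LieEquiv.ofBijective (gammaFst E D) (gammaFst_bijective E D) ⟨p, hp⟩ = x :=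
    Subtype.ext hx.symm
  have h2 : (LieEquiv.ofBijective (gammaFst E D) (gammaFst_bijective E D)).symm x = ⟨p, hp⟩ := by
    rw [← h1, LieEquiv.symm_apply_apply]
  change ((LieEquiv.ofBijective (gammaSnd E D) (gammaSnd_bijective E D)
    ((LieEquiv.ofBijective (gammaFst E D) (gammaFst_bijective E D)).symm x) : gS κ D.T) : g) = p.2
  rw [h2]
  rfl

lemma isGamma_gammaD : IsGamma E D (gammaD E D) := by
  intro α
  have h1 : pairE E D α ∈ gammaAlg E D := LieSubalgebra.subset_lieSpan (Or.inl ⟨α, rfl⟩)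
  have h2 : pairF E D α ∈ gammaAlg E D := LieSubalgebra.subset_lieSpan (Or.inr ⟨α, rfl⟩)
  have h3 : pairH D α ∈ gammaAlg E D := by
    have : pairH D α = ⁅pairE E D α, pairF E D α⁆ := by
      rw [LieAlgebra.Prod.bracket_apply]
      exact (Prod.ext (E.lie_negRoot (D_isPos D α)) (E.lie_negRoot (D_isPos' D α))).symm
    rw [this]
    exact (gammaAlg E D).lie_mem h1 h2
  exact ⟨fun x hx ↦ gammaD_apply E D h1 hx, fun x hx ↦ gammaD_apply E D h3 hx⟩

/-- A set `F ⊆ S` of simple roots is invariant under `v d : S → Σ`. -/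
def IsInvariantUnder (v : (rootSystem H).weylGroup) (F : Set H.root) : Prop :=
  F ⊆ D.S ∧ ∀ α : D.S, (α : H.root) ∈ F → weylAct v (D.d α) ∈ F

/-- `S(v, d)`: the largest subset of `S` that is invariant under `v d`. -/
def Svd (v : (rootSystem H).weylGroup) : Set H.root :=
  ⋃₀ {F | IsInvariantUnder D v F}

end RootData

/-! ### Groups -/

section Groups

variable {g : Type*} [LieRing g] [LieAlgebra ℂ g]

/-- `e = exp(A) = ∑ Aⁿ / n!`; the series is evaluated on vectors and linear functionals. -/
def IsExp (A : Module.End ℂ g) (e : g ≃ₗ[ℂ] g) : Prop :=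
  ∀ (x : g) (f : Dual ℂ g), HasSum (fun n : ℕ ↦ ((n ! : ℂ))⁻¹ * f ((A ^ n) x)) (f (e x))

/-- The group generated by all `exp(ad x)` with `x ∈ 𝔨`. For a Lie subalgebra `𝔨` it is the
connected subgroup with Lie algebra `𝔨` of the adjoint group, as a group of linear
transformations of `g`. -/
def expGroup (k : Submodule ℂ g) : Subgroup (g ≃ₗ[ℂ] g) :=
  Subgroup.closure {e | ∃ x ∈ k, IsExp (LieAlgebra.ad ℂ g x) e}

variable (g) in
/-- The adjoint group `G` of `g`; an element is identified with its adjoint action. -/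
def adjointGroup : Subgroup (g ≃ₗ[ℂ] g) := expGroup ⊤

variable [FiniteDimensional ℂ g] [LieAlgebra.IsSemisimple ℂ g]
  {H : LieSubalgebra ℂ g} [H.IsCartanSubalgebra]

/-- `vdot ∈ G` normalizes `𝔥` and induces `v` on it: `(v α)(vdot x) = α(x)`. -/
def IsRepresentative (v : (rootSystem H).weylGroup) (vdot : g ≃ₗ[ℂ] g) : Prop :=
  vdot ∈ adjointGroup g ∧ ∀ x : H, ∃ y : H, vdot x = y ∧
    ∀ α : H.root, (rootSystem H).root (weylAct v α) y = (rootSystem H).root α x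

/-- The group `M_S`, the connected subgroup of `G` with Lie algebra `𝔪_S`. -/
def leviGroup (S : Set H.root) : Subgroup (g ≃ₗ[ℂ] g) := expGroup (levi S)

end Groups

/-! ### Lagrangian subalgebras and their normalizers -/

section Lagrangian

variable {g : Type*} [LieRing g] [LieAlgebra ℂ g]

/-- `V` is isotropic for `⟨(x₁, x₂), (y₁, y₂)⟩ = ≪x₁, y₁≫ - ≪x₂, y₂≫`. -/
def IsIsotropic (κ : AdInvariantForm g) (V : Submodule ℂ (g × g)) : Prop :=
  ∀ p ∈ V, ∀ q ∈ V, κ.form p.1 q.1 - κ.form p.2 q.2 = 0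

/-- `V` is a Lagrangian subspace of `U`, i.e. maximal among the isotropic subspaces of `U`. -/
def IsLagrangianIn (κ : AdInvariantForm g) (U V : Submodule ℂ (g × g)) : Prop :=
  Maximal (fun V' ↦ V' ≤ U ∧ IsIsotropic κ V') V

/-- The normalizer of `l ⊆ g ⊕ g` in the diagonal `g_Δ`, identified with `g`:
all `x` with `[(x, x), l] ⊆ l`. -/
def diagNormalizer (l : Submodule ℂ (g × g)) : Submodule ℂ g where
  carrier := {x | ∀ p ∈ l, ⁅((x, x) : g × g), p⁆ ∈ l}
  zero_mem' p _ := by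
    have : ((0, 0) : g × g) = 0 := rfl
    simp [this]
  add_mem' {x y} hx hy p hp := by
    have : ((x + y, x + y) : g × g) = (x, x) + (y, y) := rfl
    rw [this, add_lie]
    exact l.add_mem (hx p hp) (hy p hp)
  smul_mem' a x hx p hp := by
    have : ((a • x, a • x) : g × g) = a • (x, x) := rfl
    rw [this, smul_lie]
    exact l.smul_mem a (hx p hp)

variable [FiniteDimensional ℂ g] [LieAlgebra.IsSemisimple ℂ g]
  {H : LieSubalgebra ℂ g} [H.IsCartanSubalgebra] {b : (rootSystem H).Base}
  {κ : AdInvariantForm g} (E : RootVectors b κ) (D : BDTriple b κ)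

/-- The graph `{(x, γ_d(x)) : x ∈ 𝔤_S}`. -/
def gammaGraph : Submodule ℂ (g × g) :=
  LinearMap.range ((gS κ D.S).toSubmodule.subtype.prod
    ((gS κ D.T).toSubmodule.subtype ∘ₗ (gammaD E D : gS κ D.S →ₗ[ℂ] gS κ D.T)))

/-- `𝔩_{S,T,d,V} = V + (𝔫_S ⊕ 𝔫_T⁻) + {(x, γ_d(x)) : x ∈ 𝔤_S}`. -/
def lagr (V : Submodule ℂ (g × g)) : Submodule ℂ (g × g) :=
  V ⊔ (nS b D.S).prod (nSNeg b D.T) ⊔ gammaGraph E D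

/-- `𝔩_{S,T,d,V,vdot,m} = Ad_{(m, vdot)} 𝔩_{S,T,d,V}`. -/
def lagrTwisted (V : Submodule ℂ (g × g)) (vdot m : g ≃ₗ[ℂ] g) : Submodule ℂ (g × g) :=
  (lagr E D V).map (LinearMap.prodMap (m : g →ₗ[ℂ] g) (vdot : g →ₗ[ℂ] g))

/-- `φ = Ad_vdot γ_d χ_S Ad_m⁻¹`. (The map `χ_S` being defined on all of `g`, so is `φ`.) -/
def phi (vdot m : g ≃ₗ[ℂ] g) : Module.End ℂ g :=
  (vdot : g →ₗ[ℂ] g) ∘ₗ (gS κ D.T).toSubmodule.subtype ∘ₗ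
    (gammaD E D : gS κ D.S →ₗ[ℂ] gS κ D.T) ∘ₗ chi κ D.S ∘ₗ (m.symm : g →ₗ[ℂ] g)

/-- `𝔷'_{S(v,d)} = {z ∈ 𝔷_{S(v,d)} : γ_d χ_S(z) = χ_T(Ad_vdot⁻¹ z)}`. -/
def zPrime (v : (rootSystem H).weylGroup) (vdot : g ≃ₗ[ℂ] g) : Submodule ℂ g :=
  center (Svd D v) ⊓ LinearMap.eqLocus
    ((gammaD E D : gS κ D.S →ₗ[ℂ] gS κ D.T) ∘ₗ chi κ D.S)
    (chi κ D.T ∘ₗ (vdot.symm : g →ₗ[ℂ] g))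

/-- `𝔤_{S(v,d)}^φ`, the fixed points of `φ` in `𝔤_{S(v,d)}`. -/
def gFixed (v : (rootSystem H).weylGroup) (vdot m : g ≃ₗ[ℂ] g) : Submodule ℂ g :=
  (gS κ (Svd D v)).toSubmodule ⊓ LinearMap.eqLocus (phi E D vdot m) LinearMap.id

variable (b) in
/-- `𝔫_v = 𝔫 ∩ Ad_vdot(𝔫⁻)`. -/
def nv (vdot : g ≃ₗ[ℂ] g) : Submodule ℂ g :=
  nPos b ⊓ (nNeg b).map (vdot : g →ₗ[ℂ] g)

/-- `ψ = (1 - φ)⁻¹` on a `φ`-invariant subspace `N`, as a map `N → g`. -/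
def psi {N : Submodule ℂ g} {f : Module.End ℂ g} (hf : ∀ x ∈ N, f x ∈ N) : N →ₗ[ℂ] g :=
  N.subtype ∘ₗ (Ring.inverse (1 - f.restrict hf) : Module.End ℂ N)

end Lagrangian

end LagrangianNormalizer

end

noncomputable section

set_option linter.unusedSectionVars false

namespace LagrangianNormalizer

open Module LieAlgebra LieAlgebra.IsKilling LieModule
open scoped Nat

/-! ### Heights and positive roots -/

section Heights

variable {ι M N : Type*} [AddCommGroup M] [Module ℂ M] [AddCommGroup N] [Module ℂ N]
  {P : RootPairing ι ℂ M N} [P.IsRootSystem] (b : P.Base)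

/-! Write 𝔩₀ for 𝔩_{S,T,d,V}. The proof rests on an explicit description of the normalizer of 𝔩₀ in
all of 𝔤 ⊕ 𝔤 (`normalizes_lagr_iff`): (x, y) normalizes 𝔩₀ exactly when x ⟂ 𝔫_S, y ⟂ 𝔫_T⁻ and γ_d
χ_S(x) = χ_T(y). The orthogonality conditions put x in 𝔪_S + 𝔫_S and y in 𝔪_T + 𝔫_T⁻, and V has
disappeared. After conjugation by (m, v̇), `mem_diagNormalizer_iff` leaves two conditions on x:
Ad_m⁻¹ x ⟂ 𝔫_S and x - φ(x) ∈ Ad_v̇(𝔷_T + 𝔫_T⁻).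

The second ingredient is the nilpotency of φ on 𝔫_{S(v,d)}. Consider first σ = Ad_v̇ γ_d χ_S, which
is φ without m. It is adjoint to τ = γ_d⁻¹ χ_T Ad_v̇⁻¹ (`form_sigma`), it kills the root spaces
outside [S], and it moves weights by the transpose of τ on 𝔥, the map `weightMap`, which agrees with
vd on S (`weightMap_root`). Minimality of v and the exchange condition give v(T) > 0
(`IsMinRep.isPos_weylAct`), so `weightMap` sends S to positive roots and never lowers the height of
a positive root in [S]. If a root vector of 𝔫_{S(v,d)} were never killed, take the roots of maximal
height among all such roots: no height is gained under `weightMap`, so the simple roots occurring in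
them are sent by vd to simple roots occurring in them again. They form a vd-invariant subset of S,
hence lie in S(v,d), a contradiction (`exists_invariant_subset`, `nS_le_maxGenEigenspace`). The
element m is put back in `phi_pow_eq_zero`: σ^k is compatible with brackets by 𝔪_{S(v,d)}, so its
kernel in 𝔫_{S(v,d)} is stable under M_{S(v,d)}.

Finally let x be in the normalizer of 𝔩. Adjointness of σ and τ gives ≪φ(u), x≫ = ≪u, x≫ for u ∈
𝔫_{S(v,d)}; iterating, nilpotency gives ≪u, x≫ = 0 (`form_eq_zero_of_mem_diagNormalizer`). Hence x =
s + z + n with s ∈ 𝔤_{S(v,d)}, z ∈ 𝔷_{S(v,d)}, n ∈ 𝔫_{S(v,d)}. As φ preserves all three summands,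
the condition on x - φ(x) splits into φ(s) = s, z ∈ 𝔷'_{S(v,d)} and n - φ(n) ∈ 𝔫_v, the last of
which says n ∈ ψ(𝔫_v) (`diagNormalizer_le`). The converse checks the two conditions on each summand
(`le_diagNormalizer`), using 𝔫_v ⊂ Ad_v̇ 𝔫_T⁻. -/

/-- The linear extension of the height function of a base. -/
def heightHom : M →ₗ[ℂ] ℂ := b.toWeightBasis.constr ℂ fun _ ↦ 1

lemma heightHom_of_mem_support {j : ι} (hj : j ∈ b.support) : heightHom b (P.root j) = 1 := by
  have := b.toWeightBasis.constr_basis ℂ (fun _ ↦ (1 : ℂ)) ⟨j, hj⟩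
  rwa [b.toWeightBasis_apply] at this

lemma heightHom_sum (n : ι → ℂ) :
    heightHom b (∑ j ∈ b.support, n j • P.root j) = ∑ j ∈ b.support, n j := by
  rw [map_sum]
  refine Finset.sum_congr rfl fun j hj ↦ ?_
  rw [map_smul, heightHom_of_mem_support b hj, smul_eq_mul, mul_one]

lemma heightHom_root (i : ι) : heightHom b (P.root i) = b.height i := by
  obtain ⟨f, -, -, hf⟩ := b.exists_root_eq_sum_int i
  rw [b.height_eq_sum hf, hf]
  have := heightHom_sum b (fun j ↦ (f j : ℂ))
  simpa [← Int.cast_smul_eq_zsmul ℂ] using this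

lemma coord_root {l k : ι} (hl : l ∈ b.support) (hk : k ∈ b.support) [Decidable (k = l)] :
    b.toWeightBasis.coord ⟨l, hl⟩ (P.root k) = if k = l then 1 else 0 := by
  classical
  rw [Basis.coord_apply, b.toWeightBasis_repr_root ⟨k, hk⟩, Finsupp.single_apply]
  simp [Subtype.ext_iff]

lemma coord_sum {l : ι} (hl : l ∈ b.support) (n : ι → ℂ) :
    b.toWeightBasis.coord ⟨l, hl⟩ (∑ j ∈ b.support, n j • P.root j) = n l := by
  classical
  rw [map_sum, Finset.sum_congr rfl (g := fun k ↦ if k = l then n k else 0)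
    (fun k hk ↦ by rw [map_smul, coord_root b hl hk]; simp), Finset.sum_ite_eq_of_mem' _ _ _ hl]

lemma coord_eq_zero_of_mem_span {S : Set ι} (hS : S ⊆ b.support) {l : ι} (hl : l ∈ b.support)
    (hlS : l ∉ S) {x : M} (hx : x ∈ Submodule.span ℂ (P.root '' S)) :
    b.toWeightBasis.coord ⟨l, hl⟩ x = 0 := by
  classical
  have : Submodule.span ℂ (P.root '' S) ≤ LinearMap.ker (b.toWeightBasis.coord ⟨l, hl⟩) := by
    rw [Submodule.span_le]
    rintro - ⟨k, hk, rfl⟩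
    rw [SetLike.mem_coe, LinearMap.mem_ker, coord_root b hl (hS hk), if_neg]
    rintro rfl
    exact hlS hk
  exact this hx

variable {b}

/-- A positive root in the span of a set `S` of simple roots is a combination of elements of `S`
with natural coefficients. -/
lemma exists_nat_coeff {S : Set ι} (hS : S ⊆ b.support) {i : ι} (hi : b.IsPos i)
    (hiS : P.root i ∈ Submodule.span ℂ (P.root '' S)) :
    ∃ n : ι → ℕ, (∀ j, n j ≠ 0 → j ∈ S) ∧ P.root i = ∑ j ∈ b.support, (n j : ℂ) • P.root j := by
  classical
  obtain ⟨f, hf0, hf1, hf⟩ := b.exists_root_eq_sum_int i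
  -- The coefficients all have one sign, and the negative sign would make the height nonpositive.
  replace hf1 : 0 < f := by
    refine hf1.resolve_right fun h ↦ ?_
    rw [RootPairing.Base.isPos_iff, b.height_eq_sum hf] at hi
    exact absurd hi (not_lt.mpr (Finset.sum_nonpos fun j _ ↦ h.le j))
  have hf' : P.root i = ∑ j ∈ b.support, (((f j).toNat : ℕ) : ℂ) • P.root j := by
    rw [hf]
    refine Finset.sum_congr rfl fun j _ ↦ ?_
    rw [← Int.cast_smul_eq_zsmul ℂ, ← Int.cast_natCast, Int.toNat_of_nonneg (hf1.le j)]
  refine ⟨fun j ↦ (f j).toNat, fun j hj ↦ ?_, hf'⟩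
  have hjb : j ∈ b.support := hf0 (by
    rw [Function.mem_support]
    intro h
    simp [h] at hj)
  by_contra hjS
  have h1 := coord_eq_zero_of_mem_span b hS hjb hjS hiS
  rw [hf', coord_sum b hjb] at h1
  exact hj (by exact_mod_cast h1)

lemma sum_mem_span {S : Set ι} {n : ι → ℂ} (hn : ∀ j, n j ≠ 0 → j ∈ S) :
    ∑ j ∈ b.support, n j • P.root j ∈ Submodule.span ℂ (P.root '' S) := by
  refine Submodule.sum_mem _ fun j _ ↦ ?_
  by_cases hj : n j = 0
  · rw [hj, zero_smul]
    exact zero_mem _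
  · exact Submodule.smul_mem _ _ (Submodule.subset_span ⟨j, hn j hj, rfl⟩)

lemma height_of_nat_coeff {i : ι} {n : ι → ℕ}
    (h : P.root i = ∑ j ∈ b.support, (n j : ℂ) • P.root j) :
    b.height i = ∑ j ∈ b.support, (n j : ℤ) := by
  have h1 := heightHom_root b i
  rw [h, heightHom_sum b fun j ↦ (n j : ℂ)] at h1
  exact_mod_cast h1.symm

lemma height_of_map_nat_coeff {f : M →ₗ[ℂ] M} {i i' : ι} {n : ι → ℕ} {q : ι → ι}
    (h : P.root i = ∑ j ∈ b.support, (n j : ℂ) • P.root j)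
    (hq : ∀ j, n j ≠ 0 → f (P.root j) = P.root (q j)) (hi' : P.root i' = f (P.root i)) :
    b.height i' = ∑ j ∈ b.support, (n j : ℤ) * b.height (q j) := by
  have h1 := heightHom_root b i'
  rw [hi', h, map_sum, map_sum] at h1
  have h2 : ∀ j ∈ b.support, heightHom b (f ((n j : ℂ) • P.root j)) = n j * b.height (q j) := by
    intro j _
    by_cases hj : n j = 0
    · simp [hj]
    · rw [map_smul, map_smul, hq j hj, heightHom_root, smul_eq_mul]
  rw [Finset.sum_congr rfl h2] at h1
  exact_mod_cast h1.symm

/-- A coefficient `n j` contributes `n j` to the height of `i`, and `n j` times the height of the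
positive root `q j` to the height of the image. The case of interest is `f = weightMap` on `D.S`. -/
lemma height_le_of_map {f : M →ₗ[ℂ] M} {S : Set ι} (hS : S ⊆ b.support)
    (hf : ∀ j ∈ S, ∃ k, b.IsPos k ∧ f (P.root j) = P.root k) {i i' : ι} (hi : b.IsPos i)
    (hiS : P.root i ∈ Submodule.span ℂ (P.root '' S)) (hi' : P.root i' = f (P.root i)) :
    b.height i ≤ b.height i' := by
  classical
  obtain ⟨n, hn, h⟩ := exists_nat_coeff hS hi hiS
  choose! q hq1 hq2 using hf
  rw [height_of_nat_coeff h, height_of_map_nat_coeff h (fun j hj ↦ hq2 j (hn j hj)) hi']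
  refine Finset.sum_le_sum fun j _ ↦ ?_
  by_cases hj : n j = 0
  · simp [hj]
  · have h1 : 0 < b.height (q j) := hq1 j (hn j hj)
    exact le_mul_of_one_le_right (Int.natCast_nonneg _) h1

lemma isPos_of_map {f : M →ₗ[ℂ] M} {S : Set ι} (hS : S ⊆ b.support)
    (hf : ∀ j ∈ S, ∃ k, b.IsPos k ∧ f (P.root j) = P.root k) {i i' : ι} (hi : b.IsPos i)
    (hiS : P.root i ∈ Submodule.span ℂ (P.root '' S)) (hi' : P.root i' = f (P.root i)) :
    b.IsPos i' :=
  lt_of_lt_of_le (b := b.height i) hi (height_le_of_map hS hf hi hiS hi')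

lemma mem_support_of_height_eq_one {i : ι} (hi : b.height i = 1) : i ∈ b.support := by
  classical
  have hpos : b.IsPos i := by rw [RootPairing.Base.isPos_iff, hi]; exact one_pos
  obtain ⟨n, hn, h⟩ := exists_nat_coeff (S := b.support) subset_rfl hpos (by simp)
  have h1 := height_of_nat_coeff h
  rw [hi] at h1
  have h1' : ∑ j ∈ b.support, n j = 1 := by exact_mod_cast h1.symm
  obtain ⟨j, hj, hj0⟩ : ∃ j ∈ b.support, n j ≠ 0 := by
    by_contra! hc
    rw [Finset.sum_eq_zero hc] at h1'
    exact zero_ne_one h1'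
  have h2 := Finset.add_sum_erase _ n hj
  have h3 : n j = 1 := by omega
  have h4 : ∀ k ∈ b.support, k ≠ j → n k = 0 := by
    intro k hk hkj
    have h5 : ∑ k ∈ b.support.erase j, n k = 0 := by omega
    exact Finset.sum_eq_zero_iff.mp h5 k (Finset.mem_erase.mpr ⟨hkj, hk⟩)
  rw [Finset.sum_eq_single j (fun k hk hkj ↦ by rw [h4 k hk hkj]; simp) (fun h ↦ absurd hj h), h3,
    Nat.cast_one, one_smul] at h
  rwa [P.root.injective h]

/-- A set of positive roots in the span of `S` which is mapped to itself by a linear map sending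
the elements of `S` to positive roots contains an element in the span of a subset of `S` which
is mapped to itself. -/
lemma exists_invariant_subset [Finite ι] {f : M →ₗ[ℂ] M} {S : Set ι} (hS : S ⊆ b.support)
    (hf : ∀ j ∈ S, ∃ k, b.IsPos k ∧ f (P.root j) = P.root k) {B : Set ι} (hB : B.Nonempty)
    (hBpos : ∀ i ∈ B, b.IsPos i) (hBS : ∀ i ∈ B, P.root i ∈ Submodule.span ℂ (P.root '' S))
    (hBf : ∀ i ∈ B, ∃ i' ∈ B, P.root i' = f (P.root i)) :
    ∃ i ∈ B, ∃ F ⊆ S, (∀ j ∈ F, ∃ k ∈ F, f (P.root j) = P.root k) ∧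
      P.root i ∈ Submodule.span ℂ (P.root '' F) := by
  classical
  obtain ⟨i₀, hi₀, hmax⟩ := Set.exists_max_image B b.height (Set.toFinite B) hB
  choose! n hn hsum using fun i (hi : i ∈ B) ↦ exists_nat_coeff hS (hBpos i hi) (hBS i hi)
  choose! q hq1 hq2 using hf
  -- The subset collects the simple roots occurring in the elements of `B` of maximal height.
  refine ⟨i₀, hi₀, {j | ∃ i ∈ B, b.height i = b.height i₀ ∧ n i j ≠ 0}, ?_, ?_, ?_⟩
  · rintro j ⟨i, hi, -, hj⟩
    exact hn i hi j hj
  · rintro j ⟨i, hi, hih, hj⟩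
    obtain ⟨i', hi', hii'⟩ := hBf i hi
    have hle := height_le_of_map hS (fun j hj ↦ ⟨q j, hq1 j hj, hq2 j hj⟩) (hBpos i hi)
      (hBS i hi) hii'
    have hih' : b.height i' = b.height i := le_antisymm (hih ▸ hmax i' hi') hle
    have h1 := height_of_map_nat_coeff (hsum i hi) (fun j hj ↦ hq2 j (hn i hi j hj)) hii'
    rw [hih', height_of_nat_coeff (hsum i hi)] at h1
    have hterm : ∀ k ∈ b.support, (n i k : ℤ) ≤ n i k * b.height (q k) := by
      intro k _
      by_cases hk : n i k = 0
      · simp [hk]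
      · have : 0 < b.height (q k) := hq1 k (hn i hi k hk)
        exact le_mul_of_one_le_right (Int.natCast_nonneg _) this
    -- The two heights agree while each term can only grow, so every `q k` that occurs has height
    -- one and is simple.
    have hsimple : ∀ k, n i k ≠ 0 → q k ∈ b.support := by
      intro k hk
      have h2 := (Finset.sum_eq_sum_iff_of_le hterm).mp h1 k (hS (hn i hi k hk))
      refine mem_support_of_height_eq_one (b := b) ?_
      have hk' : (n i k : ℤ) ≠ 0 := by exact_mod_cast hk
      exact mul_left_cancel₀ hk' (by rw [← h2, mul_one])
    refine ⟨q j, ⟨i', hi', hih'.trans hih, ?_⟩, hq2 j (hn i hi j hj)⟩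
    have hqj := hsimple j hj
    have h3 := congrArg (b.toWeightBasis.coord ⟨q j, hqj⟩) hii'
    have h6 : ∀ k ∈ b.support, b.toWeightBasis.coord ⟨q j, hqj⟩ (f ((n i k : ℂ) • P.root k)) =
        if q k = q j then (n i k : ℂ) else 0 := by
      intro k _
      by_cases hk0 : n i k = 0
      · simp [hk0]
      · rw [map_smul, map_smul, hq2 k (hn i hi k hk0), coord_root b hqj (hsimple k hk0)]
        simp
    rw [hsum i' hi', coord_sum b hqj fun k ↦ (n i' k : ℂ), hsum i hi, map_sum, map_sum,
      Finset.sum_congr rfl h6] at h3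
    -- The coefficient of `q j` in the image is the sum of the natural numbers `n i k` over all `k`
    -- with `q k = q j`. Nothing can cancel, so its vanishing would force `n i j = 0`.
    intro h0
    rw [h0, Nat.cast_zero, eq_comm] at h3
    have h4 : ∑ k ∈ b.support, (if q k = q j then n i k else 0) = 0 := by
      have : ((∑ k ∈ b.support, (if q k = q j then n i k else 0) : ℕ) : ℂ) = 0 := by
        push_cast
        exact h3
      exact_mod_cast this
    have h5 := Finset.sum_eq_zero_iff.mp h4 j (hS (hn i hi j hj))
    rw [if_pos rfl] at h5
    exact hj h5
  · rw [hsum i₀ hi₀]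
    exact sum_mem_span fun j hj ↦ ⟨i₀, hi₀, rfl, by exact_mod_cast hj⟩

/-- A positive coefficient outside a set of simple roots makes a root positive. -/
lemma isPos_of_add {S : Set ι} (hS : S ⊆ b.support) {i j k : ι}
    (hi : P.root i ∈ Submodule.span ℂ (P.root '' S)) (hj : b.IsPos j)
    (hjS : P.root j ∉ Submodule.span ℂ (P.root '' S)) (hk : P.root k = P.root i + P.root j) :
    b.IsPos k := by
  classical
  let _ := P.indexNeg
  obtain ⟨n, -, hn⟩ := exists_nat_coeff (S := b.support) subset_rfl hj (by simp)
  obtain ⟨l, hl, hlS, hl0⟩ : ∃ l ∈ b.support, l ∉ S ∧ n l ≠ 0 := by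
    by_contra! hc
    refine hjS (hn ▸ Submodule.sum_mem _ fun l hl ↦ ?_)
    by_cases hlS : l ∈ S
    · exact Submodule.smul_mem _ _ (Submodule.subset_span ⟨l, hlS, rfl⟩)
    · rw [hc l hl hlS, Nat.cast_zero, zero_smul]
      exact zero_mem _
  have hi0 := coord_eq_zero_of_mem_span b hS hl hlS hi
  by_contra hneg
  have hneg' : b.IsPos (-k) := (RootPairing.Base.IsPos.neg_iff_not (b := b) k).mpr hneg
  obtain ⟨n', -, hn'⟩ := exists_nat_coeff (S := b.support) subset_rfl hneg' (by simp)
  have h1 : P.root (-k) = -P.root k := by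
    rw [RootPairing.indexNeg_neg, RootPairing.root_reflectionPerm,
      RootPairing.reflection_apply_self]
  have h2 := congrArg (b.toWeightBasis.coord ⟨l, hl⟩) (hn'.symm.trans h1)
  rw [coord_sum b hl fun j ↦ (n' j : ℂ), map_neg, hk, map_add, hi0, hn,
    coord_sum b hl fun j ↦ (n j : ℂ), zero_add,
    eq_neg_iff_add_eq_zero] at h2
  have h3 : n' l + n l = 0 := by exact_mod_cast h2
  omega

/-! ### The exchange condition -/

/-- Both sides are compared on the weight space, where automorphisms act faithfully. What remains is
that `w` preserves the pairing with the coroot, which is the transpose relation between its weight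
and coweight maps. -/
lemma weylGroup_ofIdx_conj (w : P.weylGroup) (i : ι) :
    RootPairing.weylGroup.ofIdx P (P.weylGroupToPerm w i) * w =
      w * RootPairing.weylGroup.ofIdx P i := by
  refine Subtype.ext (RootPairing.Equiv.weightHom_injective P (LinearEquiv.ext fun x ↦ ?_))
  change P.reflection (P.weylGroupToPerm w i) ((w : P.Aut) • x) =
    (w : P.Aut) • (P.reflection i x)
  rw [RootPairing.reflection_apply, RootPairing.reflection_apply, smul_sub,
    smul_comm (w : P.Aut) _ (P.root i)]
  have h1 : (w : P.Aut) • P.root i = P.root (P.weylGroupToPerm w i) :=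
    RootPairing.weylGroup_apply_root P w i
  rw [h1]
  congr 2
  have h2 := LinearMap.congr_fun (RootPairing.Hom.weight_coweight_transpose_apply P P
    (P.coroot (P.weylGroupToPerm w i)) (w : P.Aut).toHom) x
  rw [RootPairing.Hom.coroot_coweightMap_apply] at h2
  have h3 : (w : P.Aut).toHom.indexEquiv.symm (P.weylGroupToPerm w i) = i :=
    (w : P.Aut).toHom.indexEquiv.symm_apply_apply i
  rw [h3] at h2
  exact h2

lemma weylGroupToPerm_ofIdx (i j : ι) :
    P.weylGroupToPerm (RootPairing.weylGroup.ofIdx P i) j = P.reflectionPerm i j := by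
  rfl

lemma weylGroup_ofIdx_mul_self (i : ι) :
    RootPairing.weylGroup.ofIdx P i * RootPairing.weylGroup.ofIdx P i = 1 := by
  refine Subtype.ext ?_
  change RootPairing.Equiv.reflection P i * RootPairing.Equiv.reflection P i = 1
  rw [mul_eq_one_iff_inv_eq, RootPairing.Equiv.reflection_inv P i]

/-- The exchange condition: reading the word from the right, the root `i` first turns negative at
some letter, and multiplying by the reflection in `i` deletes exactly that letter. -/
lemma exists_word_of_not_isPos [Finite ι] [P.IsCrystallographic] [P.IsReduced] {i : ι}
    (hi : i ∈ b.support) (l : List b.support)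
    (hl : ¬ b.IsPos (P.weylGroupToPerm
      (l.map fun α : b.support ↦ RootPairing.weylGroup.ofIdx P α).prod i)) :
    ∃ l' : List b.support, l'.length + 1 = l.length ∧
      (l.map fun α : b.support ↦ RootPairing.weylGroup.ofIdx P α).prod *
        RootPairing.weylGroup.ofIdx P i =
      (l'.map fun α : b.support ↦ RootPairing.weylGroup.ofIdx P α).prod := by
  induction l with
  | nil => exact absurd (b.isPos_of_mem_support hi) fun h ↦ hl (by
      rw [List.map_nil, List.prod_nil, map_one]
      exact h)
  | cons j l ih =>
    simp only [List.map_cons, List.prod_cons] at hl ⊢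
    set w := (l.map fun α : b.support ↦ RootPairing.weylGroup.ofIdx P α).prod
    by_cases hw : b.IsPos (P.weylGroupToPerm w i)
    · refine ⟨l, rfl, ?_⟩
      -- The simple reflection in `j` keeps every positive root other than `j` positive.
      have h1 : P.weylGroupToPerm w i = j := by
        by_contra hne
        refine hl ?_
        rw [map_mul, Equiv.Perm.mul_apply, weylGroupToPerm_ofIdx]
        exact hw.reflectionPerm j.2 hne
      rw [← h1, weylGroup_ofIdx_conj, mul_assoc, weylGroup_ofIdx_mul_self, mul_one]
    · obtain ⟨l', hl', h⟩ := ih hw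
      exact ⟨j :: l', by simp [hl'], by rw [mul_assoc, h, List.map_cons, List.prod_cons]⟩

/-- All reflections together generate the Weyl group by definition. Every root is reached from
simple ones by negation and simple reflections, and the conjugation formula carries words along
these moves. -/
lemma exists_word [Finite ι] [P.IsCrystallographic] [P.IsReduced] (b : P.Base) (w : P.weylGroup) :
    ∃ l : List b.support,
      w = (l.map fun α : b.support ↦ RootPairing.weylGroup.ofIdx P α).prod := by
  have hmul : ∀ w w' : P.weylGroup,
      (∃ l : List b.support,
        w = (l.map fun α : b.support ↦ RootPairing.weylGroup.ofIdx P α).prod) →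
      (∃ l : List b.support,
        w' = (l.map fun α : b.support ↦ RootPairing.weylGroup.ofIdx P α).prod) →
      ∃ l : List b.support,
        w * w' = (l.map fun α : b.support ↦ RootPairing.weylGroup.ofIdx P α).prod := by
    rintro _ _ ⟨l, rfl⟩ ⟨l', rfl⟩
    exact ⟨l ++ l', by simp⟩
  have hsimple : ∀ j ∈ b.support, ∃ l : List b.support, RootPairing.weylGroup.ofIdx P j =
      (l.map fun α : b.support ↦ RootPairing.weylGroup.ofIdx P α).prod :=
    fun j hj ↦ ⟨[⟨j, hj⟩], by simp⟩
  have hconj : ∀ i j, RootPairing.weylGroup.ofIdx P (P.reflectionPerm j i) =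
      RootPairing.weylGroup.ofIdx P j * (RootPairing.weylGroup.ofIdx P i *
        RootPairing.weylGroup.ofIdx P j) := by
    intro i j
    have h := weylGroup_ofIdx_conj (RootPairing.weylGroup.ofIdx P j) i
    rw [← mul_assoc, ← h, mul_assoc, weylGroup_ofIdx_mul_self, mul_one]
    rfl
  have hroot : ∀ i, ∃ l : List b.support, RootPairing.weylGroup.ofIdx P i =
      (l.map fun α : b.support ↦ RootPairing.weylGroup.ofIdx P α).prod := by
    intro i
    refine b.induction_reflect i ?_ hsimple ?_
    · intro i hi
      rw [hconj]
      exact hmul _ _ hi (hmul _ _ hi hi)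
    · intro i j hi hj
      rw [hconj]
      exact hmul _ _ (hsimple j hj) (hmul _ _ hi (hsimple j hj))
  obtain ⟨w, hw⟩ := w
  induction hw using RootPairing.weylGroup.induction with
  | mem i => exact hroot i
  | one => exact ⟨[], rfl⟩
  | mul x y hx hy h1 h2 => exact hmul _ _ h1 h2

end Heights

/-! ### Minimal coset representatives keep the simple roots of `T` positive -/

section WeylLength

variable {g : Type*} [LieRing g] [LieAlgebra ℂ g] [FiniteDimensional ℂ g]
  [LieAlgebra.IsSemisimple ℂ g] {H : LieSubalgebra ℂ g} [H.IsCartanSubalgebra]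
  {b : (rootSystem H).Base}

/-- In `weylLength` the word over `b.support` is coerced, as a list, to a word over `H.root`. Here
the coercion is made letter by letter inside the map, the form in which the exchange condition is
stated. -/
lemma weylLength_eq (w : (rootSystem H).weylGroup) : weylLength b w =
    sInf {k | ∃ l : List b.support, l.length = k ∧
      w = (l.map fun α : b.support ↦ RootPairing.weylGroup.ofIdx (rootSystem H) α).prod} := by
  have h : ∀ l : List b.support,
      ((do let a ← l; pure (a : H.root) : List H.root).map
        fun α ↦ RootPairing.weylGroup.ofIdx (rootSystem H) α) =
      l.map fun α : b.support ↦ RootPairing.weylGroup.ofIdx (rootSystem H) α := by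
    intro l
    induction l with
    | nil => rfl
    | cons a l ih =>
      rw [List.map_cons, ← ih]
      rfl
  simp only [weylLength, h]

/-- If `v α` were negative, the exchange condition would shorten a minimal word for `v` to a word
for `v` times the reflection in `α`, an element of the same coset. -/
lemma IsMinRep.isPos_weylAct {T : Set H.root} (hT : T ⊆ b.support)
    {v : (rootSystem H).weylGroup} (hv : IsMinRep b T v) {α : H.root} (hα : α ∈ T) :
    b.IsPos (weylAct v α) := by
  by_contra hneg
  have hne : {k | ∃ l : List b.support, l.length = k ∧
      v = (l.map fun α : b.support ↦
        RootPairing.weylGroup.ofIdx (rootSystem H) α).prod}.Nonempty := by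
    obtain ⟨l, hl⟩ := exists_word b v
    exact ⟨_, l, rfl, hl⟩
  obtain ⟨l, hl, hvl⟩ := Nat.sInf_mem hne
  obtain ⟨l', hl', h⟩ := exists_word_of_not_isPos (hT hα) l (hvl ▸ hneg)
  have h1 := hv _ (Subgroup.subset_closure ⟨α, hα, rfl⟩)
  have h2 : weylLength b (v * RootPairing.weylGroup.ofIdx (rootSystem H) α) ≤ l'.length := by
    rw [weylLength_eq]
    exact Nat.sInf_le ⟨l', rfl, by rw [← h, ← hvl]⟩
  rw [weylLength_eq (w := v), ← hl] at h1
  omega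

end WeylLength

/-! ### Exponentials -/

section Exponential

variable {g : Type*} [LieRing g] [LieAlgebra ℂ g]

lemma IsExp.eq_self {A : Module.End ℂ g} {e : g ≃ₗ[ℂ] g} (he : IsExp A e) {x : g} (hx : A x = 0) :
    e x = x := by
  rw [← sub_eq_zero, ← Module.forall_dual_apply_eq_zero_iff ℂ]
  intro f
  have h1 : HasSum (fun n : ℕ ↦ ((n ! : ℂ))⁻¹ * f ((A ^ n) x)) (f x) := by
    have h2 : ∀ n : ℕ, n ≠ 0 → ((n ! : ℂ))⁻¹ * f ((A ^ n) x) = 0 := by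
      intro n hn
      obtain ⟨k, rfl⟩ := Nat.exists_eq_succ_of_ne_zero hn
      rw [pow_succ, Module.End.mul_apply, hx]
      simp
    simpa using hasSum_single 0 h2
  rw [map_sub, (he x f).unique h1, sub_self]

variable [FiniteDimensional ℂ g]

/-- A functional vanishing on `U` vanishes on every term of the exponential series, hence on its
sum, so it cannot separate `e x` from `U`. -/
lemma IsExp.mem_of_stable {A : Module.End ℂ g} {e : g ≃ₗ[ℂ] g} (he : IsExp A e)
    {U : Submodule ℂ g} (hU : ∀ x ∈ U, A x ∈ U) {x : g} (hx : x ∈ U) : e x ∈ U := by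
  by_contra hex
  obtain ⟨f, hf, hfU⟩ := Submodule.exists_le_ker_of_notMem hex
  have hpow : ∀ n : ℕ, (A ^ n) x ∈ U := by
    intro n
    induction n with
    | zero => simpa using hx
    | succ n ih =>
      rw [pow_succ', Module.End.mul_apply]
      exact hU _ ih
  have h1 : HasSum (fun n : ℕ ↦ ((n ! : ℂ))⁻¹ * f ((A ^ n) x)) 0 := by
    have : ∀ n : ℕ, ((n ! : ℂ))⁻¹ * f ((A ^ n) x) = 0 := by
      intro n
      rw [LinearMap.mem_ker.mp (hfU (hpow n)), mul_zero]
    simp only [this]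
    exact hasSum_zero
  exact hf ((he x f).unique h1)

/-- The induction runs on the equality `U.map e = U`, which passes to inverses as a mere inclusion
would not. For a single exponential the inclusion becomes an equality by dimension. -/
lemma mem_of_mem_expGroup {k U : Submodule ℂ g} (hU : ∀ y ∈ k, ∀ x ∈ U, ⁅y, x⁆ ∈ U)
    {e : g ≃ₗ[ℂ] g} (he : e ∈ expGroup k) {x : g} : e x ∈ U ↔ x ∈ U := by
  have h : U.map (e : g →ₗ[ℂ] g) = U := by
    induction he using Subgroup.closure_induction with
    | mem e he =>
      obtain ⟨y, hy, he⟩ := he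
      refine Submodule.eq_of_le_of_finrank_le ?_ (LinearEquiv.finrank_map_eq e U).ge
      rintro - ⟨x, hx, rfl⟩
      exact he.mem_of_stable (hU y hy) hx
    | one => exact Submodule.map_id U
    | mul e e' _ _ h h' =>
      calc U.map ((e * e' : g ≃ₗ[ℂ] g) : g →ₗ[ℂ] g)
          = (U.map (e' : g →ₗ[ℂ] g)).map (e : g →ₗ[ℂ] g) := Submodule.map_comp _ _ _
        _ = U := by rw [h', h]
    | inv e _ h =>
      conv_lhs => rw [← h]
      rw [← Submodule.map_comp]
      convert Submodule.map_id U
      ext x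
      exact e.symm_apply_apply x
  constructor
  · intro hx
    rw [← h] at hx
    obtain ⟨y, hy, hyx⟩ := hx
    rwa [← e.injective hyx]
  · intro hx
    rw [← h]
    exact ⟨x, hx, rfl⟩

lemma symm_mem_of_mem_expGroup {k U : Submodule ℂ g} (hU : ∀ y ∈ k, ∀ x ∈ U, ⁅y, x⁆ ∈ U)
    {e : g ≃ₗ[ℂ] g} (he : e ∈ expGroup k) {x : g} : e.symm x ∈ U ↔ x ∈ U :=
  mem_of_mem_expGroup hU ((expGroup k).inv_mem he)

lemma apply_eq_self_of_mem_expGroup {k : Submodule ℂ g} {e : g ≃ₗ[ℂ] g} (he : e ∈ expGroup k)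
    {x : g} (hx : ∀ y ∈ k, ⁅y, x⁆ = 0) : e x = x := by
  induction he using Subgroup.closure_induction with
  | mem e he =>
    obtain ⟨y, hy, he⟩ := he
    exact he.eq_self (hx y hy)
  | one => rfl
  | mul e e' _ _ h h' => exact (congrArg e h').trans h
  | inv e _ h => exact e.symm_apply_eq.mpr h.symm

/-- The Cauchy product formula for a bilinear form at two exponentials. -/
lemma IsExp.hasSum_bilin {A : Module.End ℂ g} {e : g ≃ₗ[ℂ] g} (he : IsExp A e)
    (B : LinearMap.BilinForm ℂ g) (x y : g) :
    HasSum (fun n : ℕ ↦ ((n ! : ℂ))⁻¹ * ∑ p ∈ Finset.HasAntidiagonal.antidiagonal n,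
      (n.choose p.1 : ℂ) * B ((A ^ p.1) x) ((A ^ p.2) y)) (B (e x) (e y)) := by
  let b := Module.finBasis ℂ g
  let c : ∀ _ : Fin (Module.finrank ℂ g), Dual ℂ g := fun i ↦ b.coord i
  have hB : ∀ u w : g, B u w = ∑ i, ∑ j, B (b i) (b j) * (c i u * c j w) := by
    intro u w
    conv_lhs => rw [← b.sum_repr u, ← b.sum_repr w]
    simp only [map_sum, LinearMap.sum_apply, map_smul, LinearMap.smul_apply, smul_eq_mul]
    simp only [Finset.mul_sum]
    rw [Finset.sum_comm]
    refine Finset.sum_congr rfl fun i _ ↦ Finset.sum_congr rfl fun j _ ↦ ?_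
    simp only [c, Basis.coord_apply]
    ring
  -- In coordinates only products of two complex series remain. These converge absolutely, so the
  -- Cauchy product applies.
  have hprod : ∀ i j, HasSum (fun n : ℕ ↦ ∑ p ∈ Finset.HasAntidiagonal.antidiagonal n,
      (((p.1 ! : ℂ))⁻¹ * c i ((A ^ p.1) x)) * (((p.2 ! : ℂ))⁻¹ * c j ((A ^ p.2) y)))
      (c i (e x) * c j (e y)) := by
    intro i j
    have h1 := he x (c i)
    have h2 := he y (c j)
    have h3 := summable_norm_sum_mul_antidiagonal_of_summable_norm h1.summable.norm
      h2.summable.norm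
    have h4 := tsum_mul_tsum_eq_tsum_sum_antidiagonal_of_summable_norm h1.summable.norm
      h2.summable.norm
    rw [h1.tsum_eq, h2.tsum_eq] at h4
    rw [h4]
    exact h3.of_norm.hasSum
  rw [hB]
  refine Eq.mpr (congrArg (HasSum · _) (funext fun n ↦ ?_))
    (hasSum_sum fun i _ ↦ hasSum_sum fun j _ ↦ (hprod i j).mul_left (B (b i) (b j)))
  simp only [Finset.mul_sum]
  rw [Finset.sum_congr rfl fun i _ ↦ Finset.sum_comm, Finset.sum_comm]
  refine Finset.sum_congr rfl fun p hp ↦ ?_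
  rw [hB]
  simp only [Finset.mul_sum]
  refine Finset.sum_congr rfl fun i _ ↦ Finset.sum_congr rfl fun j _ ↦ ?_
  have hn : (n.choose p.1 : ℂ) * (p.1 ! : ℂ) * (p.2 ! : ℂ) = (n ! : ℂ) := by
    rw [← Finset.HasAntidiagonal.mem_antidiagonal.mp hp]
    rw [Nat.choose_symm_add]
    exact_mod_cast Nat.add_choose_mul_factorial_mul_factorial p.1 p.2
  have h0 : (n ! : ℂ) ≠ 0 := by exact_mod_cast n.factorial_ne_zero
  have h1 : (p.1 ! : ℂ) ≠ 0 := by exact_mod_cast p.1.factorial_ne_zero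
  have h2 : (p.2 ! : ℂ) ≠ 0 := by exact_mod_cast p.2.factorial_ne_zero
  field_simp
  rw [← hn]
  ring

/-- The exponential of a derivation is an automorphism: after applying a functional, the Leibniz
formula for the powers of `ad z` matches the Cauchy product term by term. -/
lemma IsExp.map_lie {z : g} {e : g ≃ₗ[ℂ] g} (he : IsExp (LieAlgebra.ad ℂ g z) e) (x y : g) :
    e ⁅x, y⁆ = ⁅e x, e y⁆ := by
  rw [← sub_eq_zero, ← Module.forall_dual_apply_eq_zero_iff ℂ]
  intro f
  rw [map_sub, sub_eq_zero]
  let B : LinearMap.BilinForm ℂ g := (LieModule.toEnd ℂ g g : g →ₗ[ℂ] Module.End ℂ g).compr₂ f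
  have hB : ∀ u w, B u w = f ⁅u, w⁆ := fun _ _ ↦ rfl
  refine (he ⁅x, y⁆ f).unique
    (Eq.mpr (congrArg (HasSum · _) (funext fun n ↦ ?_)) (he.hasSum_bilin B x y))
  congr 1
  -- An inner derivation here is `u ↦ ⁅u, a⁆`, so `ad z` is the one given by `a = -z`.
  have h := LieDerivation.iterate_apply_lie (LieDerivation.inner ℂ g g (-z)) n x y
  have hD : (LieDerivation.inner ℂ g g (-z) : g → g) = LieAlgebra.ad ℂ g z := by
    funext u
    change ⁅u, -z⁆ = ⁅z, u⁆
    rw [lie_neg, lie_skew]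
  rw [hD] at h
  rw [Module.End.pow_apply, h, map_sum]
  refine Finset.sum_congr rfl fun p _ ↦ ?_
  rw [map_nsmul, hB, nsmul_eq_mul, Module.End.pow_apply, Module.End.pow_apply]

/-- Since `ad z` is skew for the form, moving its powers to one side leaves in degree `n` an
alternating sum of binomial coefficients, which vanishes except for `n = 0`. -/
lemma IsExp.form_apply {κ : AdInvariantForm g} {z : g} {e : g ≃ₗ[ℂ] g}
    (he : IsExp (LieAlgebra.ad ℂ g z) e) (x y : g) : κ.form (e x) (e y) = κ.form x y := by
  refine (he.hasSum_bilin κ.form x y).unique ?_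
  have hpow : ∀ (p : ℕ) (u w : g), κ.form ((LieAlgebra.ad ℂ g z ^ p) u) w =
      (-1) ^ p * κ.form u ((LieAlgebra.ad ℂ g z ^ p) w) := by
    intro p
    induction p with
    | zero => simp
    | succ p ih =>
      intro u w
      have h1 : (LieAlgebra.ad ℂ g z ^ (p + 1)) u = (LieAlgebra.ad ℂ g z ^ p) ⁅z, u⁆ := by
        rw [pow_succ, Module.End.mul_apply, LieAlgebra.ad_apply]
      have h2 : (LieAlgebra.ad ℂ g z ^ (p + 1)) w = ⁅z, (LieAlgebra.ad ℂ g z ^ p) w⁆ := by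
        rw [pow_succ', Module.End.mul_apply, LieAlgebra.ad_apply]
      rw [h1, h2, ih, κ.invariant]
      ring
  have h1 : ∀ n : ℕ, n ≠ 0 → ((n ! : ℂ))⁻¹ * ∑ p ∈ Finset.HasAntidiagonal.antidiagonal n, (n.choose p.1 : ℂ) *
      κ.form ((LieAlgebra.ad ℂ g z ^ p.1) x) ((LieAlgebra.ad ℂ g z ^ p.2) y) = 0 := by
    intro n hn
    have h2 : ∀ p ∈ Finset.HasAntidiagonal.antidiagonal n, (n.choose p.1 : ℂ) *
        κ.form ((LieAlgebra.ad ℂ g z ^ p.1) x) ((LieAlgebra.ad ℂ g z ^ p.2) y) =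
        (((-1) ^ p.1 * n.choose p.1 : ℤ) : ℂ) * κ.form x ((LieAlgebra.ad ℂ g z ^ n) y) := by
      intro p hp
      rw [hpow, ← Module.End.mul_apply, ← pow_add, Finset.HasAntidiagonal.mem_antidiagonal.mp hp]
      push_cast
      ring
    rw [Finset.sum_congr rfl h2, ← Finset.sum_mul, ← Int.cast_sum,
      Finset.Nat.sum_antidiagonal_eq_sum_range_succ_mk,
      Int.alternating_sum_range_choose_of_ne hn]
    simp
  simpa using hasSum_single 0 h1

lemma map_lie_of_mem_expGroup {k : Submodule ℂ g} {e : g ≃ₗ[ℂ] g} (he : e ∈ expGroup k) :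
    ∀ x y : g, e ⁅x, y⁆ = ⁅e x, e y⁆ := by
  induction he using Subgroup.closure_induction with
  | mem e he =>
    obtain ⟨z, -, he⟩ := he
    exact he.map_lie
  | one => exact fun _ _ ↦ rfl
  | mul e e' _ _ h h' => exact fun x y ↦ (congrArg e (h' x y)).trans (h _ _)
  | inv e _ h =>
    intro x y
    change e.symm ⁅x, y⁆ = ⁅e.symm x, e.symm y⁆
    rw [e.symm_apply_eq, h, e.apply_symm_apply, e.apply_symm_apply]

lemma form_apply_of_mem_expGroup (κ : AdInvariantForm g) {k : Submodule ℂ g} {e : g ≃ₗ[ℂ] g}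
    (he : e ∈ expGroup k) : ∀ x y : g, κ.form (e x) (e y) = κ.form x y := by
  induction he using Subgroup.closure_induction with
  | mem e he =>
    obtain ⟨z, -, he⟩ := he
    exact he.form_apply
  | one => exact fun _ _ ↦ rfl
  | mul e e' _ _ h h' => exact fun x y ↦ (h _ _).trans (h' x y)
  | inv e _ h =>
    intro x y
    change κ.form (e.symm x) (e.symm y) = _
    rw [← h, e.apply_symm_apply, e.apply_symm_apply]

end Exponential

section RootDecomposition

variable {g : Type*} [LieRing g] [LieAlgebra ℂ g] [FiniteDimensional ℂ g]
  [LieAlgebra.IsSemisimple ℂ g] {H : LieSubalgebra ℂ g} [H.IsCartanSubalgebra]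

/-! ### Sums of root spaces -/

lemma rootSum_le {A : Set H.root} {U : Submodule ℂ g}
    (h : ∀ α ∈ A, ∀ x ∈ rootSpace H (α : Weight ℂ H g), x ∈ U) : rootSum A ≤ U :=
  iSup₂_le h

lemma rootSum_mono {A B : Set H.root} (h : A ⊆ B) : rootSum A ≤ (rootSum B : Submodule ℂ g) :=
  rootSum_le fun _ hα _ hx ↦ mem_rootSum (h hα) hx

lemma negRoot_negRoot (α : H.root) : negRoot (negRoot α) = α := by
  refine (rootSystem H).root.injective ?_
  rw [root_negRoot, root_negRoot, neg_neg]

lemma negRoot_mem_closureRoots {S : Set H.root} {α : H.root} :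
    negRoot α ∈ closureRoots S ↔ α ∈ closureRoots S := by
  simp only [closureRoots, Set.mem_ofPred_eq, root_negRoot, neg_mem_iff]

lemma exists_root_decomposition (x : g) : ∃ (t : H) (f : H.root → g),
    (∀ α : H.root, f α ∈ rootSpace H (α : Weight ℂ H g)) ∧ x = t + ∑ α : H.root, f α := by
  have hx : x ∈ H.toSubmodule ⊔ ⨆ α : H.root, (rootSpace H (α : Weight ℂ H g)).toSubmodule := by
    rw [iSup_rootSpace_eq_top]
    exact Submodule.mem_top
  obtain ⟨t, ht, y, hy, rfl⟩ := Submodule.mem_sup.mp hx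
  obtain ⟨f, hf, rfl⟩ := (Submodule.mem_iSup_iff_exists_finsupp _ _).mp hy
  exact ⟨⟨t, ht⟩, f, hf, by rw [Finsupp.sum_fintype _ _ fun _ ↦ rfl]⟩

/-- The form pairs `𝔤_α` with `𝔤_{-α}` perfectly, while `𝔤_{-α}` is orthogonal to `𝔥` and to every
other root space. So orthogonality to `𝔤_{-α}` kills the `α`-component. -/
lemma mem_cartan_sup_rootSum (κ : AdInvariantForm g) {A : Set H.root} {x : g}
    (h : ∀ α ∉ A, ∀ e ∈ rootSpace H (negRoot α : Weight ℂ H g), κ.form x e = 0) :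
    x ∈ H.toSubmodule ⊔ rootSum A := by
  obtain ⟨t, f, hf, rfl⟩ := exists_root_decomposition (H := H) x
  refine Submodule.add_mem_sup t.2 (Submodule.sum_mem _ fun α _ ↦ ?_)
  by_cases hα : α ∈ A
  · exact mem_rootSum hα (hf α)
  · have h0 : f α = 0 := by
      refine κ.eq_zero_of_rootSpace ((add_eq_zero_iff_negRoot α _).mpr rfl) (hf α) fun e he ↦ ?_
      have h1 := h α hα e he
      rw [map_add, LinearMap.add_apply, κ.cartan_rootSpace t _ e he, zero_add, map_sum,
        LinearMap.sum_apply, Finset.sum_eq_single α] at h1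
      · exact h1
      · intro β _ hβ
        refine κ.rootSpace_rootSpace (fun h2 ↦ hβ ?_) (hf β) he
        have h3 := (add_eq_zero_iff_negRoot β _).mp h2
        rw [← negRoot_negRoot α, h3, negRoot_negRoot]
      · exact fun h2 ↦ absurd (Finset.mem_univ α) h2
    rw [h0]
    exact zero_mem _

lemma eq_zero_of_mem_cartan_of_mem_rootSum (κ : AdInvariantForm g) {A : Set H.root} {x : g}
    (hx : x ∈ H) (hxA : x ∈ rootSum A) : x = 0 := by
  have h : (⟨x, hx⟩ : H) = 0 := κ.restrictCartan_nondegenerate.1 _ fun t ↦ by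
    rw [κ.restrictCartan_apply, κ.comm]
    exact form_cartan_rootSum κ t hxA
  exact congrArg Subtype.val h

lemma form_rootSum_rootSpace (κ : AdInvariantForm g) {A : Set H.root} {α : H.root} (hα : α ∉ A)
    {x e : g} (hx : x ∈ rootSum A) (he : e ∈ rootSpace H (negRoot α : Weight ℂ H g)) :
    κ.form x e = 0 := by
  have h : rootSum A ≤ LinearMap.ker (κ.form.flip e) := rootSum_le fun β hβ z hz ↦
    κ.rootSpace_rootSpace (fun h0 ↦ hα (by
      rw [← negRoot_negRoot α, (add_eq_zero_iff_negRoot β _).mp h0, negRoot_negRoot]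
      exact hβ)) hz he
  exact h hx

lemma mem_rootSum_of_orthogonal (κ : AdInvariantForm g) {A B : Set H.root} {x : g}
    (hx : x ∈ rootSum B)
    (h : ∀ α ∈ B, α ∉ A → ∀ e ∈ rootSpace H (negRoot α : Weight ℂ H g), κ.form x e = 0) :
    x ∈ rootSum (A ∩ B) := by
  have h1 : x ∈ H.toSubmodule ⊔ rootSum (A ∩ B) := by
    refine mem_cartan_sup_rootSum κ fun α hα e he ↦ ?_
    by_cases hB : α ∈ B
    · exact h α hB (fun hA ↦ hα ⟨hA, hB⟩) e he
    · exact form_rootSum_rootSpace κ hB hx he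
  obtain ⟨t, ht, y, hy, rfl⟩ := Submodule.mem_sup.mp h1
  have h2 : t ∈ rootSum B := by
    have := sub_mem hx (rootSum_mono Set.inter_subset_right hy)
    rwa [add_sub_cancel_right] at this
  rw [eq_zero_of_mem_cartan_of_mem_rootSum κ ht h2, zero_add]
  exact hy

lemma rootSum_inf_le (κ : AdInvariantForm g) (A B : Set H.root) :
    (rootSum A ⊓ rootSum B : Submodule ℂ g) ≤ rootSum (A ∩ B) := by
  rintro x ⟨hA, hB⟩
  exact mem_rootSum_of_orthogonal κ hB fun α _ hα e he ↦ form_rootSum_rootSpace κ hα hA he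

lemma lie_cartan_eq (t : H) {α : H.root} {x : g} (hx : x ∈ rootSpace H (α : Weight ℂ H g)) :
    ⁅(t : g), x⁆ = (rootSystem H).root α t • x :=
  lie_eq_smul_of_mem_rootSpace hx t

lemma lie_cartan_cartan (t s : H) : ⁅(t : g), (s : g)⁆ = 0 :=
  congrArg Subtype.val (LieModule.IsTrivial.trivial t s)

lemma lie_cartan_mem_rootSum (t : H) {A : Set H.root} {x : g} (hx : x ∈ rootSum A) :
    ⁅(t : g), x⁆ ∈ rootSum A := by
  have h : rootSum A ≤ (rootSum A).comap (LieAlgebra.ad ℂ g (t : g) : g →ₗ[ℂ] g) :=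
    rootSum_le fun α hα x hx ↦ by
      change ⁅(t : g), x⁆ ∈ rootSum A
      rw [lie_cartan_eq t hx]
      exact Submodule.smul_mem _ _ (mem_rootSum hα hx)
  exact h hx

lemma lie_rootSum_mem_rootSum {B A : Set H.root}
    (h1 : ∀ α ∈ B, ∀ β ∈ A, β ≠ negRoot α)
    (h2 : ∀ α ∈ B, ∀ β ∈ A, ∀ γ : H.root,
      (rootSystem H).root γ = (rootSystem H).root α + (rootSystem H).root β → γ ∈ A)
    {y x : g} (hy : y ∈ H.toSubmodule ⊔ rootSum B) (hx : x ∈ rootSum A) : ⁅y, x⁆ ∈ rootSum A := by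
  -- The composite below is the linear map `y ↦ ⁅y, x⁆`; it turns the claim into an inclusion that
  -- can be checked on root spaces.
  have h : H.toSubmodule ⊔ rootSum B ≤
      (rootSum A).comap (LieModule.toModuleHom ℂ g g ∘ₗ (TensorProduct.mk ℂ g g).flip x :
        g →ₗ[ℂ] g) := by
    refine sup_le (fun t ht ↦ ?_) (rootSum_le fun α hα z hz ↦ ?_)
    · exact lie_cartan_mem_rootSum ⟨t, ht⟩ hx
    · exact lie_mem_rootSum (h1 α hα) (h2 α hα) hz hx
  exact h hy

/-! ### Nilradicals of parabolic subalgebras -/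

/-- `C` is the set of roots of the nilradical of a parabolic subalgebra with Levi factor `𝔪_S`. -/
structure IsNilradical (S C : Set H.root) : Prop where
  mem_or : ∀ α, α ∈ closureRoots S ∨ α ∈ C ∨ negRoot α ∈ C
  notMem : ∀ α ∈ C, α ∉ closureRoots S
  neg_notMem : ∀ α ∈ C, negRoot α ∉ C
  add_mem : ∀ α β γ : H.root, α ∈ closureRoots S ∪ C → β ∈ C →
    (rootSystem H).root γ = (rootSystem H).root α + (rootSystem H).root β → γ ∈ C

lemma isNilradical_pos {b : (rootSystem H).Base} {S : Set H.root} (hS : S ⊆ b.support) :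
    IsNilradical S ({α | b.IsPos α} \ closureRoots S) where
  mem_or α := by
    by_cases h : α ∈ closureRoots S
    · exact Or.inl h
    · right
      by_cases h' : b.IsPos α
      · exact Or.inl ⟨h', h⟩
      · exact Or.inr ⟨(isPos_negRoot α).mpr h', fun h'' ↦ h (negRoot_mem_closureRoots.mp h'')⟩
  notMem α hα := hα.2
  neg_notMem α hα h := (isPos_negRoot α).mp h.1 hα.1
  add_mem := by
    rintro α β γ (hα | hα) hβ hγ
    · refine ⟨isPos_of_add hS hα hβ.1 hβ.2 hγ, fun h ↦ hβ.2 ?_⟩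
      have h1 : (rootSystem H).root β = (rootSystem H).root γ - (rootSystem H).root α := by
        rw [hγ, add_sub_cancel_left]
      rw [closureRoots, Set.mem_ofPred_eq, h1]
      exact Submodule.sub_mem _ h hα
    · refine ⟨RootPairing.Base.IsPos.add hα.1 hβ.1 hγ, fun h ↦ ?_⟩
      -- If `γ` were in `[S]`, adding `-γ` to `β` would leave a positive root, but the sum is `-α`.
      refine (isPos_negRoot α).mp (isPos_of_add hS (i := negRoot γ) ?_ hβ.1 hβ.2 ?_) hα.1
      · exact negRoot_mem_closureRoots.mpr h
      · rw [root_negRoot, root_negRoot, hγ]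
        abel

lemma IsNilradical.neg {S C : Set H.root} (h : IsNilradical S C) :
    IsNilradical S {α | negRoot α ∈ C} where
  mem_or α := by
    simp only [Set.mem_ofPred_eq, negRoot_negRoot]
    exact (h.mem_or α).imp_right Or.symm
  notMem α hα h' := h.notMem _ hα (negRoot_mem_closureRoots.mpr h')
  neg_notMem α hα h' := h.neg_notMem _ hα h'
  add_mem α β γ hα hβ hγ := by
    refine h.add_mem (negRoot α) (negRoot β) (negRoot γ) ?_ hβ ?_
    · exact hα.imp_left negRoot_mem_closureRoots.mpr
    · rw [root_negRoot, root_negRoot, root_negRoot, hγ, neg_add]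

lemma isNilradical_neg {b : (rootSystem H).Base} {S : Set H.root} (hS : S ⊆ b.support) :
    IsNilradical S ({α | ¬ b.IsPos α} \ closureRoots S) := by
  convert (isNilradical_pos hS).neg using 1
  ext α
  simp only [Set.mem_sdiff, Set.mem_ofPred_eq, isPos_negRoot, negRoot_mem_closureRoots]

lemma closureRoots_mono {F S : Set H.root} (h : F ⊆ S) : closureRoots F ⊆ closureRoots S := by
  intro α hα
  have h1 : Submodule.span ℂ ((rootSystem H).root '' F) ≤
      Submodule.span ℂ ((rootSystem H).root '' S) := Submodule.span_mono (Set.image_mono h)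
  exact h1 hα

lemma levi_mono {F S : Set H.root} (h : F ⊆ S) : levi F ≤ (levi S : Submodule ℂ g) :=
  sup_le_sup_left (rootSum_mono (closureRoots_mono h)) H.toSubmodule

lemma IsNilradical.lie_mem {S C : Set H.root} (h : IsNilradical S C) {y x : g}
    (hy : y ∈ H.toSubmodule ⊔ rootSum (closureRoots S ∪ C)) (hx : x ∈ rootSum C) :
    ⁅y, x⁆ ∈ rootSum C := by
  refine lie_rootSum_mem_rootSum ?_ (fun α hα β hβ γ hγ ↦ h.add_mem α β γ hα hβ hγ) hy hx
  rintro α (hα | hα) β hβ rfl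
  · exact h.notMem _ hβ (negRoot_mem_closureRoots.mpr hα)
  · exact h.neg_notMem _ hα hβ

lemma IsNilradical.levi_lie_mem {S C : Set H.root} (h : IsNilradical S C) {y x : g}
    (hy : y ∈ levi S) (hx : x ∈ rootSum C) : ⁅y, x⁆ ∈ rootSum C :=
  h.lie_mem ((sup_le_sup_left (rootSum_mono Set.subset_union_left) H.toSubmodule :
    levi S ≤ H.toSubmodule ⊔ rootSum (closureRoots S ∪ C)) hy) hx

lemma mem_cartan_of_mem_center {S : Set H.root} {z : g} (hz : z ∈ center S) : z ∈ H := by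
  obtain ⟨t, -, rfl⟩ := hz
  exact t.2

lemma root_eq_zero_of_mem_span {S : Set H.root} {t : H} (ht : (t : g) ∈ center S) {f : Dual ℂ H}
    (hf : f ∈ Submodule.span ℂ ((rootSystem H).root '' S)) : f t = 0 := by
  obtain ⟨s, hs, hst⟩ := ht
  obtain rfl : s = t := Subtype.ext hst
  have hs' : s ∈ ⨅ α ∈ S, LinearMap.ker ((rootSystem H).root α) := hs
  simp only [Submodule.mem_iInf, LinearMap.mem_ker] at hs'
  induction hf using Submodule.span_induction with
  | mem f hf =>
    obtain ⟨α, hα, rfl⟩ := hf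
    exact hs' α hα
  | zero => simp
  | add f g _ _ h1 h2 => simp [h1, h2]
  | smul a f _ h => simp [h]

lemma mem_center {S : Set H.root} {t : H} (ht : ∀ α ∈ S, (rootSystem H).root α t = 0) :
    (t : g) ∈ center S := by
  refine ⟨t, ?_, rfl⟩
  change t ∈ ⨅ α ∈ S, LinearMap.ker ((rootSystem H).root α)
  simpa only [Submodule.mem_iInf, LinearMap.mem_ker] using ht

lemma levi_lie_center {S : Set H.root} {y z : g} (hy : y ∈ levi S) (hz : z ∈ center S) :
    ⁅y, z⁆ = 0 := by
  have hzH := mem_cartan_of_mem_center hz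
  have h : levi S ≤ LinearMap.ker (LieAlgebra.ad ℂ g z : g →ₗ[ℂ] g) := by
    refine sup_le (fun t ht ↦ ?_) (rootSum_le fun α hα x hx ↦ ?_)
    · exact lie_cartan_cartan ⟨z, hzH⟩ ⟨t, ht⟩
    · refine (lie_cartan_eq ⟨z, hzH⟩ hx).trans ?_
      rw [root_eq_zero_of_mem_span (S := S) hz hα, zero_smul]
  rw [← lie_skew, neg_eq_zero]
  exact h hy

variable (κ : AdInvariantForm g)

lemma cartan_le (S : Set H.root) : H.toSubmodule ≤ semisimplePart κ S ⊔ center S := by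
  intro x hx
  have h : (⟨x, hx⟩ : H) ∈ Submodule.span ℂ ((rootSystem H).coroot '' closureRoots S) ⊔
      ⨅ α ∈ S, LinearMap.ker ((rootSystem H).root α) := by
    rw [(isCompl_span_coroot S).sup_eq_top]
    exact Submodule.mem_top
  obtain ⟨y, hy, z, hz, hyz⟩ := Submodule.mem_sup.mp h
  have h2 : x = y + z := (congrArg Subtype.val hyz).symm
  rw [h2]
  refine Submodule.add_mem_sup ?_ ⟨z, hz, rfl⟩
  have h3 : Submodule.span ℂ ((rootSystem H).coroot '' closureRoots S) ≤
      (semisimplePart κ S).comap H.toSubmodule.subtype := by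
    rw [Submodule.span_le]
    rintro - ⟨α, hα, rfl⟩
    exact coroot_mem_semisimplePart κ S hα
  exact h3 hy

lemma levi_le (S : Set H.root) : levi S ≤ semisimplePart κ S ⊔ center S :=
  sup_le (cartan_le κ S) (le_sup_right.trans le_sup_left)

lemma hVec_span_le (S : Set H.root) :
    Submodule.span ℂ ((fun α ↦ ((κ.hVec ((rootSystem H).root α) : H) : g)) '' S) ≤
      H.toSubmodule := by
  rw [Submodule.span_le]
  rintro - ⟨α, -, rfl⟩
  exact (κ.hVec ((rootSystem H).root α)).2

lemma semisimplePart_le_levi (S : Set H.root) : semisimplePart κ S ≤ levi S :=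
  sup_le_sup_right (hVec_span_le κ S) _

lemma levi_lie_semisimplePart {S : Set H.root} {y x : g} (hy : y ∈ levi S)
    (hx : x ∈ semisimplePart κ S) : ⁅y, x⁆ ∈ semisimplePart κ S := by
  obtain ⟨s, hs, z, hz, rfl⟩ := Submodule.mem_sup.mp (levi_le κ S hy)
  rw [add_lie, ← lie_skew z x, levi_lie_center (semisimplePart_le_levi κ S hx) hz, neg_zero,
    add_zero]
  exact lie_mem_semisimplePart κ S hs hx

lemma mem_span_hVec_of_mem_cartan {S : Set H.root} {x : g} (hx : x ∈ semisimplePart κ S)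
    (hxH : x ∈ H) :
    x ∈ Submodule.span ℂ ((fun α ↦ ((κ.hVec ((rootSystem H).root α) : H) : g)) '' S) := by
  obtain ⟨s, hs, r, hr, rfl⟩ := Submodule.mem_sup.mp hx
  have h : r ∈ H := by
    have := H.sub_mem hxH (hVec_span_le κ S hs)
    rwa [add_sub_cancel_left] at this
  rw [eq_zero_of_mem_cartan_of_mem_rootSum κ h hr, add_zero]
  exact hs

/-! ### The projection to `𝔤_S` -/

lemma chi_of_mem {S : Set H.root} {x : g} (hx : x ∈ semisimplePart κ S) :
    (chi κ S x : g) = x :=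
  congrArg Subtype.val
    (Submodule.projectionOnto_apply_left (isCompl_semisimplePart κ S) ⟨x, hx⟩)

lemma chi_of_mem_compl {S : Set H.root} {x : g} (hx : x ∈ semisimpleCompl S) : chi κ S x = 0 :=
  Submodule.projectionOnto_apply_of_mem_right (isCompl_semisimplePart κ S) hx

lemma chi_mem (S : Set H.root) (x : g) : (chi κ S x : g) ∈ semisimplePart κ S := (chi κ S x).2

lemma chi_add {S : Set H.root} {x y : g} (hx : x ∈ semisimplePart κ S)
    (hy : y ∈ semisimpleCompl S) : (chi κ S (x + y) : g) = x := by
  rw [map_add, chi_of_mem_compl κ hy, add_zero, chi_of_mem κ hx]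

lemma sub_chi_mem (S : Set H.root) (x : g) : x - chi κ S x ∈ semisimpleCompl S := by
  have hx : x ∈ semisimplePart κ S ⊔ semisimpleCompl S := by
    rw [(isCompl_semisimplePart κ S).sup_eq_top]
    exact Submodule.mem_top
  obtain ⟨a, ha, c, hc, rfl⟩ := Submodule.mem_sup.mp hx
  rwa [chi_add κ ha hc, add_sub_cancel_left]

/-- The projection is an orthogonal one: its kernel `semisimpleCompl S` is orthogonal to `𝔤_S`. -/
lemma form_chi_left {S : Set H.root} (x : g) {y : g} (hy : y ∈ semisimplePart κ S) :
    κ.form (chi κ S x) y = κ.form x y := by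
  have h := form_semisimplePart_compl κ S y hy _ (sub_chi_mem κ S x)
  rw [map_sub, sub_eq_zero, κ.comm, κ.comm y] at h
  exact h.symm

lemma mem_compl_of_orthogonal {S : Set H.root} {x : g}
    (h : ∀ y ∈ semisimplePart κ S, κ.form y x = 0) : x ∈ semisimpleCompl S := by
  have h0 : (chi κ S x : g) = 0 := gS_nondegenerate (chi_mem κ S x) fun y hy ↦ by
    rw [form_chi_left κ x hy, κ.comm]
    exact h y hy
  have := sub_chi_mem κ S x
  rwa [h0, sub_zero] at this

/-- The complement is the orthogonal complement of `𝔤_S`, and `ad y` is skew and preserves `𝔤_S`. -/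
lemma levi_lie_compl (κ : AdInvariantForm g) {S : Set H.root} {y x : g} (hy : y ∈ levi S)
    (hx : x ∈ semisimpleCompl S) : ⁅y, x⁆ ∈ semisimpleCompl S := by
  refine mem_compl_of_orthogonal κ fun u hu ↦ ?_
  have h := κ.invariant y u x
  rw [form_semisimplePart_compl κ S _ (levi_lie_semisimplePart κ hy hu) x hx, eq_comm,
    neg_eq_zero] at h
  exact h

lemma chi_levi_lie {S : Set H.root} {y : g} (hy : y ∈ levi S) (x : g) :
    (chi κ S ⁅y, x⁆ : g) = ⁅y, (chi κ S x : g)⁆ := by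
  have h : ⁅y, x⁆ = ⁅y, (chi κ S x : g)⁆ + ⁅y, x - chi κ S x⁆ := by
    rw [← lie_add, add_sub_cancel]
  conv_lhs => rw [h]
  exact chi_add κ (levi_lie_semisimplePart κ hy (chi_mem κ S x))
    (levi_lie_compl κ hy (sub_chi_mem κ S x))

lemma sub_chi_mem_center {S : Set H.root} {y : g} (hy : y ∈ levi S) :
    y - chi κ S y ∈ center S := by
  obtain ⟨s, hs, z, hz, rfl⟩ := Submodule.mem_sup.mp (levi_le κ S hy)
  rw [chi_add κ hs (Submodule.mem_sup_left hz), add_sub_cancel_left]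
  exact hz

/-- The component of `y` that `χ_S` discards lies in `𝔷_S` and commutes with `𝔤_S`, so the
equivariance of `χ_S` under `𝔪_S` becomes multiplicativity. -/
lemma chi_lie_levi {S : Set H.root} {y : g} (hy : y ∈ levi S) (x : g) :
    chi κ S ⁅y, x⁆ = ⁅chi κ S y, chi κ S x⁆ := by
  refine Subtype.ext ((chi_levi_lie κ hy x).trans ?_)
  change _ = ⁅(chi κ S y : g), (chi κ S x : g)⁆
  rw [← sub_eq_zero, ← sub_lie, ← lie_skew,
    levi_lie_center (semisimplePart_le_levi κ S (chi_mem κ S x)) (sub_chi_mem_center κ hy),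
    neg_zero]

lemma chi_mem_cartan {S : Set H.root} {t : g} (ht : t ∈ H) : (chi κ S t : g) ∈ H := by
  have h := H.sub_mem ht (mem_cartan_of_mem_center
    (sub_chi_mem_center κ (S := S) (Submodule.mem_sup_left ht)))
  rwa [sub_sub_cancel] at h

end RootDecomposition

section Gamma

variable {g : Type*} [LieRing g] [LieAlgebra ℂ g] [FiniteDimensional ℂ g]
  [LieAlgebra.IsSemisimple ℂ g] {H : LieSubalgebra ℂ g} [H.IsCartanSubalgebra]
  {b : (rootSystem H).Base} {κ : AdInvariantForm g} (E : RootVectors b κ) (D : BDTriple b κ)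

/-! ### Properties of `γ_d` -/

/-- The graph of `γ_d` is isotropic for the difference form. Together with `form_gammaD_symm` this
makes the inverse of `γ_d` its adjoint. -/
lemma form_gammaD (x y : gS κ D.S) :
    κ.form (gammaD E D x) (gammaD E D y) = κ.form x y := by
  obtain ⟨p, hp, hpx⟩ := gammaAlg_fst E D x
  obtain ⟨q, hq, hqy⟩ := gammaAlg_fst E D y
  rw [gammaD_apply E D hp hpx.symm, gammaD_apply E D hq hqy.symm, ← hpx, ← hqy,
    gammaAlg_isotropic E D hp hq]

lemma form_gammaD_symm (x : gS κ D.S) (y : gS κ D.T) :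
    κ.form (gammaD E D x) y = κ.form x ((gammaD E D).symm y) := by
  rw [← form_gammaD E D, LieEquiv.apply_symm_apply]

lemma hVec_mem_gS {S : Set H.root} {α : H.root} (hα : α ∈ S) :
    ((κ.hVec ((rootSystem H).root α) : H) : g) ∈ gS κ S :=
  hVec_mem_semisimplePart κ S _ (Submodule.subset_span ⟨α, hα, rfl⟩)

/-- The Cartan part of `𝔤_S` is spanned by the `H_α` with `α ∈ S`, and these go to `H_{dα}`. -/
lemma gammaD_mem_cartan {x : gS κ D.S} (hx : (x : g) ∈ H) : (gammaD E D x : g) ∈ H := by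
  have h : Submodule.span ℂ ((fun α ↦ ((κ.hVec ((rootSystem H).root α) : H) : g)) '' D.S) ≤
      (H.toSubmodule.comap ((gS κ D.T).toSubmodule.subtype ∘ₗ
        (gammaD E D : gS κ D.S →ₗ[ℂ] gS κ D.T))).map (gS κ D.S).toSubmodule.subtype := by
    rw [Submodule.span_le]
    rintro - ⟨α, hα, rfl⟩
    refine ⟨⟨_, hVec_mem_gS hα⟩, ?_, rfl⟩
    change (gammaD E D ⟨_, hVec_mem_gS hα⟩ : g) ∈ H
    rw [(isGamma_gammaD E D ⟨α, hα⟩).2 _ rfl]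
    exact (κ.hVec _).2
  obtain ⟨y, hy, hyx⟩ := h (mem_span_hVec_of_mem_cartan κ x.2 hx)
  obtain rfl : y = x := Subtype.ext hyx
  exact hy

lemma gammaD_symm_mem_cartan {x : gS κ D.T} (hx : (x : g) ∈ H) :
    ((gammaD E D).symm x : g) ∈ H := by
  have h : Submodule.span ℂ ((fun α ↦ ((κ.hVec ((rootSystem H).root α) : H) : g)) '' D.T) ≤
      (H.toSubmodule.comap ((gS κ D.S).toSubmodule.subtype ∘ₗ
        ((gammaD E D).symm : gS κ D.T →ₗ[ℂ] gS κ D.S))).map (gS κ D.T).toSubmodule.subtype := by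
    rw [Submodule.span_le]
    rintro - ⟨α, hα, rfl⟩
    refine ⟨⟨_, hVec_mem_gS hα⟩, ?_, rfl⟩
    change ((gammaD E D).symm ⟨_, hVec_mem_gS hα⟩ : g) ∈ H
    obtain ⟨β, hβ⟩ := D.d.surjective ⟨α, hα⟩
    have h1 := (isGamma_gammaD E D β).2 ⟨_, hVec_mem_gS β.2⟩ rfl
    have h2 : gammaD E D ⟨_, hVec_mem_gS β.2⟩ = ⟨_, hVec_mem_gS hα⟩ := by
      refine Subtype.ext (h1.trans ?_)
      rw [hβ]
    rw [← h2, LieEquiv.symm_apply_apply]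
    exact (κ.hVec _).2
  obtain ⟨y, hy, hyx⟩ := h (mem_span_hVec_of_mem_cartan κ x.2 hx)
  obtain rfl : y = x := Subtype.ext hyx
  exact hy

end Gamma

section Representative

variable {g : Type*} [LieRing g] [LieAlgebra ℂ g] [FiniteDimensional ℂ g]
  [LieAlgebra.IsSemisimple ℂ g] {H : LieSubalgebra ℂ g} [H.IsCartanSubalgebra]
  {v : (rootSystem H).weylGroup} {vdot : g ≃ₗ[ℂ] g} (hvdot : IsRepresentative v vdot)

/-! ### The action of a representative of a Weyl group element -/

/-- The automorphism of `𝔥` induced by a representative of a Weyl group element. -/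
def IsRepresentative.cartanEnd : H →ₗ[ℂ] H :=
  (vdot : g →ₗ[ℂ] g).restrict (p := H.toSubmodule) (q := H.toSubmodule) fun x hx ↦ by
    obtain ⟨y, hy, -⟩ := hvdot.2 ⟨x, hx⟩
    change vdot x ∈ H
    rw [hy]
    exact y.2

lemma IsRepresentative.coe_cartanEnd (t : H) : (hvdot.cartanEnd t : g) = vdot t := rfl

lemma IsRepresentative.root_cartanEnd (t : H) (α : H.root) :
    (rootSystem H).root (weylAct v α) (hvdot.cartanEnd t) = (rootSystem H).root α t := by
  obtain ⟨y, hy, h⟩ := hvdot.2 t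
  have : hvdot.cartanEnd t = y := Subtype.ext hy
  rw [this, h]

lemma IsRepresentative.cartanEnd_surjective : Function.Surjective hvdot.cartanEnd := by
  rw [← LinearMap.injective_iff_surjective]
  intro s t h
  exact Subtype.ext (vdot.injective (congrArg Subtype.val h))

include hvdot in
lemma IsRepresentative.symm_mem_cartan {x : g} (hx : x ∈ H) : vdot.symm x ∈ H := by
  obtain ⟨t, ht⟩ := hvdot.cartanEnd_surjective ⟨x, hx⟩
  have : x = vdot t := (congrArg Subtype.val ht).symm
  rw [this, vdot.symm_apply_apply]
  exact t.2

include hvdot in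
lemma IsRepresentative.map_lie (x y : g) : vdot ⁅x, y⁆ = ⁅vdot x, vdot y⁆ :=
  map_lie_of_mem_expGroup hvdot.1 x y

include hvdot in
lemma IsRepresentative.form_apply (κ : AdInvariantForm g) (x y : g) :
    κ.form (vdot x) y = κ.form x (vdot.symm y) := by
  rw [← form_apply_of_mem_expGroup κ hvdot.1 x (vdot.symm y), vdot.apply_symm_apply]

lemma mem_rootSpace_of_lie {χ : H → ℂ} {x : g} (h : ∀ t : H, ⁅(t : g), x⁆ = χ t • x) :
    x ∈ rootSpace H χ :=
  weightSpace_le_genWeightSpace g χ ((mem_weightSpace χ x).mpr h)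

include hvdot in
lemma IsRepresentative.apply_mem_rootSpace {α : H.root} {x : g}
    (hx : x ∈ rootSpace H (α : Weight ℂ H g)) :
    vdot x ∈ rootSpace H (weylAct v α : Weight ℂ H g) := by
  refine mem_rootSpace_of_lie fun t ↦ ?_
  obtain ⟨s, rfl⟩ := hvdot.cartanEnd_surjective t
  rw [hvdot.coe_cartanEnd, ← hvdot.map_lie, lie_cartan_eq s hx, map_smul,
    ← hvdot.root_cartanEnd]
  rfl

include hvdot in
lemma IsRepresentative.map_rootSum_le (A : Set H.root) :
    (rootSum A).map (vdot : g →ₗ[ℂ] g) ≤ rootSum (weylAct v '' A) := by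
  rw [Submodule.map_le_iff_le_comap]
  exact rootSum_le fun α hα x hx ↦
    mem_rootSum (Set.mem_image_of_mem _ hα) (hvdot.apply_mem_rootSpace hx)

lemma weylAct_bijective (v : (rootSystem H).weylGroup) : Function.Bijective (weylAct v) :=
  ((rootSystem H).weylGroupToPerm v).bijective

include hvdot in
lemma IsRepresentative.rootSum_image_le (A : Set H.root) :
    rootSum (weylAct v '' A) ≤ (rootSum A).map (vdot : g →ₗ[ℂ] g) := by
  refine rootSum_le ?_
  rintro - ⟨α, hα, rfl⟩ x hx
  refine ⟨vdot.symm x, mem_rootSum hα (mem_rootSpace_of_lie fun t ↦ ?_),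
    vdot.apply_symm_apply x⟩
  refine vdot.injective ?_
  rw [hvdot.map_lie, map_smul, vdot.apply_symm_apply, ← hvdot.coe_cartanEnd,
    lie_cartan_eq _ hx, hvdot.root_cartanEnd]
  rfl

end Representative

section PhiZero

variable {g : Type*} [LieRing g] [LieAlgebra ℂ g] [FiniteDimensional ℂ g]
  [LieAlgebra.IsSemisimple ℂ g] {H : LieSubalgebra ℂ g} [H.IsCartanSubalgebra]
  {b : (rootSystem H).Base} {κ : AdInvariantForm g} (E : RootVectors b κ) (D : BDTriple b κ)

/-! ### The maps `Ad_vdot γ_d χ_S` and `γ_d⁻¹ χ_T Ad_vdot⁻¹` -/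

/-- `Ad_vdot γ_d χ_S` -/
def sigma (vdot : g ≃ₗ[ℂ] g) : Module.End ℂ g :=
  (vdot : g →ₗ[ℂ] g) ∘ₗ (gS κ D.T).toSubmodule.subtype ∘ₗ
    (gammaD E D : gS κ D.S →ₗ[ℂ] gS κ D.T) ∘ₗ chi κ D.S

/-- `γ_d⁻¹ χ_T Ad_vdot⁻¹` -/
def tau (vdot : g ≃ₗ[ℂ] g) : g →ₗ[ℂ] gS κ D.S :=
  ((gammaD E D).symm : gS κ D.T →ₗ[ℂ] gS κ D.S) ∘ₗ chi κ D.T ∘ₗ (vdot.symm : g →ₗ[ℂ] g)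

lemma sigma_apply (vdot : g ≃ₗ[ℂ] g) (x : g) :
    sigma E D vdot x = vdot (gammaD E D (chi κ D.S x)) := rfl

lemma tau_apply (vdot : g ≃ₗ[ℂ] g) (x : g) :
    tau E D vdot x = (gammaD E D).symm (chi κ D.T (vdot.symm x)) := rfl

lemma phi_apply (vdot m : g ≃ₗ[ℂ] g) (x : g) :
    phi E D vdot m x = sigma E D vdot (m.symm x) := rfl

lemma tau_sigma (vdot : g ≃ₗ[ℂ] g) (x : g) :
    tau E D vdot (sigma E D vdot x) = chi κ D.S x := by
  rw [tau_apply, sigma_apply, vdot.symm_apply_apply]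
  have h : chi κ D.T (gammaD E D (chi κ D.S x)) = gammaD E D (chi κ D.S x) :=
    Subtype.ext (chi_of_mem κ (gammaD E D (chi κ D.S x)).2)
  rw [h, LieEquiv.symm_apply_apply]

lemma gammaD_tau (vdot : g ≃ₗ[ℂ] g) (x : g) :
    gammaD E D (tau E D vdot x) = chi κ D.T (vdot.symm x) := by
  rw [tau_apply, LieEquiv.apply_symm_apply]

lemma sigma_levi_lie {v : (rootSystem H).weylGroup} {vdot : g ≃ₗ[ℂ] g}
    (hvdot : IsRepresentative v vdot) {y : g} (hy : y ∈ levi D.S) (x : g) :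
    sigma E D vdot ⁅y, x⁆ = ⁅sigma E D vdot y, sigma E D vdot x⁆ := by
  simp only [sigma_apply]
  rw [chi_lie_levi κ hy, LieEquiv.map_lie, ← hvdot.map_lie]
  rfl

variable {v : (rootSystem H).weylGroup} {vdot : g ≃ₗ[ℂ] g} (hvdot : IsRepresentative v vdot)

include hvdot in
-- Adjoints are taken factor by factor: `Ad_vdot` and `γ_d` are isometries, and `χ_S` and `χ_T` are
-- orthogonal projections.
lemma form_sigma (x y : g) :
    κ.form (sigma E D vdot x) y = κ.form x (tau E D vdot y : g) := by
  rw [sigma_apply, hvdot.form_apply, κ.comm,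
    ← form_chi_left κ _ (gammaD E D (chi κ D.S x)).2, κ.comm, form_gammaD_symm, ← tau_apply,
    form_chi_left κ _ (tau E D vdot y).2]

include hvdot in
lemma sigma_mem_cartan {x : g} (hx : x ∈ H) : sigma E D vdot x ∈ H := by
  have h := gammaD_mem_cartan E D (chi_mem_cartan κ (S := D.S) hx)
  exact (hvdot.cartanEnd ⟨_, h⟩).2

include hvdot in
lemma tau_mem_cartan {x : g} (hx : x ∈ H) : (tau E D vdot x : g) ∈ H :=
  gammaD_symm_mem_cartan E D (chi_mem_cartan κ (S := D.T) (hvdot.symm_mem_cartan hx))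

include hvdot in
-- Since `Ad_vdot⁻¹ t` lies in `𝔥`, it differs from its `χ_T`-projection, which is `γ_d(tau t)`, by
-- an element of `𝔷_T`, and this commutes with `𝔤_T`. Consequently `sigma` carries vectors of weight
-- `f` to vectors of weight `f ∘ tau`.
lemma lie_sigma {t : g} (ht : t ∈ H) (x : g) :
    ⁅t, sigma E D vdot x⁆ = sigma E D vdot ⁅(tau E D vdot t : g), x⁆ := by
  have h1 := sub_chi_mem_center κ (S := D.T) (y := vdot.symm t)
    (Submodule.mem_sup_left (hvdot.symm_mem_cartan ht))
  have h2 := levi_lie_center (semisimplePart_le_levi κ D.T (gammaD E D (chi κ D.S x)).2) h1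
  rw [← lie_skew, neg_eq_zero, sub_lie, sub_eq_zero] at h2
  have h3 : chi κ D.S (tau E D vdot t) = tau E D vdot t :=
    Subtype.ext (chi_of_mem κ (tau E D vdot t).2)
  rw [sigma_apply, sigma_apply, chi_lie_levi κ (semisimplePart_le_levi κ D.S (tau E D vdot t).2),
    h3, LieEquiv.map_lie, gammaD_tau]
  change _ = vdot ⁅(chi κ D.T (vdot.symm t) : g), (gammaD E D (chi κ D.S x) : g)⁆
  rw [← h2, hvdot.map_lie, vdot.apply_symm_apply]

/-- The restriction of `γ_d⁻¹ χ_T Ad_vdot⁻¹` to `𝔥`. -/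
def tauCartan : H →ₗ[ℂ] H :=
  ((gS κ D.S).toSubmodule.subtype ∘ₗ tau E D vdot).restrict (p := H.toSubmodule)
    (q := H.toSubmodule) fun _ hx ↦ tau_mem_cartan E D hvdot hx

lemma coe_tauCartan (t : H) : (tauCartan E D hvdot t : g) = tau E D vdot t := rfl

/-- The map of weights induced by `Ad_vdot γ_d χ_S`. -/
def weightMap : Dual ℂ H →ₗ[ℂ] Dual ℂ H := (tauCartan E D hvdot).dualMap

lemma weightMap_apply (f : Dual ℂ H) (t : H) :
    weightMap E D hvdot f t = f (tauCartan E D hvdot t) := rfl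

lemma form_hVec_chi {S : Set H.root} {α : H.root} (hα : α ∈ S) (t : H) :
    κ.form (κ.hVec ((rootSystem H).root α) : H) (chi κ S t : g) = (rootSystem H).root α t := by
  rw [κ.comm, form_chi_left κ _ (hVec_mem_gS hα), κ.comm, κ.form_hVec]

/-- So `weightMap` extends `v d` linearly. At `t = vdot s`, adjointness of `γ_d` rewrites `α (tau t)
= ≪H_α, γ_d⁻¹ χ_T s≫` as `≪H_{dα}, χ_T s≫ = (dα)(s)`, which is `(v dα)(t)`. -/
lemma weightMap_root (α : D.S) : weightMap E D hvdot ((rootSystem H).root α) =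
    (rootSystem H).root (weylAct v (D.d α)) := by
  ext t
  obtain ⟨s, rfl⟩ := hvdot.cartanEnd_surjective t
  rw [hvdot.root_cartanEnd, weightMap_apply, ← κ.form_hVec, coe_tauCartan, hvdot.coe_cartanEnd,
    tau_apply, vdot.symm_apply_apply, ← form_hVec_chi (D.d α).2]
  have h1 := (isGamma_gammaD E D α).2 ⟨_, hVec_mem_gS α.2⟩ rfl
  rw [← h1, form_gammaD_symm]

/-- For `f` in the span of `S`, `f t = f (χ_S t)`, because `t - χ_S t` lies in `𝔷_S`; and `χ_S t =
tau (sigma t)`, so this is the value of `weightMap f` at `sigma t`. -/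
lemma weightMap_eq_zero {f : Dual ℂ H} (hf : f ∈ Submodule.span ℂ ((rootSystem H).root '' D.S))
    (h : weightMap E D hvdot f = 0) : f = 0 := by
  ext t
  have h1 := LinearMap.congr_fun h ⟨_, sigma_mem_cartan E D hvdot t.2⟩
  rw [weightMap_apply] at h1
  have h0 : (tau E D vdot (sigma E D vdot t) : g) = chi κ D.S t :=
    congrArg Subtype.val (tau_sigma E D vdot (t : g))
  have h2 : (tauCartan E D hvdot ⟨_, sigma_mem_cartan E D hvdot t.2⟩ : H) =
      ⟨chi κ D.S t, chi_mem_cartan κ t.2⟩ := Subtype.ext h0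
  rw [h2] at h1
  have h3 := root_eq_zero_of_mem_span (t := t - ⟨chi κ D.S t, chi_mem_cartan κ t.2⟩)
    (sub_chi_mem_center κ (S := D.S) (y := (t : g)) (Submodule.mem_sup_left t.2)) hf
  rw [map_sub, h1, LinearMap.zero_apply, sub_zero] at h3
  rw [h3, LinearMap.zero_apply]

include hvdot in
lemma sigma_mem_rootSpace {α : H.root} {x : g} (hx : x ∈ rootSpace H (α : Weight ℂ H g)) :
    sigma E D vdot x ∈ rootSpace H (weightMap E D hvdot ((rootSystem H).root α)) := by
  refine mem_rootSpace_of_lie fun t ↦ ?_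
  rw [lie_sigma E D hvdot t.2, ← coe_tauCartan E D hvdot, lie_cartan_eq _ hx, map_smul]
  rfl

/-- A root vector of `[S]` is recovered from its `sigma`-image by `tau`, so the image is a nonzero
vector of the new weight. The weight itself is nonzero by injectivity on the span of `S`. -/
lemma exists_root_eq_weightMap {α : H.root} (hα : α ∈ closureRoots D.S) :
    ∃ β : H.root, (rootSystem H).root β = weightMap E D hvdot ((rootSystem H).root α) := by
  obtain ⟨x, hx, hx0⟩ := (α : Weight ℂ H g).exists_ne_zero
  have h1 := sigma_mem_rootSpace E D hvdot (α := α) hx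
  have h2 : sigma E D vdot x ≠ 0 := by
    intro h
    have h3 := congrArg Subtype.val (tau_sigma E D vdot x)
    rw [h, map_zero, chi_of_mem κ (Submodule.mem_sup_right (mem_rootSum hα hx))] at h3
    exact hx0 h3.symm
  have hne : rootSpace H (weightMap E D hvdot ((rootSystem H).root α)) ≠ ⊥ := by
    intro h
    rw [h, LieSubmodule.mem_bot] at h1
    exact h2 h1
  let χ : Weight ℂ H g := ⟨weightMap E D hvdot ((rootSystem H).root α), hne⟩
  have hχ : χ.IsNonZero := by
    intro h
    refine (rootSystem H).ne_zero α (weightMap_eq_zero E D hvdot hα ?_)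
    ext t
    exact congrFun h t
  exact ⟨⟨χ, by simpa using hχ⟩, rfl⟩

include hvdot in
lemma sigma_mem_rootSpace_of_eq {α β : H.root}
    (h : (rootSystem H).root β = weightMap E D hvdot ((rootSystem H).root α)) {x : g}
    (hx : x ∈ rootSpace H (α : Weight ℂ H g)) :
    sigma E D vdot x ∈ rootSpace H (β : Weight ℂ H g) := by
  have h1 := sigma_mem_rootSpace E D hvdot hx
  rw [← h] at h1
  exact h1

lemma sigma_eq_zero {α : H.root} (hα : α ∉ closureRoots D.S) {x : g}
    (hx : x ∈ rootSpace H (α : Weight ℂ H g)) : sigma E D vdot x = 0 := by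
  have h : chi κ D.S x = 0 := chi_of_mem_compl κ
    (Submodule.mem_sup_right (mem_rootSum (A := (closureRoots D.S)ᶜ) hα hx))
  rw [sigma_apply, h, map_zero, ZeroMemClass.coe_zero, map_zero]

/-! ### The set `S(v, d)` -/

lemma Svd_subset (v : (rootSystem H).weylGroup) : Svd D v ⊆ D.S := by
  rintro α ⟨F, hF, hα⟩
  exact hF.1 hα

lemma weylAct_mem_Svd {α : D.S} (hα : (α : H.root) ∈ Svd D v) : weylAct v (D.d α) ∈ Svd D v := by
  obtain ⟨F, hF, hα⟩ := hα
  exact ⟨F, hF, hF.2 α hα⟩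

/-- The map `v d` is an injective self-map of the finite set `S(v, d)`, hence surjective. -/
lemma exists_mem_Svd {α : H.root} (hα : α ∈ Svd D v) :
    ∃ β : D.S, (β : H.root) ∈ Svd D v ∧ weylAct v (D.d β) = α := by
  let f : Svd D v → Svd D v := fun β ↦
    ⟨weylAct v (D.d ⟨β, Svd_subset D v β.2⟩), weylAct_mem_Svd D (α := ⟨β, Svd_subset D v β.2⟩) β.2⟩
  have hf : Function.Injective f := by
    intro β β' h
    have h1 := D.d.injective (Subtype.ext ((weylAct_bijective v).1 (congrArg Subtype.val h)))
    exact Subtype.ext (Subtype.mk.inj h1)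
  obtain ⟨β, hβ⟩ := (Finite.injective_iff_surjective.mp hf) ⟨α, hα⟩
  exact ⟨⟨β, Svd_subset D v β.2⟩, β.2, congrArg Subtype.val hβ⟩

lemma weightMap_mem_span {f : Dual ℂ H}
    (hf : f ∈ Submodule.span ℂ ((rootSystem H).root '' Svd D v)) :
    weightMap E D hvdot f ∈ Submodule.span ℂ ((rootSystem H).root '' Svd D v) := by
  have h : Submodule.span ℂ ((rootSystem H).root '' Svd D v) ≤
      (Submodule.span ℂ ((rootSystem H).root '' Svd D v)).comap (weightMap E D hvdot) := by
    rw [Submodule.span_le]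
    rintro - ⟨α, hα, rfl⟩
    rw [SetLike.mem_coe, Submodule.mem_comap, weightMap_root E D hvdot ⟨α, Svd_subset D v hα⟩]
    exact Submodule.subset_span
      ⟨_, weylAct_mem_Svd D (α := ⟨α, Svd_subset D v hα⟩) hα, rfl⟩
  exact h hf

/-- The span of `S(v, d)` is mapped onto itself, and `weightMap` is injective on the span of `S`.
Roots of `[S]` outside `[S(v, d)]` therefore stay outside. -/
lemma mem_span_of_weightMap_mem {f : Dual ℂ H}
    (hf : f ∈ Submodule.span ℂ ((rootSystem H).root '' D.S))
    (h : weightMap E D hvdot f ∈ Submodule.span ℂ ((rootSystem H).root '' Svd D v)) :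
    f ∈ Submodule.span ℂ ((rootSystem H).root '' Svd D v) := by
  have h1 : Submodule.span ℂ ((rootSystem H).root '' Svd D v) ≤
      (Submodule.span ℂ ((rootSystem H).root '' Svd D v)).map (weightMap E D hvdot) := by
    rw [Submodule.span_le]
    rintro - ⟨α, hα, rfl⟩
    obtain ⟨β, hβ, rfl⟩ := exists_mem_Svd D hα
    exact ⟨_, Submodule.subset_span ⟨β, hβ, rfl⟩, weightMap_root E D hvdot β⟩
  obtain ⟨f', hf', hff'⟩ := h1 h
  have h2 : f - f' = 0 := by
    refine weightMap_eq_zero E D hvdot (sub_mem hf ?_) (by rw [map_sub, hff', sub_self])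
    exact Submodule.span_mono (Set.image_mono (Svd_subset D v)) hf'
  rwa [sub_eq_zero.mp h2]

end PhiZero

section Nilpotency

variable {g : Type*} [LieRing g] [LieAlgebra ℂ g] [FiniteDimensional ℂ g]
  [LieAlgebra.IsSemisimple ℂ g] {H : LieSubalgebra ℂ g} [H.IsCartanSubalgebra]
  {b : (rootSystem H).Base} {κ : AdInvariantForm g} (E : RootVectors b κ) (D : BDTriple b κ)
  {v : (rootSystem H).weylGroup} {vdot : g ≃ₗ[ℂ] g} (hvdot : IsRepresentative v vdot)
  (hv : IsMinRep b D.T v)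

/-! ### Positive roots -/

lemma IsRepresentative.cartanEnd_bijective : Function.Bijective hvdot.cartanEnd :=
  ⟨LinearMap.injective_iff_surjective.mpr hvdot.cartanEnd_surjective, hvdot.cartanEnd_surjective⟩

/-- The transpose of the inverse of the automorphism of `𝔥` induced by `vdot`. -/
def IsRepresentative.weightEnd : Dual ℂ H →ₗ[ℂ] Dual ℂ H :=
  ((LinearEquiv.ofBijective hvdot.cartanEnd hvdot.cartanEnd_bijective).symm :
    H →ₗ[ℂ] H).dualMap

lemma IsRepresentative.weightEnd_root (α : H.root) :
    hvdot.weightEnd ((rootSystem H).root α) = (rootSystem H).root (weylAct v α) := by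
  ext t
  obtain ⟨s, rfl⟩ := hvdot.cartanEnd_surjective t
  rw [hvdot.root_cartanEnd]
  change (rootSystem H).root α 
    ((LinearEquiv.ofBijective hvdot.cartanEnd hvdot.cartanEnd_bijective).symm
      (LinearEquiv.ofBijective hvdot.cartanEnd hvdot.cartanEnd_bijective s)) = _
  rw [LinearEquiv.symm_apply_apply]

lemma IsRepresentative.dualMap_root (α : H.root) :
    hvdot.cartanEnd.dualMap ((rootSystem H).root (weylAct v α)) = (rootSystem H).root α := by
  ext t
  exact hvdot.root_cartanEnd t α

include hvdot hv in
lemma isPos_weylAct {α : H.root} (hα : b.IsPos α) (hαT : α ∈ closureRoots D.T) :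
    b.IsPos (weylAct v α) :=
  isPos_of_map (f := hvdot.weightEnd) D.T_subset
    (fun _ hj ↦ ⟨_, hv.isPos_weylAct D.T_subset hj, hvdot.weightEnd_root _⟩) hα hαT
    (hvdot.weightEnd_root α).symm

lemma dualMap_mem_span {f : Dual ℂ H}
    (hf : f ∈ Submodule.span ℂ ((rootSystem H).root '' Svd D v)) :
    hvdot.cartanEnd.dualMap f ∈ Submodule.span ℂ ((rootSystem H).root '' D.T) := by
  have h : Submodule.span ℂ ((rootSystem H).root '' Svd D v) ≤
      (Submodule.span ℂ ((rootSystem H).root '' D.T)).comap hvdot.cartanEnd.dualMap := by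
    rw [Submodule.span_le]
    rintro - ⟨α, hα, rfl⟩
    obtain ⟨β, -, rfl⟩ := exists_mem_Svd D hα
    rw [SetLike.mem_coe, Submodule.mem_comap, hvdot.dualMap_root]
    exact Submodule.subset_span ⟨_, (D.d β).2, rfl⟩
  exact h hf

include hvdot in
lemma mem_closureRoots_of_weylAct {α : H.root} (hα : weylAct v α ∈ closureRoots (Svd D v)) :
    α ∈ closureRoots D.T := by
  have h := dualMap_mem_span D hvdot hα
  rwa [hvdot.dualMap_root] at h

include hv in
lemma isPos_of_eq_weightMap {α β : H.root} (hα : b.IsPos α) (hαS : α ∈ closureRoots D.S)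
    (h : (rootSystem H).root β = weightMap E D hvdot ((rootSystem H).root α)) : b.IsPos β :=
  isPos_of_map (f := weightMap E D hvdot) D.S_subset
    (fun j hj ↦ ⟨_, hv.isPos_weylAct D.T_subset (D.d ⟨j, hj⟩).2,
      weightMap_root E D hvdot ⟨j, hj⟩⟩) hα hαS h

include hvdot hv in
lemma nv_le_image : nv b vdot ≤
    rootSum ({α | b.IsPos α} ∩ weylAct v '' ({α | ¬ b.IsPos α} \ closureRoots D.T)) := by
  refine (inf_le_inf_left _ (hvdot.map_rootSum_le _)).trans
    ((rootSum_inf_le κ _ _).trans (rootSum_mono ?_))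
  rintro - ⟨hα, α, hneg, rfl⟩
  refine ⟨hα, α, ⟨hneg, fun hT ↦ ?_⟩, rfl⟩
  -- On `[T]` the element `v` preserves signs, so no negative root of `[T]` can become positive.
  have h1 := isPos_weylAct D hvdot hv ((isPos_negRoot α).mpr hneg)
    (negRoot_mem_closureRoots.mpr hT)
  have h2 : weylAct v (negRoot α) = negRoot (weylAct v α) := by
    refine (rootSystem H).root.injective ?_
    rw [← hvdot.weightEnd_root, root_negRoot, root_negRoot, map_neg, hvdot.weightEnd_root]
  rw [h2] at h1
  exact (isPos_negRoot _).mp h1 hα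

include hvdot hv in
lemma nv_le_nS : nv b vdot ≤ nS b (Svd D v) := by
  refine (nv_le_image D hvdot hv).trans (rootSum_mono ?_)
  rintro - ⟨hα, α, hneg, rfl⟩
  exact ⟨hα, fun hF ↦ hneg.2 (mem_closureRoots_of_weylAct D hvdot hF)⟩

include hvdot hv in
lemma nv_le_map : nv b vdot ≤ (nSNeg b D.T).map (vdot : g →ₗ[ℂ] g) :=
  (nv_le_image D hvdot hv).trans
    ((rootSum_mono Set.inter_subset_right).trans (hvdot.rootSum_image_le _))

/-! ### Invariant subspaces -/

include hvdot in
lemma sigma_mem_of_rootSpace {U : Submodule ℂ g} {α : H.root}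
    (hU : α ∈ closureRoots D.S → ∀ β : H.root,
      (rootSystem H).root β = weightMap E D hvdot ((rootSystem H).root α) →
      ∀ x ∈ rootSpace H (β : Weight ℂ H g), x ∈ U) {x : g}
    (hx : x ∈ rootSpace H (α : Weight ℂ H g)) : sigma E D vdot x ∈ U := by
  by_cases hα : α ∈ closureRoots D.S
  · obtain ⟨β, hβ⟩ := exists_root_eq_weightMap E D hvdot hα
    exact hU hα β hβ _ (sigma_mem_rootSpace_of_eq E D hvdot hβ hx)
  · rw [sigma_eq_zero E D hα hx]
    exact zero_mem U

include hvdot hv in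
-- Root spaces outside `[S]` are killed. Inside `[S]`, `weightMap` keeps positive roots positive and
-- does not move a root into `[S(v, d)]`.
lemma sigma_mem_nS {x : g} (hx : x ∈ nS b (Svd D v)) : sigma E D vdot x ∈ nS b (Svd D v) := by
  have h : nS b (Svd D v) ≤ (nS b (Svd D v)).comap (sigma E D vdot) :=
    rootSum_le fun α hα x hx ↦ sigma_mem_of_rootSpace E D hvdot (fun hαS β hβ y hy ↦
      mem_rootSum (A := {α | b.IsPos α} \ closureRoots (Svd D v))
        ⟨isPos_of_eq_weightMap E D hvdot hv hα.1 hαS hβ, fun hF ↦ hα.2 (by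
          rw [closureRoots, Set.mem_ofPred_eq, hβ] at hF
          exact mem_span_of_weightMap_mem E D hvdot hαS hF)⟩ hy) hx
  exact h hx

include hvdot in
lemma sigma_mem_rootSum_closureRoots {x : g} (hx : x ∈ rootSum (closureRoots (Svd D v))) :
    sigma E D vdot x ∈ rootSum (closureRoots (Svd D v)) := by
  have h : rootSum (closureRoots (Svd D v)) ≤
      (rootSum (closureRoots (Svd D v))).comap (sigma E D vdot) :=
    rootSum_le fun α hα x hx ↦ sigma_mem_of_rootSpace E D hvdot (fun _ β hβ y hy ↦
      mem_rootSum (A := closureRoots (Svd D v)) (by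
        rw [closureRoots, Set.mem_ofPred_eq, hβ]
        exact weightMap_mem_span E D hvdot hα) hy) hx
  exact h hx

include hvdot in
lemma sigma_mem_levi {x : g} (hx : x ∈ levi (Svd D v)) : sigma E D vdot x ∈ levi (Svd D v) := by
  have h : levi (Svd D v) ≤ (levi (Svd D v)).comap (sigma E D vdot) :=
    sup_le (fun t ht ↦ Submodule.mem_sup_left (sigma_mem_cartan E D hvdot ht))
      fun x hx ↦ Submodule.mem_sup_right (sigma_mem_rootSum_closureRoots E D hvdot hx)
  exact h hx

lemma sigma_hVec (f : Dual ℂ H) :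
    sigma E D vdot (κ.hVec f : H) = (κ.hVec (weightMap E D hvdot f) : H) := by
  have h : (⟨_, sigma_mem_cartan E D hvdot (κ.hVec f).2⟩ : H) =
      κ.hVec (weightMap E D hvdot f) := by
    rw [← sub_eq_zero]
    refine κ.restrictCartan_nondegenerate.1 _ fun t ↦ ?_
    rw [map_sub, LinearMap.sub_apply, κ.restrictCartan_apply, κ.restrictCartan_apply,
      κ.form_hVec, weightMap_apply, form_sigma E D hvdot, ← coe_tauCartan E D hvdot,
      κ.form_hVec, sub_self]
  exact congrArg Subtype.val h

include hvdot in
lemma sigma_mem_semisimplePart {x : g} (hx : x ∈ semisimplePart κ (Svd D v)) :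
    sigma E D vdot x ∈ semisimplePart κ (Svd D v) := by
  have h : semisimplePart κ (Svd D v) ≤
      (semisimplePart κ (Svd D v)).comap (sigma E D vdot) := by
    refine sup_le ?_
      fun x hx ↦ Submodule.mem_sup_right (sigma_mem_rootSum_closureRoots E D hvdot hx)
    rw [Submodule.span_le]
    rintro - ⟨α, hα, rfl⟩
    rw [SetLike.mem_coe, Submodule.mem_comap, sigma_hVec E D hvdot]
    exact hVec_mem_semisimplePart κ _ _
      (weightMap_mem_span E D hvdot (Submodule.subset_span ⟨α, hα, rfl⟩))
  exact h hx

include hvdot in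
-- Each `α` in `S(v, d)` is `v d β` with `β` in `S(v, d)`, and then `α (sigma z) = β (tau (sigma z))
-- = β (χ_S z) = β z = 0`.
lemma sigma_mem_center {z : g} (hz : z ∈ center (Svd D v)) :
    sigma E D vdot z ∈ center (Svd D v) := by
  have hzH := mem_cartan_of_mem_center hz
  refine mem_center (t := ⟨_, sigma_mem_cartan E D hvdot hzH⟩) fun α hα ↦ ?_
  obtain ⟨β, hβ, rfl⟩ := exists_mem_Svd D hα
  rw [← weightMap_root E D hvdot, weightMap_apply, ← κ.form_hVec, coe_tauCartan, tau_sigma,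
    form_hVec_chi (κ := κ) β.2 ⟨z, hzH⟩]
  exact root_eq_zero_of_mem_span (S := Svd D v) hz (Submodule.subset_span ⟨β, hβ, rfl⟩)

include hvdot in
lemma apply_mem_center {z : g} (hz : z ∈ center D.T) : vdot z ∈ center (Svd D v) := by
  have hzH := mem_cartan_of_mem_center hz
  refine mem_center (t := hvdot.cartanEnd ⟨z, hzH⟩) fun α hα ↦ ?_
  obtain ⟨β, hβ, rfl⟩ := exists_mem_Svd D hα
  rw [hvdot.root_cartanEnd]
  exact root_eq_zero_of_mem_span (S := D.T) hz (Submodule.subset_span ⟨_, (D.d β).2, rfl⟩)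

/-! ### Nilpotency -/

lemma mem_maxGenEigenspace_zero {f : Module.End ℂ g} {x : g} :
    x ∈ f.maxGenEigenspace 0 ↔ ∃ k : ℕ, (f ^ k) x = 0 := by
  rw [Module.End.mem_maxGenEigenspace, zero_smul, sub_zero]

include hvdot hv in
-- The generalized eigenspace of `0` expresses local nilpotency as membership in a submodule, so it
-- may be tested on root spaces. The bad roots lie in `[S]` and are preserved by `weightMap`, so
-- `exists_invariant_subset` applies to them.
lemma nS_le_maxGenEigenspace :
    nS b (Svd D v) ≤ (sigma E D vdot).maxGenEigenspace 0 := by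
  let B : Set H.root := {α | (b.IsPos α ∧ α ∉ closureRoots (Svd D v)) ∧
    ∃ x ∈ rootSpace H (α : Weight ℂ H g), x ∉ (sigma E D vdot).maxGenEigenspace 0}
  have hB : ¬ B.Nonempty := by
    intro hB
    have hBS : ∀ α ∈ B, (rootSystem H).root α ∈
        Submodule.span ℂ ((rootSystem H).root '' D.S) := by
      rintro α ⟨-, x, hx, hx0⟩
      by_contra hα
      refine hx0 (mem_maxGenEigenspace_zero.mpr ⟨1, ?_⟩)
      rw [pow_one, sigma_eq_zero E D hα hx]
    obtain ⟨α, hα, F, hFS, hF, hαF⟩ := exists_invariant_subset (f := weightMap E D hvdot)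
      D.S_subset (fun j hj ↦ ⟨_, hv.isPos_weylAct D.T_subset (D.d ⟨j, hj⟩).2,
        weightMap_root E D hvdot ⟨j, hj⟩⟩) hB (fun α hα ↦ hα.1.1) hBS (by
        rintro α hα
        obtain ⟨⟨hpos, hF⟩, x, hx, hx0⟩ := id hα
        have hαS := hBS α hα
        obtain ⟨β, hβ⟩ := exists_root_eq_weightMap E D hvdot hαS
        refine ⟨β, ⟨⟨isPos_of_eq_weightMap E D hvdot hv hpos hαS hβ, fun h ↦ hF ?_⟩, _,
          sigma_mem_rootSpace_of_eq E D hvdot hβ hx, fun h ↦ hx0 ?_⟩, hβ⟩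
        · rw [closureRoots, Set.mem_ofPred_eq, hβ] at h
          exact mem_span_of_weightMap_mem E D hvdot hαS h
        · obtain ⟨k, hk⟩ := mem_maxGenEigenspace_zero.mp h
          exact mem_maxGenEigenspace_zero.mpr ⟨k + 1, by
            rw [pow_succ, Module.End.mul_apply, hk]⟩)
    -- Maximality of `S(v, d)` absorbs `F`, which puts the bad root `α` into `[S(v, d)]`.
    have hFv : F ⊆ Svd D v := Set.subset_sUnion_of_mem ⟨hFS, fun β hβ ↦ by
      obtain ⟨k, hk, hβk⟩ := hF β hβ
      rw [weightMap_root] at hβk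
      rwa [(rootSystem H).root.injective hβk]⟩
    exact hα.1.2 (closureRoots_mono hFv hαF)
  refine rootSum_le fun α hα x hx ↦ ?_
  by_contra hx0
  exact hB ⟨α, hα, x, hx, hx0⟩

include hvdot in
lemma sigma_pow_lie (k : ℕ) {y : g} (hy : y ∈ levi (Svd D v)) (x : g) :
    (sigma E D vdot ^ k) ⁅y, x⁆ = ⁅(sigma E D vdot ^ k) y, (sigma E D vdot ^ k) x⁆ := by
  induction k generalizing x y with
  | zero => rfl
  | succ k ih =>
    simp only [pow_succ, Module.End.mul_apply]
    rw [sigma_levi_lie E D hvdot (levi_mono (Svd_subset D v) hy),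
      ih (sigma_mem_levi E D hvdot hy)]

variable {m : g ≃ₗ[ℂ] g} (hm : m ∈ leviGroup (Svd D v))

include hm in
lemma symm_mem_nS {x : g} (hx : x ∈ nS b (Svd D v)) : m.symm x ∈ nS b (Svd D v) :=
  (symm_mem_of_mem_expGroup (fun _ hy _ hz ↦
    (isNilradical_pos ((Svd_subset D v).trans D.S_subset)).levi_lie_mem hy hz) hm).mpr hx

include hvdot hv hm in
lemma phi_mem_nS {x : g} (hx : x ∈ nS b (Svd D v)) : phi E D vdot m x ∈ nS b (Svd D v) :=
  sigma_mem_nS E D hvdot hv (symm_mem_nS D hm hx)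

include hvdot hv hm in
-- Powers of `φ` mix `sigma` with `m⁻¹`, but by `sigma_pow_lie` the kernel of a power of `sigma` in
-- `𝔫_{S(v,d)}` is stable under `𝔪_{S(v,d)}`, hence under `m⁻¹`. One application of `φ` thus lowers
-- the required power of `sigma` by one.
lemma phi_pow_eq_zero (k : ℕ) {x : g} (hx : x ∈ nS b (Svd D v))
    (hk : (sigma E D vdot ^ k) x = 0) : (phi E D vdot m ^ k) x = 0 := by
  induction k generalizing x with
  | zero => exact hk
  | succ k ih =>
    rw [pow_succ, Module.End.mul_apply]
    refine ih (phi_mem_nS E D hvdot hv hm hx) ?_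
    rw [phi_apply, ← Module.End.mul_apply, ← pow_succ]
    have h : m.symm x ∈ nS b (Svd D v) ⊓ LinearMap.ker (sigma E D vdot ^ (k + 1)) := by
      refine (symm_mem_of_mem_expGroup
        (U := nS b (Svd D v) ⊓ LinearMap.ker (sigma E D vdot ^ (k + 1))) (fun y hy z hz ↦ ⟨?_, ?_⟩) hm).mpr ⟨hx, hk⟩
      · exact (isNilradical_pos ((Svd_subset D v).trans D.S_subset)).levi_lie_mem hy hz.1
      · rw [SetLike.mem_coe, LinearMap.mem_ker, sigma_pow_lie E D hvdot _ hy, LinearMap.mem_ker.mp hz.2, lie_zero]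
    exact h.2

include hv in
lemma isNilpotent_phi_restrict (hvdot : IsRepresentative v vdot)
    (hm : m ∈ leviGroup (Svd D v))
    (hφ : ∀ x ∈ nS b (Svd D v), phi E D vdot m x ∈ nS b (Svd D v)) :
    IsNilpotent ((phi E D vdot m).restrict hφ) := by
  rw [Module.End.isNilpotent_iff_of_finite]
  intro x
  obtain ⟨k, hk⟩ := mem_maxGenEigenspace_zero.mp (nS_le_maxGenEigenspace E D hvdot hv x.2)
  refine ⟨k, Subtype.ext ?_⟩
  rw [Module.End.pow_restrict]
  exact phi_pow_eq_zero E D hvdot hv hm k x.2 hk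

end Nilpotency

section Normalizer

variable {g : Type*} [LieRing g] [LieAlgebra ℂ g] [FiniteDimensional ℂ g]
  [LieAlgebra.IsSemisimple ℂ g] {H : LieSubalgebra ℂ g} [H.IsCartanSubalgebra]

/-! ### Parabolic subalgebras as orthogonal complements -/

/-- The coroot lies in `[𝔤_α, 𝔤_{-α}]`, so it is a multiple of `H_α`; if `α` vanished on `H_α`, it
would vanish on the coroot, where its value is `2`. -/
lemma root_hVec_ne_zero (κ : AdInvariantForm g) (α : H.root) :
    (rootSystem H).root α (κ.hVec ((rootSystem H).root α)) ≠ 0 := by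
  intro h0
  have h := coroot_mem_corootSpace (α : Weight ℂ H g)
  rw [LieAlgebra.mem_corootSpace] at h
  have hle : Submodule.span ℂ {x : g | ∃ y ∈ rootSpace H (α : Weight ℂ H g),
      ∃ z ∈ rootSpace H (-(α : Weight ℂ H g) : H → ℂ), ⁅y, z⁆ = x} ≤
      (LinearMap.ker ((rootSystem H).root α)).map H.toSubmodule.subtype := by
    rw [Submodule.span_le]
    rintro x ⟨y, hy, z, hz, rfl⟩
    have hz' : z ∈ rootSpace H (negRoot α : Weight ℂ H g) := by
      rw [coe_negRoot]
      exact hz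
    refine ⟨κ.form y z • κ.hVec ((rootSystem H).root α), ?_,
      (lie_eq_hVec κ ((add_eq_zero_iff_negRoot α _).mpr rfl) hy hz').symm⟩
    rw [SetLike.mem_coe, LinearMap.mem_ker, map_smul, h0, smul_zero]
  obtain ⟨t, ht, hte⟩ := hle h
  obtain rfl : t = coroot (α : Weight ℂ H g) := Subtype.ext hte
  have h2 : (rootSystem H).root α (coroot (α : Weight ℂ H g)) = 2 :=
    root_apply_coroot (isNonZero_of_root α)
  rw [SetLike.mem_coe, LinearMap.mem_ker, h2] at ht
  exact two_ne_zero ht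

/-- Invariance forces the Cartan component `w` of `⁅x, e⁆` to be `-≪x, e≫ H_α`. Then `≪w, w≫ = ≪x,
e≫² α(H_α)`, and `α(H_α) ≠ 0`. -/
lemma form_eq_zero_of_lie_eq (κ : AdInvariantForm g) {A : Set H.root} {α : H.root}
    {e x w n : g} (he : e ∈ rootSpace H (α : Weight ℂ H g)) (hw : w ∈ H) (hww : κ.form w w = 0)
    (hn : n ∈ rootSum A) (h : ⁅x, e⁆ = w + n) : κ.form x e = 0 := by
  have key : ∀ t : H, κ.form w t = -((rootSystem H).root α t * κ.form x e) := by
    intro t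
    have h1 : κ.form ⁅x, e⁆ t = κ.form w t := by
      rw [h, map_add, LinearMap.add_apply, κ.comm n, form_cartan_rootSum κ t hn, add_zero]
    rw [← h1, ← lie_skew, map_neg, LinearMap.neg_apply, κ.invariant, neg_neg, ← lie_skew,
      lie_cartan_eq t he, map_neg, map_smul, smul_eq_mul]
  have h1 := key ⟨w, hw⟩
  have h2 := key (κ.hVec ((rootSystem H).root α))
  rw [κ.comm, κ.form_hVec _ ⟨w, hw⟩] at h2
  rw [h2] at h1
  have h3 : (rootSystem H).root α (κ.hVec ((rootSystem H).root α)) *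
      (κ.form x e * κ.form x e) = 0 := by
    rw [hww] at h1
    linear_combination -h1
  have h4 := (mul_eq_zero.mp h3).resolve_left (root_hVec_ne_zero κ α)
  exact mul_self_eq_zero.mp h4

lemma IsNilradical.rootSum_le_compl {S C : Set H.root} (h : IsNilradical S C) :
    rootSum C ≤ (semisimpleCompl S : Submodule ℂ g) :=
  (rootSum_mono (B := (closureRoots S)ᶜ) h.notMem).trans le_sup_right

/-- The orthogonal complement of the nilradical is contained in the parabolic subalgebra: a root
outside `[S] ∪ C` has its negative in `C`, so its component in `x` vanishes. -/
lemma IsNilradical.exists_decomposition (κ : AdInvariantForm g) {S C : Set H.root}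
    (h : IsNilradical S C) {x : g} (hx : ∀ e ∈ rootSum C, κ.form x e = 0) :
    ∃ y ∈ levi S, ∃ n ∈ rootSum C, x = y + n := by
  have h1 : x ∈ H.toSubmodule ⊔ rootSum (closureRoots S ∪ C) := by
    refine mem_cartan_sup_rootSum κ fun α hα e he ↦ hx e (mem_rootSum ?_ he)
    exact ((h.mem_or α).resolve_left fun h' ↦ hα (Or.inl h')).resolve_left
      fun h' ↦ hα (Or.inr h')
  have h2 : H.toSubmodule ⊔ rootSum (closureRoots S ∪ C) ≤ levi S ⊔ rootSum C := by
    refine sup_le (le_sup_left.trans le_sup_left) (rootSum_le ?_)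
    rintro α (hα | hα) y hy
    · exact Submodule.mem_sup_left (Submodule.mem_sup_right (mem_rootSum hα hy))
    · exact Submodule.mem_sup_right (mem_rootSum hα hy)
  obtain ⟨y, hy, n, hn, hyn⟩ := Submodule.mem_sup.mp (h2 h1)
  exact ⟨y, hy, n, hn, hyn.symm⟩

lemma form_cartan_left_rootSum (κ : AdInvariantForm g) {A : Set H.root} {t e : g} (ht : t ∈ H)
    (he : e ∈ rootSum A) : κ.form t e = 0 :=
  form_cartan_rootSum κ ⟨t, ht⟩ he

lemma IsNilradical.lie_rootSum_mem {S C : Set H.root} (h : IsNilradical S C) {x y : g}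
    (hx : x ∈ rootSum C) (hy : y ∈ rootSum C) : ⁅x, y⁆ ∈ rootSum C :=
  h.lie_mem (Submodule.mem_sup_right (rootSum_mono Set.subset_union_right hx)) hy

lemma IsNilradical.lie_levi_mem {S C : Set H.root} (h : IsNilradical S C) {x y : g}
    (hx : x ∈ rootSum C) (hy : y ∈ levi S) : ⁅x, y⁆ ∈ rootSum C := by
  rw [← lie_skew]
  exact neg_mem (h.levi_lie_mem hy hx)

lemma center_le_levi (S : Set H.root) : center S ≤ (levi S : Submodule ℂ g) :=
  fun _ hz ↦ Submodule.mem_sup_left (mem_cartan_of_mem_center hz)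

lemma form_nPos {b : (rootSystem H).Base} (κ : AdInvariantForm g) {A B : Set H.root}
    (hA : ∀ α ∈ A, b.IsPos α) (hB : ∀ α ∈ B, b.IsPos α) {x y : g} (hx : x ∈ rootSum A)
    (hy : y ∈ rootSum B) : κ.form x y = 0 := by
  refine form_rootSum κ (fun α hα β hβ h ↦ ?_) hx hy
  exact (isPos_negRoot α).mp (h ▸ hB β hβ) (hA α hα)

/-- An element centralizing `𝔤_S` is orthogonal to all brackets `⁅u, w⁆` with `u ∈ 𝔤_S`. Taking for
`u` a coroot shows that it has no root components, so it lies in `𝔥`. Its brackets with root vectors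
of `S` then put it in `𝔷_S`, which meets `𝔤_S` in zero. -/
lemma eq_zero_of_center_gS (κ : AdInvariantForm g) {S : Set H.root} {c : g}
    (hc : c ∈ semisimplePart κ S) (h : ∀ u ∈ semisimplePart κ S, ⁅c, u⁆ = 0) : c = 0 := by
  have hlie : ∀ u ∈ semisimplePart κ S, ∀ w, κ.form c ⁅u, w⁆ = 0 := by
    intro u hu w
    have h1 := κ.invariant u c w
    rw [← lie_skew, h u hu, neg_zero, map_zero, LinearMap.zero_apply, eq_comm,
      neg_eq_zero] at h1
    exact h1
  have hroot : ∀ α ∈ closureRoots S, ∀ x ∈ rootSpace H (α : Weight ℂ H g), κ.form c x = 0 := by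
    intro α hα x hx
    have h1 := hlie _ (coroot_mem_semisimplePart κ S hα) x
    have h2 : (rootSystem H).root α ((rootSystem H).coroot α) = 2 :=
      root_apply_coroot (isNonZero_of_root α)
    rw [lie_cartan_eq _ hx, h2, map_smul, smul_eq_mul] at h1
    exact (mul_eq_zero.mp h1).resolve_left two_ne_zero
  have hcH : c ∈ H := by
    have h1 : c ∈ H.toSubmodule ⊔ rootSum (∅ : Set H.root) := by
      refine mem_cartan_sup_rootSum κ fun α _ e he ↦ ?_
      by_cases hα : α ∈ closureRoots S
      · exact hroot _ (negRoot_mem_closureRoots.mpr hα) e he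
      · refine form_semisimplePart_compl κ S c hc e (Submodule.mem_sup_right
          (mem_rootSum (A := (closureRoots S)ᶜ) (fun h' ↦ hα ?_) he))
        exact negRoot_mem_closureRoots.mp h'
    have h2 : (rootSum (∅ : Set H.root) : Submodule ℂ g) ≤ H.toSubmodule :=
      rootSum_le fun α hα ↦ absurd hα (Set.notMem_empty α)
    exact sup_le le_rfl h2 h1
  have hcz : c ∈ center S := by
    refine mem_center (t := ⟨c, hcH⟩) fun α hα ↦ ?_
    obtain ⟨x, hx, hx0⟩ := (α : Weight ℂ H g).exists_ne_zero
    have h1 := h x (Submodule.mem_sup_right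
      (mem_rootSum (A := closureRoots S) (Submodule.subset_span ⟨α, hα, rfl⟩) hx))
    have h2 := lie_cartan_eq (⟨c, hcH⟩ : H) (α := α) hx
    rw [h1, eq_comm] at h2
    exact (smul_eq_zero.mp h2).resolve_right hx0
  have h1 := chi_of_mem κ hc
  rwa [chi_of_mem_compl κ (Submodule.mem_sup_left hcz), ZeroMemClass.coe_zero, eq_comm] at h1

/-! ### The normalizer of `𝔩_{S,T,d,V}` in `𝔤 ⊕ 𝔤` -/

variable {b : (rootSystem H).Base} {κ : AdInvariantForm g} (E : RootVectors b κ)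
  (D : BDTriple b κ) {V : Submodule ℂ (g × g)}

lemma mem_lagr {p : g × g} : p ∈ lagr E D V ↔ ∃ ν ∈ V, ∃ a ∈ nS b D.S, ∃ c ∈ nSNeg b D.T,
    ∃ w : gS κ D.S, p = ν + (a, c) + ((w : g), (gammaD E D w : g)) := by
  constructor
  · intro hp
    obtain ⟨q, hq, r, ⟨w, rfl⟩, rfl⟩ := Submodule.mem_sup.mp hp
    obtain ⟨ν, hν, ac, hac, rfl⟩ := Submodule.mem_sup.mp hq
    exact ⟨ν, hν, ac.1, hac.1, ac.2, hac.2, w, rfl⟩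
  · rintro ⟨ν, hν, a, ha, c, hc, w, rfl⟩
    exact Submodule.add_mem_sup (Submodule.add_mem_sup hν ⟨ha, hc⟩) ⟨w, rfl⟩

lemma nilradical_S : IsNilradical D.S ({α | b.IsPos α} \ closureRoots D.S) :=
  isNilradical_pos D.S_subset

lemma nilradical_T : IsNilradical D.T ({α | ¬ b.IsPos α} \ closureRoots D.T) :=
  isNilradical_neg D.T_subset

variable {D} in
lemma gammaD_chi_of_mem_lagr (hV : V ≤ (center D.S).prod (center D.T)) {p : g × g}
    (hp : p ∈ lagr E D V) : gammaD E D (chi κ D.S p.1) = chi κ D.T p.2 := by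
  obtain ⟨ν, hν, a, ha, c, hc, w, rfl⟩ := (mem_lagr E D).mp hp
  have h1 : chi κ D.S (ν.1 + a + w) = w := by
    rw [map_add, chi_of_mem_compl κ (add_mem (Submodule.mem_sup_left (hV hν).1)
      ((nilradical_S D).rootSum_le_compl ha)), zero_add]
    exact Subtype.ext (chi_of_mem κ w.2)
  have h2 : chi κ D.T (ν.2 + c + gammaD E D w) = gammaD E D w := by
    rw [map_add, chi_of_mem_compl κ (add_mem (Submodule.mem_sup_left (hV hν).2)
      ((nilradical_T D).rootSum_le_compl hc)), zero_add]
    exact Subtype.ext (chi_of_mem κ (gammaD E D w).2)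
  change gammaD E D (chi κ D.S (ν.1 + a + w)) = chi κ D.T (ν.2 + c + gammaD E D w)
  rw [h1, h2]

/-- The Levi part commutes with `𝔷_S` and every bracket involving the nilradical stays in it, so no
component in `𝔷_S` is produced. This is why `V` does not enter the normalizer. -/
lemma lie_decomposition {S C : Set H.root} (h : IsNilradical S C) {y n : g} (hy : y ∈ levi S)
    (hn : n ∈ rootSum C) {z a w : g} (hz : z ∈ center S) (ha : a ∈ rootSum C)
    (hw : w ∈ semisimplePart κ S) :
    ∃ a' ∈ rootSum C, ⁅y + n, z + a + w⁆ = a' + ⁅(chi κ S (y + n) : g), w⁆ := by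
  have hchi : chi κ S (y + n) = chi κ S y := by
    rw [map_add, chi_of_mem_compl κ (h.rootSum_le_compl hn), add_zero]
  have hyw : ⁅y, w⁆ = ⁅(chi κ S y : g), w⁆ := by
    rw [← sub_eq_zero, ← sub_lie, ← lie_skew,
      levi_lie_center (semisimplePart_le_levi κ S hw) (sub_chi_mem_center κ hy), neg_zero]
  refine ⟨⁅n, z⁆ + ⁅y, a⁆ + ⁅n, a⁆ + ⁅n, w⁆, ?_, ?_⟩
  · exact add_mem (add_mem (add_mem (h.lie_levi_mem hn (center_le_levi S hz))
      (h.levi_lie_mem hy ha)) (h.lie_rootSum_mem hn ha))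
      (h.lie_levi_mem hn (semisimplePart_le_levi κ S hw))
  · rw [hchi, ← hyw, add_lie, lie_add, lie_add, lie_add, lie_add, levi_lie_center hy hz]
    abel

variable {D} in
-- If one coordinate vanishes, the relation `γ_d χ_S p₁ = χ_T p₂` removes the graph component, and
-- that coordinate of `ν` vanishes as well. Isotropy of `V` then makes the other coordinate of `ν`
-- isotropic.
lemma form_self_eq_zero_of_mem_lagr (hV : V ≤ (center D.S).prod (center D.T))
    (hiso : IsIsotropic κ V) {p : g × g} (hp : p ∈ lagr E D V) (h0 : p.1 = 0 ∨ p.2 = 0) :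
    (∃ w ∈ H, κ.form w w = 0 ∧ ∃ a ∈ nS b D.S, p.1 = w + a) ∧
      ∃ w ∈ H, κ.form w w = 0 ∧ ∃ c ∈ nSNeg b D.T, p.2 = w + c := by
  have h1 := gammaD_chi_of_mem_lagr E hV hp
  obtain ⟨ν, hν, a, ha, c, hc, w, rfl⟩ := (mem_lagr E D).mp hp
  have hH1 := mem_cartan_of_mem_center (hV hν).1
  have hH2 := mem_cartan_of_mem_center (hV hν).2
  have hw : w = 0 := by
    have h2 : chi κ D.S (ν.1 + a + w) = w := by
      rw [map_add, chi_of_mem_compl κ (add_mem (Submodule.mem_sup_left (hV hν).1)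
        ((nilradical_S D).rootSum_le_compl ha)), zero_add]
      exact Subtype.ext (chi_of_mem κ w.2)
    rcases h0 with h0 | h0
    · rw [← h2]
      exact (congrArg (chi κ D.S) h0).trans (map_zero _)
    · rw [h0, map_zero] at h1
      rw [← h2]
      exact (gammaD E D).injective (h1.trans (map_zero (gammaD E D)).symm)
  subst hw
  have e1 : (ν + (a, c) + (((0 : gS κ D.S) : g), (gammaD E D 0 : g))).1 = ν.1 + a :=
    add_zero _
  have e2 : (ν + (a, c) + (((0 : gS κ D.S) : g), (gammaD E D 0 : g))).2 = ν.2 + c := by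
    rw [map_zero]
    exact add_zero _
  rw [e1, e2] at h0
  have hform : κ.form ν.1 ν.1 = 0 ∧ κ.form ν.2 ν.2 = 0 := by
    have h2 := hiso ν hν ν hν
    rcases h0 with h0 | h0
    · have h3 : ν.1 = 0 := eq_zero_of_mem_cartan_of_mem_rootSum κ hH1
        (eq_neg_of_add_eq_zero_left h0 ▸ neg_mem ha)
      rw [h3, map_zero, zero_sub, neg_eq_zero] at h2
      exact ⟨by rw [h3, map_zero], h2⟩
    · have h3 : ν.2 = 0 := eq_zero_of_mem_cartan_of_mem_rootSum κ hH2
        (eq_neg_of_add_eq_zero_left h0 ▸ neg_mem hc)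
      rw [h3, map_zero, sub_zero] at h2
      exact ⟨h2, by rw [h3, map_zero]⟩
  exact ⟨⟨ν.1, hH1, hform.1, a, ha, e1⟩, ν.2, hH2, hform.2, c, hc, e2⟩

variable {D} in
-- For necessity, brackets with `(e, 0)` and `(0, e)` lie in `𝔩_{S,T,d,V}` with one coordinate zero,
-- so their Cartan components are isotropic and `form_eq_zero_of_lie_eq` gives orthogonality.
-- Brackets with the graph of `γ_d` give the third condition.
lemma normalizes_lagr_iff (hV : V ≤ (center D.S).prod (center D.T)) (hiso : IsIsotropic κ V)
    (x y : g) : (∀ p ∈ lagr E D V, ⁅((x, y) : g × g), p⁆ ∈ lagr E D V) ↔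
      (∀ e ∈ nS b D.S, κ.form x e = 0) ∧ (∀ e ∈ nSNeg b D.T, κ.form y e = 0) ∧
        gammaD E D (chi κ D.S x) = chi κ D.T y := by
  constructor
  · intro h
    refine ⟨?_, ?_, ?_⟩
    · have hle : nS b D.S ≤ LinearMap.ker (κ.form x) := rootSum_le fun α hα e he ↦ by
        have h1 := h (e, 0) ((mem_lagr E D).mpr ⟨0, zero_mem _, e, mem_rootSum hα he, 0,
          zero_mem _, 0, by simp⟩)
        obtain ⟨w, hw, hww, a, ha, hwa⟩ :=
          (form_self_eq_zero_of_mem_lagr E hV hiso h1 (Or.inr (lie_zero y))).1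
        exact form_eq_zero_of_lie_eq κ he hw hww ha hwa
      exact fun e he ↦ hle he
    · have hle : nSNeg b D.T ≤ LinearMap.ker (κ.form y) := rootSum_le fun α hα e he ↦ by
        have h1 := h (0, e) ((mem_lagr E D).mpr ⟨0, zero_mem _, 0, zero_mem _, e,
          mem_rootSum hα he, 0, by simp⟩)
        obtain ⟨w, hw, hww, a, ha, hwa⟩ :=
          (form_self_eq_zero_of_mem_lagr E hV hiso h1 (Or.inl (lie_zero x))).2
        exact form_eq_zero_of_lie_eq κ he hw hww ha hwa
      exact fun e he ↦ hle he
    · have hchi : ∀ (S : Set H.root) (z : g) (u : gS κ S), chi κ S ⁅z, (u : g)⁆ =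
          ⁅chi κ S z, u⁆ := by
        intro S z u
        have hu : chi κ S (u : g) = u := Subtype.ext (chi_of_mem κ u.2)
        rw [← lie_skew, map_neg, chi_lie_levi κ (semisimplePart_le_levi κ S u.2), hu, lie_skew]
      rw [← sub_eq_zero]
      -- It suffices that the difference of the two sides centralizes `𝔤_T`; every element of `𝔤_T`
      -- has the form `γ_d(w)`, and the bracket with `(w, γ_d(w))` is tested.
      refine Subtype.ext (eq_zero_of_center_gS κ (SetLike.coe_mem _) fun u hu ↦ ?_)
      obtain ⟨w, hw⟩ := (gammaD E D).surjective ⟨u, hu⟩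
      replace hw : gammaD E D w = ⟨u, hu⟩ := hw
      have h1 := h _ ((mem_lagr E D).mpr ⟨0, zero_mem _, 0, zero_mem _, 0, zero_mem _, w, rfl⟩)
      have h2 := gammaD_chi_of_mem_lagr E hV h1
      have e1 : ⁅((x, y) : g × g), (0 : g × g) + (0, 0) + ((w : g), (gammaD E D w : g))⁆ =
          (⁅x, (w : g)⁆, ⁅y, (gammaD E D w : g)⁆) := by
        rw [← Prod.zero_eq_mk, add_zero, zero_add]
        rfl
      rw [e1] at h2
      change gammaD E D (chi κ D.S ⁅x, (w : g)⁆) = chi κ D.T ⁅y, (gammaD E D w : g)⁆ at h2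
      rw [hchi, hchi, LieEquiv.map_lie, ← sub_eq_zero, ← sub_lie, hw] at h2
      exact congrArg Subtype.val h2
  · rintro ⟨hx, hy, hxy⟩ p hp
    obtain ⟨x1, hx1, x2, hx2, rfl⟩ := (nilradical_S D).exists_decomposition κ hx
    obtain ⟨y1, hy1, y2, hy2, rfl⟩ := (nilradical_T D).exists_decomposition κ hy
    obtain ⟨ν, hν, a, ha, c, hc, w, rfl⟩ := (mem_lagr E D).mp hp
    obtain ⟨a', ha', h1⟩ := lie_decomposition (nilradical_S D) hx1 hx2 (hV hν).1 ha w.2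
    obtain ⟨c', hc', h2⟩ := lie_decomposition (nilradical_T D) hy1 hy2 (hV hν).2 hc
      (gammaD E D w).2
    -- The bracket has `V`-component `0`, and its graph component is given by `⁅χ_S x, w⁆`.
    refine (mem_lagr E D).mpr ⟨0, zero_mem _, a', ha', c', hc', ⁅chi κ D.S (x1 + x2), w⁆, ?_⟩
    rw [LieEquiv.map_lie, hxy, zero_add]
    exact Prod.ext h1 h2

end Normalizer

/-! ### The normalizer of the twisted subalgebra `𝔩` -/

section Twisted

variable {g : Type*} [LieRing g] [LieAlgebra ℂ g] [FiniteDimensional ℂ g]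
  [LieAlgebra.IsSemisimple ℂ g] {H : LieSubalgebra ℂ g} [H.IsCartanSubalgebra]

lemma IsNilradical.form_rootSum_eq_zero (κ : AdInvariantForm g) {S C : Set H.root}
    (h : IsNilradical S C) {x y : g} (hx : x ∈ rootSum C) (hy : y ∈ rootSum C) :
    κ.form x y = 0 := by
  refine form_rootSum κ (fun α hα β hβ hβα ↦ ?_) hx hy
  subst hβα
  exact h.neg_notMem α hα hβ

lemma semisimplePart_mono (κ : AdInvariantForm g) {F S : Set H.root} (h : F ⊆ S) :
    semisimplePart κ F ≤ semisimplePart κ S :=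
  sup_le_sup (Submodule.span_mono (Set.image_mono h)) (rootSum_mono (closureRoots_mono h))

lemma IsNilradical.exists_sub_mem (κ : AdInvariantForm g) {S C : Set H.root}
    (h : IsNilradical S C) {x : g} (hx : ∀ e ∈ rootSum C, κ.form x e = 0) :
    x - chi κ S x ∈ center S ⊔ rootSum C := by
  obtain ⟨y, hy, n, hn, rfl⟩ := h.exists_decomposition κ hx
  have h1 : chi κ S (y + n) = chi κ S y := by
    rw [map_add, chi_of_mem_compl κ (h.rootSum_le_compl hn), add_zero]
  rw [h1, add_sub_right_comm]
  exact Submodule.add_mem_sup (sub_chi_mem_center κ hy) hn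

lemma IsNilradical.form_eq_zero_of_mem (κ : AdInvariantForm g) {S C : Set H.root}
    (h : IsNilradical S C) {x w z e : g} (hw : w ∈ semisimplePart κ S)
    (hz : z ∈ center S ⊔ rootSum C) (hx : x = w + z) (he : e ∈ rootSum C) :
    κ.form x e = 0 := by
  obtain ⟨t, ht, n, hn, rfl⟩ := Submodule.mem_sup.mp hz
  rw [hx, map_add, map_add, LinearMap.add_apply, LinearMap.add_apply,
    form_semisimplePart_compl κ S w hw e (h.rootSum_le_compl he),
    form_cartan_left_rootSum κ (mem_cartan_of_mem_center ht) he,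
    h.form_rootSum_eq_zero κ hn he, add_zero, add_zero]

variable {b : (rootSystem H).Base} {κ : AdInvariantForm g} (E : RootVectors b κ)
  (D : BDTriple b κ) {V : Submodule ℂ (g × g)} {v : (rootSystem H).weylGroup}
  {vdot m : g ≃ₗ[ℂ] g}

lemma nilradical_Svd (v : (rootSystem H).weylGroup) :
    IsNilradical (Svd D v) ({α | b.IsPos α} \ closureRoots (Svd D v)) :=
  isNilradical_pos ((Svd_subset D v).trans D.S_subset)

variable {D} in
-- Both `m` and `vdot` are automorphisms, so `x` normalizes `𝔩` exactly when `(m⁻¹ x, vdot⁻¹ x)`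
-- normalizes `𝔩_{S,T,d,V}`. The two conditions on the second coordinate together say that `vdot⁻¹
-- x` is `γ_d χ_S(m⁻¹ x)` plus an element of `𝔷_T + 𝔫_T⁻`.
lemma mem_diagNormalizer_iff (hV : IsLagrangianIn κ ((center D.S).prod (center D.T)) V)
    (hvdot : IsRepresentative v vdot) (hm : m ∈ leviGroup (Svd D v)) (x : g) :
    x ∈ diagNormalizer (lagrTwisted E D V vdot m) ↔
      (∀ e ∈ nS b D.S, κ.form (m.symm x) e = 0) ∧
        x - phi E D vdot m x ∈ (center D.T ⊔ nSNeg b D.T).map (vdot : g →ₗ[ℂ] g) := by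
  have hm' : ∀ x y : g, m ⁅x, y⁆ = ⁅m x, m y⁆ := map_lie_of_mem_expGroup hm
  have h1 : x ∈ diagNormalizer (lagrTwisted E D V vdot m) ↔
      ∀ p ∈ lagr E D V, ⁅((m.symm x, vdot.symm x) : g × g), p⁆ ∈ lagr E D V := by
    have key : ∀ p : g × g, ⁅((x, x) : g × g), ((m p.1, vdot p.2) : g × g)⁆ =
        (LinearMap.prodMap (m : g →ₗ[ℂ] g) (vdot : g →ₗ[ℂ] g))
          ⁅((m.symm x, vdot.symm x) : g × g), p⁆ := by
      intro p
      refine Prod.ext ?_ ?_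
      · change ⁅x, m p.1⁆ = m ⁅m.symm x, p.1⁆
        rw [hm', m.apply_symm_apply]
      · change ⁅x, vdot p.2⁆ = vdot ⁅vdot.symm x, p.2⁆
        rw [hvdot.map_lie, vdot.apply_symm_apply]
    have hinj : Function.Injective
        (LinearMap.prodMap (m : g →ₗ[ℂ] g) (vdot : g →ₗ[ℂ] g)) := fun p q h ↦
      Prod.ext (m.injective (congrArg Prod.fst h)) (vdot.injective (congrArg Prod.snd h))
    constructor
    · intro hx p hp
      obtain ⟨q, hq, hqp⟩ := hx (m p.1, vdot p.2) ⟨p, hp, rfl⟩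
      rw [key] at hqp
      rwa [← hinj hqp]
    · rintro hx _ ⟨p, hp, rfl⟩
      exact ⟨_, hx p hp, (key p).symm⟩
  rw [h1, normalizes_lagr_iff E hV.prop.1 hV.prop.2, and_congr_right_iff]
  intro _
  have hphi : phi E D vdot m x = vdot (gammaD E D (chi κ D.S (m.symm x))) := rfl
  rw [hphi]
  constructor
  · rintro ⟨hy, hxy⟩
    refine ⟨_, (nilradical_T D).exists_sub_mem κ hy, ?_⟩
    change vdot _ = _
    rw [hxy, map_sub, vdot.apply_symm_apply]
  · rintro ⟨z, hz, hzx⟩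
    have h2 : vdot.symm x = (gammaD E D (chi κ D.S (m.symm x)) : g) + z := by
      rw [LinearEquiv.symm_apply_eq, map_add, ← sub_eq_iff_eq_add']
      exact hzx.symm
    refine ⟨fun e he ↦ (nilradical_T D).form_eq_zero_of_mem κ
      (gammaD E D (chi κ D.S (m.symm x))).2 hz h2 he, Subtype.ext ?_⟩
    have hle : center D.T ⊔ nSNeg b D.T ≤ semisimpleCompl D.T :=
      sup_le le_sup_left (nilradical_T D).rootSum_le_compl
    rw [h2, chi_add κ (gammaD E D (chi κ D.S (m.symm x))).2 (hle hz)]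

/-! ### The action of `φ` on the pieces of the normalizer -/

lemma symm_mem_gS (hm : m ∈ leviGroup (Svd D v)) {x : g} (hx : x ∈ gS κ (Svd D v)) :
    m.symm x ∈ gS κ (Svd D v) :=
  (symm_mem_of_mem_expGroup (U := semisimplePart κ (Svd D v))
    (fun _ hy _ hz ↦ levi_lie_semisimplePart κ hy hz) hm).mpr hx

lemma symm_apply_of_mem_center (hm : m ∈ leviGroup (Svd D v)) {z : g}
    (hz : z ∈ center (Svd D v)) : m.symm z = z :=
  apply_eq_self_of_mem_expGroup ((expGroup _).inv_mem hm) fun _ hy ↦ levi_lie_center hy hz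

lemma phi_mem_gS (hvdot : IsRepresentative v vdot) (hm : m ∈ leviGroup (Svd D v)) {x : g}
    (hx : x ∈ gS κ (Svd D v)) : phi E D vdot m x ∈ gS κ (Svd D v) :=
  sigma_mem_semisimplePart E D hvdot (symm_mem_gS D hm hx)

lemma phi_mem_center (hvdot : IsRepresentative v vdot) (hm : m ∈ leviGroup (Svd D v)) {z : g}
    (hz : z ∈ center (Svd D v)) : phi E D vdot m z ∈ center (Svd D v) := by
  rw [phi_apply, symm_apply_of_mem_center D hm hz]
  exact sigma_mem_center E D hvdot hz

/-- On `𝔷_{S(v,d)}` the element `m` acts trivially, and `vdot⁻¹ z` minus its `χ_T`-projection lies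
in `𝔷_T`. -/
lemma mem_zPrime_iff (hvdot : IsRepresentative v vdot) (hm : m ∈ leviGroup (Svd D v)) {z : g}
    (hz : z ∈ center (Svd D v)) : z ∈ zPrime E D v vdot ↔
      z - phi E D vdot m z ∈ (center D.T).map (vdot : g →ₗ[ℂ] g) := by
  have h0 : z ∈ zPrime E D v vdot ↔ gammaD E D (chi κ D.S z) = chi κ D.T (vdot.symm z) :=
    ⟨fun h ↦ h.2, fun h ↦ ⟨hz, h⟩⟩
  have hphi : phi E D vdot m z = vdot (gammaD E D (chi κ D.S z)) := by
    rw [phi_apply, symm_apply_of_mem_center D hm hz, sigma_apply]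
  rw [h0, hphi]
  constructor
  · intro h
    refine ⟨vdot.symm z - chi κ D.T (vdot.symm z), sub_chi_mem_center κ
      (Submodule.mem_sup_left (hvdot.symm_mem_cartan (mem_cartan_of_mem_center hz))), ?_⟩
    change vdot _ = _
    rw [h, map_sub, vdot.apply_symm_apply]
  · rintro ⟨t, ht, htz⟩
    have h2 : vdot.symm z = (gammaD E D (chi κ D.S z) : g) + t := by
      rw [LinearEquiv.symm_apply_eq, map_add, ← sub_eq_iff_eq_add']
      exact htz.symm
    refine Subtype.ext ?_
    rw [h2, chi_add κ (gammaD E D (chi κ D.S z)).2 (Submodule.mem_sup_left ht)]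

/-- `Ring.inverse` is zero on non-units; nilpotency of the restriction makes `1 - f` a unit, so that
`psi` is the true inverse. -/
lemma psi_sub_phi {N : Submodule ℂ g} {f : Module.End ℂ g} {hf : ∀ x ∈ N, f x ∈ N}
    (hnil : IsNilpotent (f.restrict hf)) (y : N) :
    psi hf y ∈ N ∧ psi hf y - f (psi hf y) = y := by
  refine ⟨(Ring.inverse (1 - f.restrict hf) y).2, ?_⟩
  have h := LinearMap.congr_fun (Ring.mul_inverse_cancel _ hnil.isUnit_one_sub) y
  exact congrArg Subtype.val h

lemma psi_apply_of_sub {N : Submodule ℂ g} {f : Module.End ℂ g} {hf : ∀ x ∈ N, f x ∈ N}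
    (hnil : IsNilpotent (f.restrict hf)) (x : N) {y : N} (h : (x : g) - f x = y) :
    psi hf y = x := by
  have h1 := LinearMap.congr_fun (Ring.inverse_mul_cancel _ hnil.isUnit_one_sub) x
  have h2 : (1 - f.restrict hf) x = y := Subtype.ext h
  rw [Module.End.mul_apply, h2] at h1
  exact congrArg Subtype.val h1

/-! ### The two inclusions -/

variable {E D} in
-- After `m⁻¹`, the three summands lie in `𝔥`, in `𝔤_S` and in `𝔫`, each orthogonal to `𝔫_S`. Their
-- images under `1 - φ` lie in `Ad_vdot 𝔷_T`, in zero and in `𝔫_v`.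
lemma le_diagNormalizer (hV : IsLagrangianIn κ ((center D.S).prod (center D.T)) V)
    (hvdot : IsRepresentative v vdot) (hv : IsMinRep b D.T v) (hm : m ∈ leviGroup (Svd D v))
    (hφ : ∀ x ∈ nS b (Svd D v), phi E D vdot m x ∈ nS b (Svd D v))
    (hnil : IsNilpotent ((phi E D vdot m).restrict hφ)) :
    zPrime E D v vdot ⊔ gFixed E D v vdot m ⊔
      ((nv b vdot).comap (nS b (Svd D v)).subtype).map (psi hφ) ≤
        diagNormalizer (lagrTwisted E D V vdot m) := by
  refine sup_le (sup_le ?_ ?_) ?_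
  · intro z hz
    refine (mem_diagNormalizer_iff E hV hvdot hm z).mpr ⟨fun e he ↦ ?_,
      Submodule.map_mono le_sup_left ((mem_zPrime_iff E D hvdot hm hz.1).mp hz)⟩
    rw [symm_apply_of_mem_center D hm hz.1]
    exact form_cartan_left_rootSum κ (mem_cartan_of_mem_center hz.1) he
  · intro s hs
    refine (mem_diagNormalizer_iff E hV hvdot hm s).mpr ⟨fun e he ↦ ?_, ?_⟩
    · exact form_semisimplePart_compl κ D.S _
        (semisimplePart_mono κ (Svd_subset D v) (symm_mem_gS D hm hs.1)) e
        ((nilradical_S D).rootSum_le_compl he)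
    · have h : phi E D vdot m s = s := hs.2
      rw [h, sub_self]
      exact zero_mem _
  · rintro - ⟨y, hy, rfl⟩
    obtain ⟨hn, hny⟩ := psi_sub_phi hnil y
    refine (mem_diagNormalizer_iff E hV hvdot hm _).mpr ⟨fun e he ↦ ?_, ?_⟩
    · exact form_nPos κ (fun _ h ↦ h.1) (fun _ h ↦ h.1) (symm_mem_nS D hm hn) he
    · rw [hny]
      exact Submodule.map_mono le_sup_right (nv_le_map D hvdot hv hy)

/-- Each `u` in `𝔫_{S(v,d)}` pairs with `x` as `φ(u)` does, and `φ` is nilpotent there. This places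
`x` in `𝔪_{S(v,d)} + 𝔫_{S(v,d)}`. -/
lemma form_eq_zero_of_mem_diagNormalizer
    (hV : IsLagrangianIn κ ((center D.S).prod (center D.T)) V)
    (hvdot : IsRepresentative v vdot) (hm : m ∈ leviGroup (Svd D v))
    (hφ : ∀ x ∈ nS b (Svd D v), phi E D vdot m x ∈ nS b (Svd D v))
    (hnil : IsNilpotent ((phi E D vdot m).restrict hφ)) {x : g}
    (hx : x ∈ diagNormalizer (lagrTwisted E D V vdot m)) {u : g} (hu : u ∈ nS b (Svd D v)) :
    κ.form x u = 0 := by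
  obtain ⟨h1, z, hz, hzx⟩ := (mem_diagNormalizer_iff E hV hvdot hm x).mp hx
  have hle : center D.T ⊔ nSNeg b D.T ≤ semisimpleCompl D.T :=
    sup_le le_sup_left (nilradical_T D).rootSum_le_compl
  have htau : tau E D vdot x = chi κ D.S (m.symm x) := by
    have h2 : vdot.symm x = (gammaD E D (chi κ D.S (m.symm x)) : g) + z := by
      rw [LinearEquiv.symm_apply_eq, map_add, ← sub_eq_iff_eq_add']
      exact hzx.symm
    have h3 : chi κ D.T (vdot.symm x) = gammaD E D (chi κ D.S (m.symm x)) :=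
      Subtype.ext (by rw [h2, chi_add κ (gammaD E D (chi κ D.S (m.symm x))).2 (hle hz)])
    rw [tau_apply, h3, LieEquiv.symm_apply_apply]
  -- Adjointness turns the left side into the pairing of `m⁻¹ u` with `χ_S(m⁻¹ x)`. Replacing this
  -- by `m⁻¹ x` changes nothing: the difference lies in `𝔷_S + 𝔫_S`, orthogonal to `𝔫`.
  have hstep : ∀ u ∈ nS b (Svd D v), κ.form (phi E D vdot m u) x = κ.form u x := by
    intro u hu
    have hu' := symm_mem_nS D hm hu
    rw [phi_apply, form_sigma E D hvdot, htau]
    obtain ⟨t, ht, n, hn, htn⟩ :=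
      Submodule.mem_sup.mp ((nilradical_S D).exists_sub_mem κ h1)
    have h4 : κ.form (m.symm u) (m.symm x - chi κ D.S (m.symm x)) = 0 := by
      rw [← htn, map_add, κ.comm,
        form_cartan_left_rootSum κ (mem_cartan_of_mem_center ht) hu', zero_add]
      exact form_nPos κ (fun _ h ↦ h.1) (fun _ h ↦ h.1) hu' hn
    rw [map_sub, sub_eq_zero] at h4
    rw [← h4]
    exact form_apply_of_mem_expGroup κ ((expGroup _).inv_mem hm) u x
  obtain ⟨k, hk⟩ := hnil
  have hpow : ∀ (j : ℕ) (u : nS b (Svd D v)),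
      κ.form ((((phi E D vdot m).restrict hφ) ^ j) u : g) x = κ.form u x := by
    intro j
    induction j with
    | zero => exact fun _ ↦ rfl
    | succ j ih =>
      intro u
      rw [pow_succ, Module.End.mul_apply, ih]
      exact hstep u u.2
  have h5 := hpow k ⟨u, hu⟩
  rw [hk, LinearMap.zero_apply, ZeroMemClass.coe_zero, map_zero, LinearMap.zero_apply] at h5
  rw [κ.comm]
  exact h5.symm

lemma map_nSNeg_le (hvdot : IsRepresentative v vdot) :
    (nSNeg b D.T).map (vdot : g →ₗ[ℂ] g) ≤ rootSum ((closureRoots (Svd D v))ᶜ) := by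
  refine (hvdot.map_rootSum_le _).trans (rootSum_mono ?_)
  rintro - ⟨α, hα, rfl⟩ h
  exact hα.2 (mem_closureRoots_of_weylAct D hvdot h)

variable {E D} in
-- The equation for `x - φ(x)` is compared component by component along `𝔤_{S(v,d)}`, `𝔷_{S(v,d)}`
-- and the root spaces outside `[S(v,d)]`. The term from `𝔷_T` falls in the second of these, the
-- term from `𝔫_T⁻` in the third.
lemma diagNormalizer_le (hV : IsLagrangianIn κ ((center D.S).prod (center D.T)) V)
    (hvdot : IsRepresentative v vdot) (hm : m ∈ leviGroup (Svd D v))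
    (hφ : ∀ x ∈ nS b (Svd D v), phi E D vdot m x ∈ nS b (Svd D v))
    (hnil : IsNilpotent ((phi E D vdot m).restrict hφ)) :
    diagNormalizer (lagrTwisted E D V vdot m) ≤ zPrime E D v vdot ⊔ gFixed E D v vdot m ⊔
      ((nv b vdot).comap (nS b (Svd D v)).subtype).map (psi hφ) := by
  intro x hx
  obtain ⟨y, hy, n, hn, rfl⟩ := (nilradical_Svd D v).exists_decomposition κ fun _ hu ↦
    form_eq_zero_of_mem_diagNormalizer E D hV hvdot hm hφ hnil hx hu
  obtain ⟨-, w, hw, hwx⟩ := (mem_diagNormalizer_iff E hV hvdot hm _).mp hx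
  obtain ⟨ζ, hζ, c, hc, rfl⟩ := Submodule.mem_sup.mp hw
  obtain ⟨s, hs, z, hz, rfl⟩ := Submodule.mem_sup.mp (levi_le κ _ hy)
  have hφn := hφ n hn
  have hφs := phi_mem_gS E D hvdot hm hs
  have hφz := phi_mem_center E D hvdot hm hz
  have hvζ := apply_mem_center D hvdot hζ
  have hvc : vdot c ∈ rootSum ((closureRoots (Svd D v))ᶜ) := map_nSNeg_le D hvdot ⟨c, hc, rfl⟩
  have hn' : n - phi E D vdot m n ∈ rootSum ((closureRoots (Svd D v))ᶜ) :=
    rootSum_mono (nilradical_Svd D v).notMem (sub_mem hn hφn)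
  have heq : (s - phi E D vdot m s) + (z - phi E D vdot m z) + (n - phi E D vdot m n) =
      vdot ζ + vdot c := by
    rw [← map_add]
    refine Eq.trans ?_ hwx.symm
    rw [map_add, map_add]
    abel
  have hsub : s - phi E D vdot m s = (vdot ζ - (z - phi E D vdot m z)) +
      (vdot c - (n - phi E D vdot m n)) := by
    rw [← sub_eq_zero] at heq ⊢
    rw [← heq]
    abel
  have hs0 : s - phi E D vdot m s = 0 := by
    have h1 : s - phi E D vdot m s ∈ semisimpleCompl (Svd D v) := by
      rw [hsub]
      exact Submodule.add_mem_sup (sub_mem hvζ (sub_mem hz hφz)) (sub_mem hvc hn')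
    have h2 := chi_of_mem κ (sub_mem hs hφs : s - phi E D vdot m s ∈ semisimplePart κ (Svd D v))
    rwa [chi_of_mem_compl κ h1, ZeroMemClass.coe_zero, eq_comm] at h2
  rw [hs0] at hsub
  have hc0 : vdot c - (n - phi E D vdot m n) = 0 := by
    refine eq_zero_of_mem_cartan_of_mem_rootSum κ ?_ (sub_mem hvc hn')
    rw [← neg_eq_of_add_eq_zero_right hsub.symm]
    exact neg_mem (mem_cartan_of_mem_center (sub_mem hvζ (sub_mem hz hφz)))
  have hnc : vdot c = n - phi E D vdot m n := sub_eq_zero.mp hc0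
  have hzζ : vdot ζ = z - phi E D vdot m z := by
    rw [hc0, add_zero, eq_comm, sub_eq_zero] at hsub
    exact hsub
  -- The same vector is a sum of positive root vectors and the `vdot`-image of a sum of negative
  -- ones, which is membership in `𝔫_v`.
  have hnv : n - phi E D vdot m n ∈ nv b vdot := by
    refine ⟨rootSum_mono (fun _ h ↦ h.1) (sub_mem hn hφn), c, rootSum_mono (fun _ h ↦ h.1) hc, hnc⟩
  rw [add_comm s z]
  refine Submodule.add_mem_sup (Submodule.add_mem_sup ?_ ⟨hs, (sub_eq_zero.mp hs0).symm⟩)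
    ⟨⟨_, sub_mem hn hφn⟩, hnv, psi_apply_of_sub hnil ⟨n, hn⟩ rfl⟩
  exact (mem_zPrime_iff E D hvdot hm hz).mpr ⟨ζ, hζ, hzζ⟩

end Twisted

end LagrangianNormalizer

end

open LagrangianNormalizer in
theorem theorem3p10 {g : Type*} [LieRing g] [LieAlgebra ℂ g] [FiniteDimensional ℂ g]
    [LieAlgebra.IsSemisimple ℂ g] {H : LieSubalgebra ℂ g} [H.IsCartanSubalgebra]
    (b : (LieAlgebra.IsKilling.rootSystem H).Base) (κ : AdInvariantForm g)
    (E : RootVectors b κ) (D : BDTriple b κ)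
    (V : Submodule ℂ (g × g)) (hV : IsLagrangianIn κ ((center D.S).prod (center D.T)) V)
    (v : (LieAlgebra.IsKilling.rootSystem H).weylGroup) (hv : IsMinRep b D.T v)
    (vdot : g ≃ₗ[ℂ] g) (hvdot : IsRepresentative v vdot)
    (m : g ≃ₗ[ℂ] g) (hm : m ∈ leviGroup (Svd D v)) :
    -- `φ` preserves `𝔤_{S(v,d)}` and is `Ad_vdot γ_d Ad_m⁻¹` there
    (∀ x ∈ gS κ (Svd D v), phi E D vdot m x ∈ gS κ (Svd D v) ∧
      (chi κ D.S (m.symm x) : g) = m.symm x) ∧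
    -- the two descriptions of `𝔷'_{S(v,d)}` agree
    (∀ z ∈ center (Svd D v),
      z ∈ zPrime E D v vdot ↔ z - phi E D vdot m z ∈ (center D.T).map (vdot : g →ₗ[ℂ] g)) ∧
    nv b vdot ≤ nS b (Svd D v) ∧
    -- `φ` is nilpotent on `𝔫_{S(v,d)}`, so that `ψ` is defined, and the normalizer is as claimed
    ∃ hφ : ∀ x ∈ nS b (Svd D v), phi E D vdot m x ∈ nS b (Svd D v),
      IsNilpotent ((phi E D vdot m).restrict hφ) ∧
      diagNormalizer (lagrTwisted E D V vdot m) =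
        zPrime E D v vdot ⊔ gFixed E D v vdot m ⊔
          ((nv b vdot).comap (nS b (Svd D v)).subtype).map (psi hφ) := by
  have hφ : ∀ x ∈ nS b (Svd D v), phi E D vdot m x ∈ nS b (Svd D v) :=
    fun _ ↦ phi_mem_nS E D hvdot hv hm
  have hnil := isNilpotent_phi_restrict E D hv hvdot hm hφ
  exact ⟨fun x hx ↦ ⟨phi_mem_gS E D hvdot hm hx, chi_of_mem κ
      (semisimplePart_mono κ (Svd_subset D v) (symm_mem_gS D hm hx))⟩,
    fun z ↦ mem_zPrime_iff E D hvdot hm, nv_le_nS D hvdot hv, hφ, hnil,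
    le_antisymm (diagNormalizer_le hV hvdot hm hφ hnil)
      (le_diagNormalizer hV hvdot hv hm hφ hnil)⟩
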